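/- Let $\mathcal H$ be a separable complex Hilbert space (inner product linear in the second argument), let $-\infty<a<b\le\infty$, and let $V:(a,b)\to\mathcal B(\mathcal H)$ be weakly measurable with $\|V(\cdot)\|_{\mathcal B(\mathcal H)}\in L^1_{\rm loc}((a,b);dx)$ and $V(x)=V(x)^*$ for a.e. $x\in(a,b)$. Put $\tau=-\frac{d^2}{dx^2}+V(\cdot)$. Let $H_{\max}$ be the maximal operator in $L^2((a,b);dx;\mathcal H)$: $H_{\max}u=\tau u$ for all $u\in L^2((a,b);dx;\mathcal H)\cap W^{2,1}_{\rm loc}((a,b);dx;\mathcal H)$ with $\tau u\in L^2((a,b);dx;\mathcal H)$. Assume that $a$ is a regular endpoint, i.e., $\|V(\cdot)\|\in L^1((a,c);dx)$ for some $c\in(a,b)$, and that $b$ is of limit-point type, i.e., $\lim_{x\uparrow b}[(u(x),v'(x))_{\mathcal H}-(u'(x),v(x))_{\mathcal H}]=0$ for all $u,v\in\operatorname{dom}(H_{\max})$. For self-adjoint $\alpha\in\mathcal B(\mathcal H)$ let $H_\alpha$ be the restriction of $H_{\max}$ to those $u\in\operatorname{dom}(H_{\max})$ with $\sin(\alpha)u'(a)+\cos(\alpha)u(a)=0$,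 and let $\rho(H_\alpha)$ be its resolvent set. Let $\theta_\alpha(z,\cdot),\phi_\alpha(z,\cdot)$ be the $\mathcal B(\mathcal H)$-valued (strong) solutions of $\tau Y=zY$ on $[a,b)$ with $$\theta_\alpha(z,a)=\phi_\alpha'(z,a)=\cos(\alpha),\qquad -\phi_\alpha(z,a)=\theta_\alpha'(z,a)=\sin(\alpha).$$ For $z\in\mathbb C\setminus\mathbb R$ let $\mathcal D_z=\{u\in\operatorname{dom}(H_{\max}) : H_{\max}u=zu\}$ and, for $u\in\mathcal D_z$, $\mathcal C_{1,\alpha,z}u=\cos(\alpha)u(a)+\sin(\alpha)u'(a)$, $\mathcal C_{2,\alpha,z}u=-\sin(\alpha)u(a)+\cos(\alpha)u'(a)$. Define $$m_\alpha(z)=\mathcal C_{2,\alpha,z}\,\mathcal C_{1,\alpha,z}^{-1},\qquad \psi_\alpha(z,x)=\theta_\alpha(z,x)+\phi_\alpha(z,x)m_\alpha(z),$$ and let $$G_\alpha(z,x,x')=\begin{cases}\phi_\alpha(z,x)\,\psi_\alpha(\overline z,x')^*, & a\le x\le x'<b,\\ \psi_\alpha(z,x)\,\phi_\alpha(\overline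 z,x')^*, & a\le x'\le x<b,\end{cases}$$ be the Green's function of $H_\alpha$. **Theorem.** Let $\alpha,\beta\in\mathcal B(\mathcal H)$ be self-adjoint. 1. $m_\alpha(z)$ is a well-defined operator in $\mathcal B(\mathcal H)$ for every $z\in\mathbb C\setminus\mathbb R$, and $m_\alpha$ is a bounded operator-valued Herglotz function: it is analytic on $\mathbb C_+=\{z : \operatorname{Im}z>0\}$ and $\operatorname{Im}(u,m_\alpha(z)u)_{\mathcal H}\ge0$ for all $u\in\mathcal H$, $z\in\mathbb C_+$. If $\mathcal H\ne\{0\}$, then $m_\alpha$ is not constant on $\mathbb C_+$. 2. For every $z\in\mathbb C\setminus\mathbb R$ the strong partial derivatives $\partial_xG_\alpha$, $\partial_{x'}G_\alpha$ and $\partial_x\partial_{x'}G_\alpha$ of $G_\alpha(z,x,x')$ exist for $a<x<x'<b$, and their strong limits $G_{\alpha,x}(z,a,a)$, $G_{\alpha,x'}(z,a,a)$, $G_{\alpha,x,x'}(z,a,a)$ as $x'\to a$, $a<x<x'$, exist in $\mathcal B(\mathcal H)$, and $$m_\alpha(z)=\big(-\sin(\alpha),\ \cos(\alpha)\big)\begin{pmatrix}G_\alpha(z,a,a)&G_{\alpha,x'}(z,a,a)\\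 G_{\alpha,x}(z,a,a)&G_{\alpha,x,x'}(z,a,a)\end{pmatrix}\begin{pmatrix}-\sin(\alpha)\\ \cos(\alpha)\end{pmatrix}.$$ 3. $\mathbb C\setminus\mathbb R\subseteq\rho(H_\alpha)$, and $m_\alpha$ extends from $\mathbb C\setminus\mathbb R$ to a $\mathcal B(\mathcal H)$-valued function that is analytic on $\rho(H_\alpha)$. 4. With $$\begin{pmatrix}A&B\\ C&D\end{pmatrix}=\begin{pmatrix}\cos(\beta)&\sin(\beta)\\ -\sin(\beta)&\cos(\beta)\end{pmatrix}\begin{pmatrix}\cos(\alpha)&-\sin(\alpha)\\ \sin(\alpha)&\cos(\alpha)\end{pmatrix},$$ for every $z\in\mathbb C\setminus\mathbb R$ the operator $A+Bm_\alpha(z)$ is boundedly invertible and $$m_\beta(z)=\big(C+Dm_\alpha(z)\big)\big(A+Bm_\alpha(z)\big)^{-1}.$$ -/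

import Mathlib

open Set Filter Topology MeasureTheory
open scoped ENNReal

noncomputable section

namespace WeylTitchmarsh

variable {H : Type*} [NormedAddCommGroup H] [InnerProductSpace ℂ H]

/-- The interval `(a, b)`, with `a` finite and `b ≤ ∞`. -/
def ivl (a : ℝ) (b : EReal) : Set ℝ := {x | a < x ∧ (x : EReal) < b}

/-- Lebesgue measure on `(a, b)`. -/
abbrev ivlMeasure (a : ℝ) (b : EReal) : Measure ℝ := volume.restrict (ivl a b)

/-- The Hilbert space `L²((a,b); dx; H)`. -/
abbrev L2 (H : Type*) [NormedAddCommGroup H] [InnerProductSpace ℂ H] (a : ℝ) (b : EReal) :=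
  Lp H 2 (ivlMeasure a b)

/-- `y` lies in `W^{2,1}_loc((a,b); dx; H)`, with first derivative `y'` and second derivative
`y''`: `y` is differentiable with derivative `y'`, and `y'` is locally absolutely continuous with
locally (Bochner) integrable density `y''`. -/
structure IsW21Loc (a : ℝ) (b : EReal) (y y' y'' : ℝ → H) : Prop where
  hasDerivAt : ∀ x ∈ ivl a b, HasDerivAt y (y' x) x
  locallyIntegrable : LocallyIntegrableOn y'' (ivl a b)
  integral_eq : ∀ x ∈ ivl a b, ∀ t ∈ ivl a b, y' t - y' x = ∫ s in x..t, y'' s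

/-- The differential expression `τ y = -y'' + V y`. -/
def tau (V : ℝ → H →L[ℂ] H) (y y'' : ℝ → H) : ℝ → H := fun x => -y'' x + V x (y x)

/-- `y ∈ dom(H_max)` with derivatives `y'`, `y''`. -/
structure IsMaxDomain (a : ℝ) (b : EReal) (V : ℝ → H →L[ℂ] H) (y y' y'' : ℝ → H) : Prop where
  w21 : IsW21Loc a b y y' y''
  memLp : MemLp y 2 (ivlMeasure a b)
  tau_memLp : MemLp (tau V y y'') 2 (ivlMeasure a b)

/-- The Wronskian `W_*(u,v) = (u, v') - (u', v)`, as a function of `x`. -/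
def wronskian (u u' v v' : ℝ → H) (x : ℝ) : ℂ := inner ℂ (u x) (v' x) - inner ℂ (u' x) (v x)

/-- The endpoint `b` is of limit-point type for `τ`: `W_*(u,v)(x) → 0` as `x ↑ b` for all
`u, v ∈ dom(H_max)`. -/
def IsLimitPoint (a : ℝ) (b : EReal) (V : ℝ → H →L[ℂ] H) : Prop :=
  ∀ u u' u'' v v' v'' : ℝ → H, IsMaxDomain a b V u u' u'' → IsMaxDomain a b V v v' v'' →
    Tendsto (wronskian u u' v v') (comap (fun x : ℝ => (x : EReal)) (𝓝[<] b)) (𝓝 0)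

/-- The standing assumptions on the potential: `V` is weakly measurable, `‖V‖ ∈ L¹_loc((a,b))`,
`V(x)` is self-adjoint a.e., `a` is a regular endpoint, and `b` is of limit-point type. -/
structure IsPotential [CompleteSpace H] (a : ℝ) (b : EReal) (V : ℝ → H →L[ℂ] H) : Prop where
  weaklyMeasurable : ∀ f g : H,
    AEStronglyMeasurable (fun x => inner ℂ f (V x g)) (ivlMeasure a b)
  locallyIntegrable : LocallyIntegrableOn (fun x => ‖V x‖) (ivl a b)
  selfAdjoint : ∀ᵐ x ∂(ivlMeasure a b), IsSelfAdjoint (V x)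
  regular_left : ∃ c ∈ ivl a b, IntegrableOn (fun x => ‖V x‖) (Ioc a c)
  limitPoint_right : IsLimitPoint a b V

/-- The boundary values of `y` and `y'` at the left endpoint are `y₀ = y(a)`, `y₁ = y'(a)`. -/
def HasBoundaryValues (a : ℝ) (y y' : ℝ → H) (y₀ y₁ : H) : Prop :=
  Tendsto y (𝓝[>] a) (𝓝 y₀) ∧ Tendsto y' (𝓝[>] a) (𝓝 y₁)

section operators

variable [CompleteSpace H]

/-- `sin(α)`, by the functional calculus of the self-adjoint operator `α`. -/
def opSin (α : H →L[ℂ] H) : H →L[ℂ] H := cfc Real.sin α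

/-- `cos(α)`, by the functional calculus of the self-adjoint operator `α`. -/
def opCos (α : H →L[ℂ] H) : H →L[ℂ] H := cfc Real.cos α

end operators

section Halpha

variable [CompleteSpace H]

/-- The graph of `H_α`, the restriction of `H_max` to the functions satisfying
`sin(α) u'(a) + cos(α) u(a) = 0`. -/
def graphHalpha (a : ℝ) (b : EReal) (V : ℝ → H →L[ℂ] H) (α : H →L[ℂ] H) :
    Submodule ℂ (L2 H a b × L2 H a b) where
  carrier := {p | ∃ (u u' u'' : ℝ → H) (u₀ u₁ : H), IsW21Loc a b u u' u'' ∧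
    p.1 =ᵐ[ivlMeasure a b] u ∧ p.2 =ᵐ[ivlMeasure a b] tau V u u'' ∧
    HasBoundaryValues a u u' u₀ u₁ ∧ opSin α u₁ + opCos α u₀ = 0}
  zero_mem' := by
    refine ⟨0, 0, 0, 0, 0, ⟨fun x _ => hasDerivAt_const x (0 : H), ?_, ?_⟩, ?_, ?_, ?_, ?_⟩
    · exact (locallyIntegrable_zero).locallyIntegrableOn _
    · intro x _ t _
      simp
    · exact Lp.coeFn_zero H 2 _
    · filter_upwards [Lp.coeFn_zero H 2 (ivlMeasure a b)] with x hx
      simpa [tau] using hx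
    · exact ⟨tendsto_const_nhds, tendsto_const_nhds⟩
    · simp
  add_mem' := by
    rintro ⟨p₁, p₂⟩ ⟨q₁, q₂⟩ ⟨u, u', u'', u₀, u₁, hu, hp₁, hp₂, hb, hc⟩
      ⟨w, w', w'', w₀, w₁, hw, hq₁, hq₂, hb', hc'⟩
    refine ⟨u + w, u' + w', u'' + w'', u₀ + w₀, u₁ + w₁, ⟨?_, ?_, ?_⟩, ?_, ?_, ?_, ?_⟩
    · exact fun x hx => (hu.1 x hx).add (hw.1 x hx)
    · exact hu.2.add hw.2
    · intro x hx t ht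
      have hsub : uIcc x t ⊆ ivl a b := by
        intro s hs
        rw [mem_uIcc] at hs
        rcases hs with hs | hs
        · exact ⟨hx.1.trans_le hs.1, lt_of_le_of_lt (EReal.coe_le_coe_iff.2 hs.2) ht.2⟩
        · exact ⟨ht.1.trans_le hs.1, lt_of_le_of_lt (EReal.coe_le_coe_iff.2 hs.2) hx.2⟩
      have i₁ : IntervalIntegrable u'' volume x t :=
        (hu.2.integrableOn_compact_subset hsub isCompact_uIcc).intervalIntegrable
      have i₂ : IntervalIntegrable w'' volume x t :=
        (hw.2.integrableOn_compact_subset hsub isCompact_uIcc).intervalIntegrable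
      have := intervalIntegral.integral_add i₁ i₂
      simp only [Pi.add_apply]
      rw [this, ← hu.3 x hx t ht, ← hw.3 x hx t ht]
      abel
    · filter_upwards [Lp.coeFn_add p₁ q₁, hp₁, hq₁] with x h1 h2 h3
      simp only [Prod.mk_add_mk] at *
      rw [h1, Pi.add_apply, h2, h3, Pi.add_apply]
    · filter_upwards [Lp.coeFn_add p₂ q₂, hp₂, hq₂] with x h1 h2 h3
      simp only [Prod.mk_add_mk] at *
      rw [h1, Pi.add_apply, h2, h3]
      simp only [tau, Pi.add_apply, map_add]
      abel
    · exact ⟨hb.1.add hb'.1, hb.2.add hb'.2⟩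
    · have : opSin α (u₁ + w₁) + opCos α (u₀ + w₀)
        = (opSin α u₁ + opCos α u₀) + (opSin α w₁ + opCos α w₀) := by
        simp only [map_add]; abel
      rw [this, hc, hc', add_zero]
  smul_mem' := by
    rintro k ⟨p₁, p₂⟩ ⟨u, u', u'', u₀, u₁, hu, hp₁, hp₂, hb, hc⟩
    refine ⟨k • u, k • u', k • u'', k • u₀, k • u₁, ⟨?_, ?_, ?_⟩, ?_, ?_, ?_, ?_⟩
    · exact fun x hx => (hu.1 x hx).const_smul k
    · exact hu.2.smul k
    · intro x hx t ht
      simp only [Pi.smul_apply]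
      rw [intervalIntegral.integral_smul, ← hu.3 x hx t ht, smul_sub]
    · filter_upwards [Lp.coeFn_smul k p₁, hp₁] with x h1 h2
      simp only [Prod.smul_mk] at *
      rw [h1, Pi.smul_apply, h2, Pi.smul_apply]
    · filter_upwards [Lp.coeFn_smul k p₂, hp₂] with x h1 h2
      simp only [Prod.smul_mk] at *
      rw [h1, Pi.smul_apply, h2]
      simp only [tau, Pi.smul_apply, map_smul, smul_add, smul_neg]
    · exact ⟨hb.1.const_smul k, hb.2.const_smul k⟩
    · have : opSin α (k • u₁) + opCos α (k • u₀) = k • (opSin α u₁ + opCos α u₀) := by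
        simp only [map_smul, smul_add]
      rw [this, hc, smul_zero]

/-- The operator `H_α` in `L²((a,b); dx; H)`. -/
def Halpha (a : ℝ) (b : EReal) (V : ℝ → H →L[ℂ] H) (α : H →L[ℂ] H) :
    L2 H a b →ₗ.[ℂ] L2 H a b :=
  (graphHalpha a b V α).toLinearPMap

theorem isOpen_ivl (a : ℝ) (b : EReal) : IsOpen (ivl a b) :=
  (isOpen_Ioi (a := a)).inter ((isOpen_Iio (a := b)).preimage continuous_coe_real_ereal)

theorem graphHalpha_single_valued (a : ℝ) (b : EReal) (V : ℝ → H →L[ℂ] H) (α : H →L[ℂ] H)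
    (p : L2 H a b × L2 H a b) (hp : p ∈ graphHalpha a b V α) (hp0 : p.1 = 0) : p.2 = 0 := by
  obtain ⟨u, u', u'', u₀, u₁, hu, h1, h2, -, -⟩ := hp
  have hu0 : ∀ᵐ x ∂(ivlMeasure a b), u x = 0 := by
    rw [hp0] at h1
    filter_upwards [h1, Lp.coeFn_zero H 2 (ivlMeasure a b)] with x hx hx'
    rw [← hx, hx', Pi.zero_apply]
  have hcont : ContinuousOn u (ivl a b) := fun x hx =>
    (hu.1 x hx).continuousAt.continuousWithinAt
  have hu_zero : EqOn u 0 (ivl a b) :=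
    Measure.eqOn_open_of_ae_eq hu0 (isOpen_ivl a b) hcont continuousOn_const
  have hu'_zero : ∀ x ∈ ivl a b, u' x = 0 := by
    intro x hx
    have : HasDerivAt u 0 x := (hasDerivAt_const x (0 : H)).congr_of_eventuallyEq
      (by filter_upwards [(isOpen_ivl a b).mem_nhds hx] with t ht using hu_zero ht)
    exact (hu.1 x hx).unique this
  have hsub : ∀ x ∈ ivl a b, ∀ t ∈ ivl a b, uIcc x t ⊆ ivl a b := by
    intro x hx t ht s hs
    rw [mem_uIcc] at hs
    rcases hs with hs | hs
    · exact ⟨hx.1.trans_le hs.1, lt_of_le_of_lt (EReal.coe_le_coe_iff.2 hs.2) ht.2⟩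
    · exact ⟨ht.1.trans_le hs.1, lt_of_le_of_lt (EReal.coe_le_coe_iff.2 hs.2) hx.2⟩
  have hall : ∀ᵐ x ∂(volume : Measure ℝ), ∀ p q : ℚ, (p : ℝ) ∈ ivl a b → (q : ℝ) ∈ ivl a b →
      x ∈ uIcc (p : ℝ) q → HasDerivAt (fun t => ∫ s in (p : ℝ)..t, u'' s) (u'' x) x := by
    rw [ae_all_iff]
    intro p
    rw [ae_all_iff]
    intro q
    by_cases hpq : (p : ℝ) ∈ ivl a b ∧ (q : ℝ) ∈ ivl a b
    · have i₁ : IntervalIntegrable u'' volume p q :=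
        (hu.2.integrableOn_compact_subset (hsub _ hpq.1 _ hpq.2) isCompact_uIcc).intervalIntegrable
      filter_upwards [i₁.ae_hasDerivAt_integral] with x hx _ _ hx'
      exact hx hx' _ left_mem_uIcc
    · exact Eventually.of_forall fun x h1 h2 => absurd ⟨h1, h2⟩ hpq
  have hu''_zero : ∀ᵐ x ∂(ivlMeasure a b), u'' x = 0 := by
    rw [ae_restrict_iff' (isOpen_ivl a b).measurableSet]
    filter_upwards [hall] with x hx hxI
    obtain ⟨l, r, hlr, hsubI⟩ := mem_nhds_iff_exists_Ioo_subset.1 ((isOpen_ivl a b).mem_nhds hxI)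
    obtain ⟨p, hp1, hp2⟩ := exists_rat_btwn hlr.1
    obtain ⟨q, hq1, hq2⟩ := exists_rat_btwn hlr.2
    have hpI : (p : ℝ) ∈ ivl a b := hsubI ⟨hp1, hp2.trans hlr.2⟩
    have hqI : (q : ℝ) ∈ ivl a b := hsubI ⟨hlr.1.trans hq1, hq2⟩
    have hd := hx p q hpI hqI (by rw [mem_uIcc]; exact Or.inl ⟨hp2.le, hq1.le⟩)
    have hz : HasDerivAt (fun t => ∫ s in (p : ℝ)..t, u'' s) 0 x := by
      refine (hasDerivAt_const x (0 : H)).congr_of_eventuallyEq ?_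
      filter_upwards [(isOpen_ivl a b).mem_nhds hxI] with t ht
      rw [← hu.3 p hpI t ht, hu'_zero _ hpI, hu'_zero _ ht, sub_zero]
    exact hd.unique hz
  apply Lp.ext
  filter_upwards [h2, hu0, hu''_zero, Lp.coeFn_zero H 2 (ivlMeasure a b)] with x e1 e2 e3 e4
  rw [e1, e4]
  simp [tau, e2, e3]

/-- `graphHalpha` is indeed the graph of the operator `Halpha`. -/
theorem graph_Halpha (a : ℝ) (b : EReal) (V : ℝ → H →L[ℂ] H) (α : H →L[ℂ] H) :
    (Halpha a b V α).graph = graphHalpha a b V α :=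
  Submodule.toLinearPMap_graph_eq _ (graphHalpha_single_valued a b V α)

end Halpha

/-- The resolvent set of a (generally unbounded) linear operator `T` in a normed space: those `z`
for which `T - z` is a bijection from `dom(T)` onto the space with a bounded inverse `R`. -/
def resolventSet {E : Type*} [NormedAddCommGroup E] [NormedSpace ℂ E] (T : E →ₗ.[ℂ] E) : Set ℂ :=
  {z | ∃ R : E →L[ℂ] E,
    (∀ f : E, ∃ h : R f ∈ T.domain, T ⟨R f, h⟩ - z • R f = f) ∧
    (∀ u : T.domain, R (T u - z • (u : E)) = u)}

section solutions

variable [CompleteSpace H]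

/-- `y` is a strong solution of `τ y = z y` on `(a,b)`, with derivative `y'`. -/
def IsSolution (a : ℝ) (b : EReal) (V : ℝ → H →L[ℂ] H) (z : ℂ) (y y' : ℝ → H) : Prop :=
  ∃ y'' : ℝ → H, IsW21Loc a b y y' y'' ∧ ∀ᵐ x ∂(ivlMeasure a b), tau V y y'' x = z • y x

/-- `Y` is a `B(H)`-valued solution of `τ Y = z Y` with derivative `Y'` and the initial values
`Y(a) = Y₀`, `Y'(a) = Y₁` at the left endpoint. -/
structure IsOpSolution (a : ℝ) (b : EReal) (V : ℝ → H →L[ℂ] H) (z : ℂ) (Y₀ Y₁ : H →L[ℂ] H)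
    (Y Y' : ℝ → H →L[ℂ] H) : Prop where
  solution : ∀ h : H, IsSolution a b V z (fun x => Y x h) (fun x => Y' x h)
  boundary : ∀ h : H,
    HasBoundaryValues a (fun x => Y x h) (fun x => Y' x h) (Y₀ h) (Y₁ h)
  left : Y a = Y₀
  left_deriv : Y' a = Y₁

open Classical in
/-- The solution of the initial value problem `τ Y = z Y`, `Y(a) = Y₀`, `Y'(a) = Y₁` on `[a, b)`
(only its values on `[a, b)`, where it is unique, are meaningful). -/
def opSolution (a : ℝ) (b : EReal) (V : ℝ → H →L[ℂ] H) (z : ℂ) (Y₀ Y₁ : H →L[ℂ] H) :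
    ℝ → H →L[ℂ] H :=
  if h : ∃ Y Y' : ℝ → H →L[ℂ] H, IsOpSolution a b V z Y₀ Y₁ Y Y' then h.choose else 0

/-- `θ_α(z, ·, a)`: `θ(a) = cos α`, `θ'(a) = sin α`. -/
def theta (a : ℝ) (b : EReal) (V : ℝ → H →L[ℂ] H) (α : H →L[ℂ] H) (z : ℂ) : ℝ → H →L[ℂ] H :=
  opSolution a b V z (opCos α) (opSin α)

/-- `φ_α(z, ·, a)`: `φ(a) = -sin α`, `φ'(a) = cos α`. -/
def phi (a : ℝ) (b : EReal) (V : ℝ → H →L[ℂ] H) (α : H →L[ℂ] H) (z : ℂ) : ℝ → H →L[ℂ] H :=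
  opSolution a b V z (-opSin α) (opCos α)

/-- The pairs `(𝒞_{1,α,z} u, 𝒞_{2,α,z} u)` for `u` in the space `𝒟_z` of square integrable
solutions of `τ u = z u`, where `𝒞_{1,α,z} u = cos(α) u(a) + sin(α) u'(a)` and
`𝒞_{2,α,z} u = -sin(α) u(a) + cos(α) u'(a)`. -/
def weylRelation (a : ℝ) (b : EReal) (V : ℝ → H →L[ℂ] H) (α : H →L[ℂ] H) (z : ℂ) : Set (H × H) :=
  {p | ∃ (u u' : ℝ → H) (u₀ u₁ : H), IsSolution a b V z u u' ∧ MemLp u 2 (ivlMeasure a b) ∧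
    HasBoundaryValues a u u' u₀ u₁ ∧
    p.1 = opCos α u₀ + opSin α u₁ ∧ p.2 = -opSin α u₀ + opCos α u₁}

/-- `M = 𝒞_{2,α,z} 𝒞_{1,α,z}⁻¹` as a bounded operator defined on all of `H`: the graph of `M` is
the set of pairs `(𝒞_{1,α,z} u, 𝒞_{2,α,z} u)`, `u ∈ 𝒟_z`. -/
def IsWeylM (a : ℝ) (b : EReal) (V : ℝ → H →L[ℂ] H) (α : H →L[ℂ] H) (z : ℂ)
    (M : H →L[ℂ] H) : Prop :=
  ∀ f g : H, (f, g) ∈ weylRelation a b V α z ↔ g = M f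

open Classical in
/-- The Weyl--Titchmarsh function `m_α(z) = 𝒞_{2,α,z} 𝒞_{1,α,z}⁻¹`, for nonreal `z`. -/
def weylM (a : ℝ) (b : EReal) (V : ℝ → H →L[ℂ] H) (α : H →L[ℂ] H) (z : ℂ) : H →L[ℂ] H :=
  if h : ∃ M : H →L[ℂ] H, IsWeylM a b V α z M then h.choose else 0

/-- The Weyl--Titchmarsh solution `ψ_α(z, x) = θ_α(z, x, a) + φ_α(z, x, a) m_α(z)`. -/
def psi (a : ℝ) (b : EReal) (V : ℝ → H →L[ℂ] H) (α : H →L[ℂ] H) (z : ℂ) (x : ℝ) : H →L[ℂ] H :=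
  theta a b V α z x + phi a b V α z x * weylM a b V α z

/-- The Green's function `G_α(z, x, x')` of `H_α`. -/
def green (a : ℝ) (b : EReal) (V : ℝ → H →L[ℂ] H) (α : H →L[ℂ] H) (z : ℂ) (x x' : ℝ) :
    H →L[ℂ] H :=
  if x ≤ x' then
    phi a b V α z x * ContinuousLinearMap.adjoint (psi a b V α (starRingEnd ℂ z) x')
  else
    psi a b V α z x * ContinuousLinearMap.adjoint (phi a b V α (starRingEnd ℂ z) x')

end solutions

/-- `L = s-lim F(x, x')` as `x' → a` with `a < x < x'`. -/
def IsStrongCornerLimit (a : ℝ) (F : ℝ → ℝ → H →L[ℂ] H) (L : H →L[ℂ] H) : Prop :=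
  ∀ h : H, Tendsto (fun p : ℝ × ℝ => F p.1 p.2 h)
    (𝓝[{p : ℝ × ℝ | a < p.1 ∧ p.1 < p.2}] (a, a)) (𝓝 (L h))

/-- In the region `a < x < x' < b` the strong partial derivatives `∂ₓ G`, `∂_{x'} G`,
`∂ₓ ∂_{x'} G` exist, and their strong limits at the corner `(a, a)` are `Gx`, `Gx'`, `Gxx'`. -/
def HasCornerDerivatives (a : ℝ) (b : EReal) (G : ℝ → ℝ → H →L[ℂ] H)
    (Gx Gx' Gxx' : H →L[ℂ] H) : Prop :=
  ∃ Dx Dx' Dxx' : ℝ → ℝ → H →L[ℂ] H,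
    (∀ x x' : ℝ, a < x → x < x' → (x' : EReal) < b → ∀ h : H,
      HasDerivAt (fun s => G s x' h) (Dx x x' h) x ∧
      HasDerivAt (fun t => G x t h) (Dx' x x' h) x' ∧
      HasDerivAt (fun s => Dx' s x' h) (Dxx' x x' h) x) ∧
    IsStrongCornerLimit a Dx Gx ∧ IsStrongCornerLimit a Dx' Gx' ∧ IsStrongCornerLimit a Dxx' Gxx'

/-- `M` is a bounded operator-valued Herglotz function on the open upper half-plane: it is
analytic there, and `(u, M(z) u)` has nonnegative imaginary part. -/
structure IsHerglotz (M : ℂ → H →L[ℂ] H) : Prop where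
  analytic : AnalyticOnNhd ℂ M {z | 0 < z.im}
  im_nonneg : ∀ z : ℂ, 0 < z.im → ∀ u : H, 0 ≤ (inner ℂ u (M z u)).im

section transfer

variable [CompleteSpace H]

/-- The block matrix `(A B; C D)` of the rotations for `β` and `α`. -/
def rotationMatrix (β α : H →L[ℂ] H) : Matrix (Fin 2) (Fin 2) (H →L[ℂ] H) :=
  !![opCos β, opSin β; -opSin β, opCos β] * !![opCos α, -opSin α; opSin α, opCos α]

end transfer

end WeylTitchmarsh

end

/-! Everything rests on Green's formula (`IsPotential.wronskian_left`). The Wronskian vanishes at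
the limit-point end, so pairings of square integrable solutions are determined by their Cauchy data
at `a`. There the pair (𝒞₁, 𝒞₂) is a symplectic change of coordinates (`symplectic_bc`).

If 𝒞₁u = 0, the boundary term disappears and |Im z| ‖u‖ ≤ ‖(H_α - z)u‖ (`SolvesBVP.norm_le`). Hence
H_α - z is injective with closed range. A vector orthogonal to the range must be φ_α(z̄,·)k; it then
lies in the kernel of H_α - z̄ and vanishes. This gives the resolvent R(z) for nonreal z
(`exists_resolvent`).

The same estimate makes 𝒞₁ injective on 𝒟_z. It is onto because R(z) applied to a suitable function
supported near `a` is, away from `a`, a solution that can be continued back to `a`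
(`exists_memLp_sol`). So m is defined, and its boundedness follows from |Im z| ‖u‖² ≤ ‖𝒞₁u‖ ‖𝒞₂u‖.

With Ψ_z h = ψ_α(z,·)h, Green's formula reads m(z) - m(w)* = (z - w̄) Ψ_w* Ψ_z (`inner_weylM_sub`).
Taking w = z̄ gives m(z̄)* = m(z), and w = z gives Im m ≥ 0. Since Ψ_z = (1 + (z - i)R(z))Ψ_i,
taking w = i expresses m(z) through the resolvent and gives the analytic extension.

The linear fractional formula describes the same space 𝒟_z in two rotated coordinate systems. The
Green's function formula comes from the initial values of φ and ψ. If m were constant, ψ(z,·)h would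
have Cauchy data independent of z and Im z ‖ψ‖² would be constant; but ψ stays near its initial
value on a length of order |z|^(-1/2), which is incompatible with z = iy, y → ∞ (`exists_weylM_ne`).
-/

noncomputable section

namespace WeylTitchmarsh

/-! ### Absolute continuity and powers of primitives. -/

section absolutelyContinuous

variable {E : Type*} [NormedAddCommGroup E] [NormedSpace ℝ E]

theorem absolutelyContinuousOnInterval_of_dist_le {E : Type*} [NormedAddCommGroup E] {F : ℝ → E}
    {g : ℝ → ℝ} {p q : ℝ}
    (hg : AbsolutelyContinuousOnInterval g p q)
    (h : ∀ s ∈ uIcc p q, ∀ t ∈ uIcc p q, dist (F s) (F t) ≤ dist (g s) (g t)) :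
    AbsolutelyContinuousOnInterval F p q := by
  rw [absolutelyContinuousOnInterval_iff] at hg ⊢
  intro ε hε
  obtain ⟨δ, hδ, H⟩ := hg ε hε
  refine ⟨δ, hδ, fun I hI hlen => lt_of_le_of_lt (Finset.sum_le_sum fun i hi => ?_) (H I hI hlen)⟩
  exact h _ (hI.1 i hi).1 _ (hI.1 i hi).2

theorem norm_integral_le_abs_integral {f : ℝ → E} {w : ℝ → ℝ} {p q s t : ℝ}
    (hw : IntervalIntegrable w volume p q) (hs : s ∈ uIcc p q) (ht : t ∈ uIcc p q)
    (h : ∀ x ∈ uIoc p q, ‖f x‖ ≤ w x) :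
    ‖∫ x in s..t, f x‖ ≤ |∫ x in s..t, w x| := by
  have hsub : uIcc s t ⊆ uIcc p q := uIcc_subset_uIcc hs ht
  refine intervalIntegral.norm_integral_le_abs_of_norm_le ?_ (hw.mono_set hsub)
  rw [ae_restrict_iff' measurableSet_uIoc]
  have hsub' : uIoc s t ⊆ uIoc p q := by
    intro x hx
    rw [mem_uIcc] at hs ht
    rw [mem_uIoc] at hx ⊢
    grind
  exact Eventually.of_forall fun x hx => h x (hsub' hx)

/-- Subtracting the primitive of `F'` leaves an absolutely continuous function with derivative zero
almost everywhere, hence a constant. Differentiability is assumed because it is not automatic for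
values in a general Banach space. -/
theorem integral_eq_sub_of_absolutelyContinuous {F F' : ℝ → E} {p q : ℝ}
    (hF : AbsolutelyContinuousOnInterval F p q) (hF' : IntervalIntegrable F' volume p q)
    (hd : ∀ᵐ x, x ∈ uIcc p q → HasDerivAt F (F' x) x) [CompleteSpace E] :
    ∫ x in p..q, F' x = F q - F p := by
  have hG : AbsolutelyContinuousOnInterval (fun x => ∫ s in p..x, F' s) p q := by
    refine absolutelyContinuousOnInterval_of_dist_le
      (hF'.norm.absolutelyContinuousOnInterval_intervalIntegral (c := p) left_mem_uIcc) ?_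
    intro s hs t ht
    have h1 : ∀ x ∈ uIcc p q, IntervalIntegrable F' volume p x := fun x hx =>
      hF'.mono_set (uIcc_subset_uIcc_left hx)
    rw [dist_eq_norm, Real.dist_eq, intervalIntegral.integral_interval_sub_left (h1 s hs) (h1 t ht),
      intervalIntegral.integral_interval_sub_left (h1 s hs).norm (h1 t ht).norm]
    exact norm_integral_le_abs_integral hF'.norm ht hs fun x _ => le_rfl
  obtain ⟨C, hC⟩ := (hF.sub hG).const_of_ae_hasDerivAt_zero (by
    filter_upwards [hd, hF'.ae_hasDerivAt_integral] with x h1 h2 hx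
    simpa using (h1 hx).sub (h2 hx p left_mem_uIcc))
  have h1 := hC p left_mem_uIcc
  have h2 := hC q right_mem_uIcc
  simp only [Pi.sub_apply, intervalIntegral.integral_same, sub_zero] at h1 h2
  rw [h1, ← h2]
  abel

/-- The fundamental theorem for the (n+1)-st power of the primitive, in its absolutely continuous
form because `w` is only integrable. It is the source of the factorials in the Picard iteration. -/
theorem integral_mul_primitive_pow {w : ℝ → ℝ} {p q : ℝ} (hw : IntervalIntegrable w volume p q)
    (n : ℕ) :
    ∫ x in p..q, w x * (∫ s in p..x, w s) ^ n = (∫ s in p..q, w s) ^ (n + 1) / (n + 1) := by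
  have hI := hw.absolutelyContinuousOnInterval_intervalIntegral (c := p) left_mem_uIcc
  have hpow : ∀ m : ℕ, AbsolutelyContinuousOnInterval
      (fun x => (∫ s in p..x, w s) ^ (m + 1)) p q := by
    intro m
    induction m with
    | zero => simpa using hI
    | succ m ih =>
      have := ih.fun_mul hI
      simpa [pow_succ] using this
  have hint : IntervalIntegrable (fun x => ((n + 1 : ℕ) : ℝ) * (∫ s in p..x, w s) ^ n * w x)
      volume p q :=
    hw.continuousOn_mul (continuousOn_const.mul (hI.continuousOn.pow n))
  have := integral_eq_sub_of_absolutelyContinuous (hpow n) hint (by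
    filter_upwards [hw.ae_hasDerivAt_integral] with x hx hx'
    simpa using (hx hx' p left_mem_uIcc).fun_pow (n + 1))
  simp only [intervalIntegral.integral_same, ne_eq, Nat.add_eq_zero_iff, one_ne_zero, and_false,
    not_false_eq_true, zero_pow, sub_zero] at this
  rw [eq_div_iff (by positivity), ← this, mul_comm, ← intervalIntegral.integral_const_mul]
  congr 1
  ext x
  push_cast
  ring

/-- The absolute values allow `q` on either side of `p`; to the left they only cost the sign (-1)^n.
-/
theorem abs_integral_mul_abs_primitive_pow {w : ℝ → ℝ} {p q : ℝ}
    (hw : IntervalIntegrable w volume p q) (h0 : ∀ x, 0 ≤ w x) (n : ℕ) :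
    |∫ x in p..q, w x * |∫ s in p..x, w s| ^ n| = |∫ s in p..q, w s| ^ (n + 1) / (n + 1) := by
  rcases le_total p q with hpq | hpq
  · have h : ∀ x, p ≤ x → |∫ s in p..x, w s| = ∫ s in p..x, w s := fun x hx =>
      abs_of_nonneg (intervalIntegral.integral_nonneg hx fun _ _ => h0 _)
    have : ∫ x in p..q, w x * |∫ s in p..x, w s| ^ n = ∫ x in p..q, w x *
        (∫ s in p..x, w s) ^ n := by
      refine intervalIntegral.integral_congr fun x hx => ?_
      rw [uIcc_of_le hpq] at hx
      simp only [h x hx.1]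
    rw [this, integral_mul_primitive_pow hw, h q hpq, abs_of_nonneg]
    have := h q hpq ▸ abs_nonneg _
    positivity
  · have h : ∀ x, x ≤ p → |∫ s in p..x, w s| = -∫ s in p..x, w s := fun x hx => by
      rw [intervalIntegral.integral_symm, abs_neg, neg_neg]
      exact abs_of_nonneg (intervalIntegral.integral_nonneg hx fun _ _ => h0 _)
    have : ∫ x in p..q, w x * |∫ s in p..x, w s| ^ n
        = (-1) ^ n * ∫ x in p..q, w x * (∫ s in p..x, w s) ^ n := by
      rw [← intervalIntegral.integral_const_mul]
      refine intervalIntegral.integral_congr fun x hx => ?_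
      rw [uIcc_of_ge hpq] at hx
      simp only [h x hx.2]
      rw [neg_pow]
      ring
    rw [this, integral_mul_primitive_pow hw, abs_mul, abs_div, abs_pow, abs_pow]
    simp only [abs_neg, abs_one, one_pow, one_mul]
    rw [abs_of_nonneg (by positivity : (0 : ℝ) ≤ n + 1)]

end absolutelyContinuous

/-! ### Linear Volterra equations in a Banach space. -/

section volterra

/-- On an order connected set of reals, continuity can be checked on compact subintervals. -/
theorem continuousOn_of_uIcc {X : Type*} [TopologicalSpace X] {J : Set ℝ} {f : ℝ → X}
    (h : ∀ p ∈ J, ∀ q ∈ J, ContinuousOn f (uIcc p q)) : ContinuousOn f J := by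
  intro x hx
  -- If `x` is the largest point of `J`, then `q = x` serves; otherwise any larger point does. With
  -- `p` chosen likewise, [p, q] is a neighbourhood of `x` within `J`.
  obtain ⟨q, hq, hxq, hq'⟩ : ∃ q ∈ J, x ≤ q ∧ ∃ V ∈ 𝓝 x, ∀ y ∈ J, y ∈ V → y ≤ q := by
    by_cases hq : ∃ q ∈ J, x < q
    · obtain ⟨q, hq, hxq⟩ := hq
      exact ⟨q, hq, hxq.le, Iio q, Iio_mem_nhds hxq, fun y _ hy => le_of_lt hy⟩
    · push Not at hq
      exact ⟨x, hx, le_rfl, univ, univ_mem, fun y hy _ => hq y hy⟩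
  obtain ⟨p, hp, hxp, hp'⟩ : ∃ p ∈ J, p ≤ x ∧ ∃ V ∈ 𝓝 x, ∀ y ∈ J, y ∈ V → p ≤ y := by
    by_cases hp : ∃ p ∈ J, p < x
    · obtain ⟨p, hp, hxp⟩ := hp
      exact ⟨p, hp, hxp.le, Ioi p, Ioi_mem_nhds hxp, fun y _ hy => le_of_lt hy⟩
    · push Not at hp
      exact ⟨x, hx, le_rfl, univ, univ_mem, fun y hy _ => hp y hy⟩
  obtain ⟨U, hU, hU'⟩ := hq'
  obtain ⟨V, hV, hV'⟩ := hp'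
  refine (h p hp q hq x ?_).mono_of_mem_nhdsWithin ?_
  · rw [uIcc_of_le (hxp.trans hxq)]
    exact ⟨hxp, hxq⟩
  · rw [uIcc_of_le (hxp.trans hxq)]
    filter_upwards [mem_nhdsWithin_of_mem_nhds hU, mem_nhdsWithin_of_mem_nhds hV,
      self_mem_nhdsWithin] with y h1 h2 h3
    exact ⟨hV' y h3 h2, hU' y h3 h1⟩

variable {E : Type*} [NormedAddCommGroup E] [NormedSpace ℝ E]

/-- A strongly measurable family of bounded operators `A` on the interval `J` with a locally
integrable bound `w`. -/
structure VolterraFamily (J : Set ℝ) (A : ℝ → E →L[ℝ] E) (w : ℝ → ℝ) : Prop where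
  ordConnected : J.OrdConnected
  meas : ∀ Y : ℝ → E, AEStronglyMeasurable Y (volume.restrict J) →
    AEStronglyMeasurable (fun x => A x (Y x)) (volume.restrict J)
  bound : ∀ x, ‖A x‖ ≤ w x
  integrable : ∀ p ∈ J, ∀ q ∈ J, IntervalIntegrable w volume p q

namespace VolterraFamily

variable {J : Set ℝ} {A : ℝ → E →L[ℝ] E} {w : ℝ → ℝ}

theorem uIcc_subset (hA : VolterraFamily J A w) {p q : ℝ} (hp : p ∈ J) (hq : q ∈ J) :
    uIcc p q ⊆ J :=
  hA.ordConnected.uIcc_subset hp hq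

theorem nonneg (hA : VolterraFamily J A w) (x : ℝ) : 0 ≤ w x :=
  (norm_nonneg _).trans (hA.bound x)

theorem intervalIntegrable_apply (hA : VolterraFamily J A w) {Y : ℝ → E} (hY : ContinuousOn Y J)
    {p q : ℝ} (hp : p ∈ J) (hq : q ∈ J) :
    IntervalIntegrable (fun x => A x (Y x)) volume p q := by
  have hsub := hA.uIcc_subset hp hq
  obtain ⟨C, hC⟩ := isCompact_uIcc.exists_bound_of_continuousOn (hY.mono hsub)
  refine ((hA.integrable p hp q hq).mul_const C).mono_fun' ?_ ?_
  · exact (hA.meas Y (hY.aestronglyMeasurable hA.ordConnected.measurableSet)).mono_measure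
      (Measure.restrict_mono (uIoc_subset_uIcc.trans hsub) le_rfl)
  · rw [EventuallyLE, ae_restrict_iff' measurableSet_uIoc]
    refine Eventually.of_forall fun x hx => (A x).le_of_opNorm_le_of_le (hA.bound x) ?_
    exact hC x (uIoc_subset_uIcc hx)

theorem continuousOn_integral_apply (hA : VolterraFamily J A w) {Y : ℝ → E}
    (hY : ContinuousOn Y J) {c : ℝ} (hc : c ∈ J) :
    ContinuousOn (fun x => ∫ s in c..x, A s (Y s)) J := by
  refine continuousOn_of_uIcc fun p hp q hq => ?_
  have h1 : ContinuousOn (fun x => ∫ s in p..x, A s (Y s)) (uIcc p q) :=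
    intervalIntegral.continuousOn_primitive_interval' (hA.intervalIntegrable_apply hY hp hq)
      left_mem_uIcc
  refine (h1.const_add (∫ s in c..p, A s (Y s))).congr fun x hx => ?_
  exact (intervalIntegral.integral_add_adjacent_intervals (hA.intervalIntegrable_apply hY hc hp)
    (hA.intervalIntegrable_apply hY hp (hA.uIcc_subset hp hq hx))).symm

theorem abs_integral_mono (hA : VolterraFamily J A w) {c x y : ℝ} (hc : c ∈ J) (hy : y ∈ J)
    (hx : x ∈ uIcc c y) : |∫ s in c..x, w s| ≤ |∫ s in c..y, w s| := by
  refine intervalIntegral.abs_integral_mono_interval ?_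
    (Eventually.of_forall fun x => hA.nonneg x) (hA.integrable c hc y hy)
  intro s hs
  rw [mem_uIcc] at hx
  rw [mem_uIoc] at hs ⊢
  grind

/-- Each integration raises the power of |∫ w| by one and divides by the new exponent, by
`abs_integral_mul_abs_primitive_pow`. -/
theorem iterate_bound (hA : VolterraFamily J A w) {c y M : ℝ} (hc : c ∈ J) (hy : y ∈ J)
    {d : ℕ → ℝ → E} (h0 : ∀ x ∈ uIcc c y, ‖d 0 x‖ ≤ M)
    (hd : ∀ n, ∀ x ∈ uIcc c y, d (n + 1) x = ∫ s in c..x, A s (d n s)) (n : ℕ) :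
    ∀ x ∈ uIcc c y, ‖d n x‖ ≤ M * (|∫ s in c..x, w s| ^ n / n.factorial) := by
  induction n with
  | zero => simpa using h0
  | succ n ih =>
    intro x hx
    have hxJ := hA.uIcc_subset hc hy hx
    have hM : 0 ≤ M := (norm_nonneg _).trans (h0 x hx)
    have hwx := hA.integrable c hc x hxJ
    have hcont : ContinuousOn (fun x => |∫ s in c..x, w s| ^ n) (uIcc c x) :=
      ((intervalIntegral.continuousOn_primitive_interval' hwx left_mem_uIcc).abs).pow n
    have hint : IntervalIntegrable
        (fun s => M / n.factorial * (w s * |∫ r in c..s, w r| ^ n)) volume c x :=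
      (hwx.mul_continuousOn hcont).const_mul _
    rw [hd n x hx]
    refine (norm_integral_le_abs_integral hint left_mem_uIcc right_mem_uIcc fun s hs => ?_).trans ?_
    · have hs' : s ∈ uIcc c y := uIcc_subset_uIcc_left hx (uIoc_subset_uIcc hs)
      refine ((A s).le_of_opNorm_le_of_le (hA.bound s) (ih s hs')).trans (le_of_eq ?_)
      ring
    · rw [intervalIntegral.integral_const_mul, abs_mul,
        abs_integral_mul_abs_primitive_pow hwx hA.nonneg, abs_of_nonneg (by positivity),
        Nat.factorial_succ]
      push_cast
      apply le_of_eq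
      field_simp

/-- A solution of the homogeneous equation is its own Picard iterate of every order, so
`iterate_bound` squeezes it below M Wⁿ/n! → 0. -/
theorem eq_zero (hA : VolterraFamily J A w) {c : ℝ} (hc : c ∈ J) {D : ℝ → E}
    (hD : ContinuousOn D J) (h : ∀ x ∈ J, D x = ∫ s in c..x, A s (D s)) : ∀ x ∈ J, D x = 0 := by
  intro x hx
  obtain ⟨M, hM⟩ := isCompact_uIcc.exists_bound_of_continuousOn (hD.mono (hA.uIcc_subset hc hx))
  have hb := fun n => hA.iterate_bound hc hx (d := fun _ => D) hM
    (fun _ t ht => h t (hA.uIcc_subset hc hx ht)) n x right_mem_uIcc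
  have hlim := (FloorSemiring.tendsto_pow_div_factorial_atTop (|∫ s in c..x, w s|)).const_mul M
  rw [mul_zero] at hlim
  exact norm_le_zero_iff.1 (ge_of_tendsto' hlim hb)

/-- The solution is the sum of the Picard iterates `d n` of `G`. Their factorial bounds give locally
uniform convergence and add up to the exponential bound. -/
theorem exists_solution [CompleteSpace E] (hA : VolterraFamily J A w) {c : ℝ} (hc : c ∈ J)
    {G : ℝ → E} (hG : ContinuousOn G J) :
    ∃ Y : ℝ → E, ContinuousOn Y J ∧ (∀ x ∈ J, Y x = G x + ∫ s in c..x, A s (Y s)) ∧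
      ∀ x ∈ J, ∀ M, (∀ s ∈ uIcc c x, ‖G s‖ ≤ M) → ‖Y x‖ ≤ M * Real.exp |∫ s in c..x, w s| := by
  let d : ℕ → ℝ → E := fun n => Nat.rec G (fun _ y x => ∫ s in c..x, A s (y s)) n
  have hd : ∀ n x, d (n + 1) x = ∫ s in c..x, A s (d n s) := fun n x => rfl
  have hdc : ∀ n, ContinuousOn (d n) J := by
    intro n
    induction n with
    | zero => exact hG
    | succ n ih => exact hA.continuousOn_integral_apply ih hc
  have hsum : ∀ N M : ℝ, Summable fun n : ℕ => M * (N ^ n / n.factorial) := fun N M =>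
    (Real.summable_pow_div_factorial N).mul_left M
  have hbound : ∀ y ∈ J, ∀ M, (∀ s ∈ uIcc c y, ‖G s‖ ≤ M) → ∀ n, ∀ x ∈ uIcc c y,
      ‖d n x‖ ≤ M * (|∫ s in c..x, w s| ^ n / n.factorial) := fun y hy M hM n =>
    hA.iterate_bound hc hy hM (fun n x _ => hd n x) n
  have hbound' : ∀ y ∈ J, ∀ M, (∀ s ∈ uIcc c y, ‖G s‖ ≤ M) → ∀ n, ∀ x ∈ uIcc c y,
      ‖d n x‖ ≤ M * (|∫ s in c..y, w s| ^ n / n.factorial) := by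
    intro y hy M hM n x hx
    have hM0 : 0 ≤ M := (norm_nonneg _).trans (hM x hx)
    refine (hbound y hy M hM n x hx).trans ?_
    have := hA.abs_integral_mono hc hy hx
    gcongr
  have hGb : ∀ y ∈ J, ∃ M, ∀ s ∈ uIcc c y, ‖G s‖ ≤ M := fun y hy =>
    isCompact_uIcc.exists_bound_of_continuousOn (hG.mono (hA.uIcc_subset hc hy))
  have hdsum : ∀ x ∈ J, Summable fun n => d n x := by
    intro x hx
    obtain ⟨M, hM⟩ := hGb x hx
    exact Summable.of_norm_bounded (hsum _ M) fun n => hbound x hx M hM n x right_mem_uIcc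
  have hYc : ∀ y ∈ J, ContinuousOn (fun x => ∑' n, d n x) (uIcc c y) := by
    intro y hy
    obtain ⟨M, hM⟩ := hGb y hy
    exact continuousOn_tsum (fun n => (hdc n).mono (hA.uIcc_subset hc hy)) (hsum _ M)
      fun n x hx => hbound' y hy M hM n x hx
  have hYJ : ContinuousOn (fun x => ∑' n, d n x) J := by
    refine continuousOn_of_uIcc fun p hp q hq => ?_
    -- Uniform convergence is available on intervals with one end point at `c`; two of them cover
    -- the interval between `p` and `q`.
    have h1 := (hYc p hp).union_of_isClosed (hYc q hq) isClosed_Icc isClosed_Icc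
    refine h1.mono fun x hx => ?_
    simp only [mem_union, mem_uIcc] at hx ⊢
    grind
  refine ⟨fun x => ∑' n, d n x, hYJ, fun x hx => ?_, fun x hx M hM => ?_⟩
  · obtain ⟨M, hM⟩ := hGb x hx
    have key : HasSum (fun n => ∫ s in c..x, A s (d n s)) (∫ s in c..x, A s (∑' n, d n s)) := by
      refine intervalIntegral.hasSum_integral_of_dominated_convergence
        (fun n s => w s * (M * (|∫ s in c..x, w s| ^ n / n.factorial))) ?_ ?_ ?_ ?_ ?_
      · exact fun n =>
          (hA.intervalIntegrable_apply (hdc n) hc hx).aestronglyMeasurable_restrict_uIoc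
      · refine fun n => Eventually.of_forall fun s hs => ?_
        exact (A s).le_of_opNorm_le_of_le (hA.bound s)
          (hbound' x hx M hM n s (uIoc_subset_uIcc hs))
      · exact Eventually.of_forall fun s _ => (hsum _ M).mul_left _
      · simp_rw [tsum_mul_left]
        exact (hA.integrable c hc x hx).mul_const _
      · exact Eventually.of_forall fun s hs =>
          (A s).hasSum (hdsum s (hA.uIcc_subset hc hx (uIoc_subset_uIcc hs))).hasSum
    beta_reduce
    rw [(hdsum x hx).tsum_eq_zero_add]
    congr 1
    exact key.tsum_eq
  · have h1 := tsum_of_norm_bounded ((hsum _ M).hasSum)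
      (fun n => hbound x hx M hM n x right_mem_uIcc)
    refine h1.trans (le_of_eq ?_)
    rw [tsum_mul_left, Real.exp_eq_exp_ℝ, NormedSpace.exp_eq_tsum_div]

end VolterraFamily

end volterra

/-! ### Weak and strong measurability in a separable Hilbert space. -/

section measurability

variable {H : Type*} [NormedAddCommGroup H] [InnerProductSpace ℂ H]

/-- Distinct members are at distance √2, so the balls of radius 1/2 around them are disjoint, and a
separable space has only countably many disjoint nonempty open sets. -/
theorem countable_of_orthonormal [TopologicalSpace.SeparableSpace H] {ι : Type*} {e : ι → H}
    (he : Orthonormal ℂ e) : Countable ι := by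
  refine Pairwise.countable_of_isOpen_disjoint (s := fun i => Metric.ball (e i) (1 / 2)) ?_
    (fun _ => Metric.isOpen_ball) fun i => ⟨e i, Metric.mem_ball_self (by norm_num)⟩
  intro i j hij
  refine Metric.ball_disjoint_ball ?_
  have h : ‖e i - e j‖ ^ 2 = 2 := by
    rw [@norm_sub_sq ℂ, he.1 i, he.1 j, he.2 hij]
    norm_num
  rw [dist_eq_norm]
  nlinarith [norm_nonneg (e i - e j)]

variable [CompleteSpace H] [TopologicalSpace.SeparableSpace H]

/-- Pettis' theorem: the expansion in a countable orthonormal basis exhibits `y` as a limit of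
measurable finite sums. -/
theorem aestronglyMeasurable_of_inner {X : Type*} [MeasurableSpace X] {μ : Measure X} {y : X → H}
    (h : ∀ f : H, AEStronglyMeasurable (fun x => inner ℂ f (y x)) μ) :
    AEStronglyMeasurable y μ := by
  obtain ⟨s, e, he⟩ := exists_hilbertBasis ℂ H
  have : Countable s := countable_of_orthonormal e.orthonormal
  refine aestronglyMeasurable_of_tendsto_ae (atTop : Filter (Finset s))
    (f := fun F x => ∑ i ∈ F, inner ℂ (e i) (y x) • e i) (fun F => ?_)
    (Eventually.of_forall fun x => ?_)
  · exact Finset.aestronglyMeasurable_fun_sum _ fun i _ => (h (e i)).smul_const _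
  · have := e.hasSum_repr (y x)
    simpa only [e.repr_apply_apply, HasSum, SummationFilter.unconditional_filter] using this

/-- A weakly measurable `V` need not be measurable in operator norm, so only `V x (y x)` is
considered. It is the sum of the vectors `V x (e i)`, weighted by the coordinates of `y x`. -/
theorem aestronglyMeasurable_apply {X : Type*} [MeasurableSpace X] {μ : Measure X}
    {V : X → H →L[ℂ] H} (hV : ∀ f g : H, AEStronglyMeasurable (fun x => inner ℂ f (V x g)) μ)
    {y : X → H} (hy : AEStronglyMeasurable y μ) : AEStronglyMeasurable (fun x => V x (y x)) μ := by
  obtain ⟨s, e, he⟩ := exists_hilbertBasis ℂ H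
  have : Countable s := countable_of_orthonormal e.orthonormal
  refine aestronglyMeasurable_of_tendsto_ae (atTop : Filter (Finset s))
    (f := fun F x => ∑ i ∈ F, inner ℂ (e i) (y x) • V x (e i)) (fun F => ?_)
    (Eventually.of_forall fun x => ?_)
  · exact Finset.aestronglyMeasurable_fun_sum _ fun i _ =>
      (aestronglyMeasurable_const.inner hy).smul
        (aestronglyMeasurable_of_inner fun f => hV f (e i))
  · have := (V x).hasSum (e.hasSum_repr (y x))
    simpa only [e.repr_apply_apply, map_smul, HasSum,
      SummationFilter.unconditional_filter] using this

end measurability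

/-! ### Indefinite integrals on an interval and the product rule. -/

section primitives

variable {E : Type*} [NormedAddCommGroup E]

/-- `f` is integrable on all compact subintervals of `J` with end points in `J`. -/
def LocInt (J : Set ℝ) (f : ℝ → E) : Prop :=
  ∀ p ∈ J, ∀ q ∈ J, IntervalIntegrable f volume p q

variable {J : Set ℝ}

theorem LocInt.add {f g : ℝ → E} (hf : LocInt J f) (hg : LocInt J g) :
    LocInt J (fun x => f x + g x) := fun p hp q hq => (hf p hp q hq).add (hg p hp q hq)

theorem LocInt.sub {f g : ℝ → E} (hf : LocInt J f) (hg : LocInt J g) :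
    LocInt J (fun x => f x - g x) := fun p hp q hq => (hf p hp q hq).sub (hg p hp q hq)

theorem LocInt.zero : LocInt J (fun _ => (0 : E)) := fun _ _ _ _ => by simp

theorem LocInt.mono {J' : Set ℝ} {f : ℝ → E} (hf : LocInt J f) (h : J' ⊆ J) : LocInt J' f :=
  fun p hp q hq => hf p (h hp) q (h hq)

theorem locInt_of_continuousOn (hJ : J.OrdConnected) {f : ℝ → E} (hf : ContinuousOn f J) :
    LocInt J f := fun _ hp _ hq =>
  (hf.mono (hJ.uIcc_subset hp hq)).intervalIntegrable

theorem restrict_uIoc_le (hJ : J.OrdConnected) {p q : ℝ} (hp : p ∈ J) (hq : q ∈ J) :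
    volume.restrict (uIoc p q) ≤ volume.restrict J :=
  Measure.restrict_mono (uIoc_subset_uIcc.trans (hJ.uIcc_subset hp hq)) le_rfl

theorem LocInt.congr (hJ : J.OrdConnected) {f g : ℝ → E} (hf : LocInt J f)
    (h : f =ᵐ[volume.restrict J] g) : LocInt J g := fun p hp q hq =>
  (hf p hp q hq).congr_ae (ae_mono (restrict_uIoc_le hJ hp hq) h)

variable [NormedSpace ℝ E]

/-- `y` is an indefinite integral of `y'` on `J`. -/
structure IsPrim (J : Set ℝ) (y y' : ℝ → E) : Prop where
  locInt : LocInt J y'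
  sub_eq : ∀ x ∈ J, ∀ t ∈ J, y t - y x = ∫ s in x..t, y' s

theorem integral_congr_of_ae (hJ : J.OrdConnected) {f g : ℝ → E}
    (h : f =ᵐ[volume.restrict J] g) {p q : ℝ} (hp : p ∈ J) (hq : q ∈ J) :
    ∫ x in p..q, f x = ∫ x in p..q, g x :=
  intervalIntegral.integral_congr_ae_restrict
    (ae_mono (restrict_uIoc_le hJ hp hq) h)

namespace IsPrim

variable {y y' : ℝ → E}

theorem of_base {c : ℝ} (hc : c ∈ J) (h' : LocInt J y')
    (h : ∀ x ∈ J, y x = y c + ∫ s in c..x, y' s) : IsPrim J y y' := by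
  refine ⟨h', fun x hx t ht => ?_⟩
  rw [h x hx, h t ht, add_sub_add_left_eq_sub,
    intervalIntegral.integral_interval_sub_left (h' c hc t ht) (h' c hc x hx)]

theorem eq_add (h : IsPrim J y y') {x t : ℝ} (hx : x ∈ J) (ht : t ∈ J) :
    y t = y x + ∫ s in x..t, y' s := by
  rw [← h.sub_eq x hx t ht]; abel

theorem mono {J' : Set ℝ} (h : IsPrim J y y') (hJ : J' ⊆ J) : IsPrim J' y y' :=
  ⟨h.locInt.mono hJ, fun x hx t ht => h.sub_eq x (hJ hx) t (hJ ht)⟩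

theorem congr_ae (hJ : J.OrdConnected) {g : ℝ → E} (h : IsPrim J y y')
    (hg : y' =ᵐ[volume.restrict J] g) : IsPrim J y g :=
  ⟨h.locInt.congr hJ hg, fun x hx t ht => by
    rw [h.sub_eq x hx t ht, integral_congr_of_ae hJ hg hx ht]⟩

theorem continuousOn (hJ : J.OrdConnected) (h : IsPrim J y y') : ContinuousOn y J := by
  refine continuousOn_of_uIcc fun p hp q hq => ?_
  have h1 : ContinuousOn (fun x => ∫ s in p..x, y' s) (uIcc p q) :=
    intervalIntegral.continuousOn_primitive_interval' (h.locInt p hp q hq) left_mem_uIcc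
  exact (h1.const_add (y p)).congr fun x hx => h.eq_add hp (hJ.uIcc_subset hp hq hx)

theorem hasDerivAt_ae [CompleteSpace E] (hJ : J.OrdConnected) (h : IsPrim J y y') {p q : ℝ}
    (hp : p ∈ J) (hq : q ∈ J) : ∀ᵐ x, x ∈ uIcc p q → HasDerivAt y (y' x) x := by
  have h1 : ∀ᵐ x : ℝ, x ≠ p := by simp [ae_iff, measure_singleton]
  have h2 : ∀ᵐ x : ℝ, x ≠ q := by simp [ae_iff, measure_singleton]
  filter_upwards [(h.locInt p hp q hq).ae_hasDerivAt_integral, h1, h2] with x hx hxp hxq hxm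
  refine ((hx hxm p left_mem_uIcc).const_add (y p)).congr_of_eventuallyEq ?_
  have : uIcc p q ∈ 𝓝 x := by
    rw [uIcc] at hxm ⊢
    refine Icc_mem_nhds (lt_of_le_of_ne hxm.1 ?_) (lt_of_le_of_ne hxm.2 ?_)
    · rcases min_choice p q with e | e <;> rw [e] <;> tauto
    · rcases max_choice p q with e | e <;> rw [e] <;> tauto
  filter_upwards [this] with t ht
  exact h.eq_add hp (hJ.uIcc_subset hp hq ht)

theorem hasDerivAt [CompleteSpace E] (h : IsPrim J y y') (hy' : ContinuousOn y' J)
    {x : ℝ} (hx : J ∈ 𝓝 x) : HasDerivAt y (y' x) x := by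
  have hxJ := mem_of_mem_nhds hx
  have hd : HasDerivAt (fun t => ∫ s in x..t, y' s) (y' x) x := by
    refine intervalIntegral.integral_hasDerivAt_right (by simp) ?_ (hy'.continuousAt hx)
    obtain ⟨l, r, hlr, hI⟩ := mem_nhds_iff_exists_Ioo_subset.1 hx
    exact (hy'.mono hI).stronglyMeasurableAtFilter isOpen_Ioo x hlr
  refine (hd.const_add (y x)).congr_of_eventuallyEq ?_
  filter_upwards [hx] with t ht using h.eq_add hxJ ht

theorem add {g g' : ℝ → E} (h : IsPrim J y y') (hg : IsPrim J g g') :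
    IsPrim J (fun x => y x + g x) (fun x => y' x + g' x) :=
  ⟨h.locInt.add hg.locInt, fun x hx t ht => by
    rw [intervalIntegral.integral_add (h.locInt x hx t ht) (hg.locInt x hx t ht),
      ← h.sub_eq x hx t ht, ← hg.sub_eq x hx t ht]
    abel⟩

theorem sub {g g' : ℝ → E} (h : IsPrim J y y') (hg : IsPrim J g g') :
    IsPrim J (fun x => y x - g x) (fun x => y' x - g' x) :=
  ⟨h.locInt.sub hg.locInt, fun x hx t ht => by
    rw [intervalIntegral.integral_sub (h.locInt x hx t ht) (hg.locInt x hx t ht),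
      ← h.sub_eq x hx t ht, ← hg.sub_eq x hx t ht]
    abel⟩

theorem dist_le [CompleteSpace E] (hJ : J.OrdConnected) (h : IsPrim J y y') {w : ℝ → ℝ}
    {p q s t : ℝ}
    (hp : p ∈ J) (hq : q ∈ J)
    (hw : IntervalIntegrable w volume p q) (hs : s ∈ uIcc p q) (ht : t ∈ uIcc p q)
    (hb : ∀ x ∈ uIoc p q, ‖y' x‖ ≤ w x) : ‖y t - y s‖ ≤ |∫ x in s..t, w x| := by
  rw [h.sub_eq s (hJ.uIcc_subset hp hq hs) t (hJ.uIcc_subset hp hq ht)]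
  exact norm_integral_le_abs_integral hw hs ht hb

end IsPrim

theorem IsPrim.const_smul {𝕜 : Type*} [NontriviallyNormedField 𝕜] [NormedSpace 𝕜 E]
    [SMulCommClass ℝ 𝕜 E] {y y' : ℝ → E} (h : IsPrim J y y') (k : 𝕜) :
    IsPrim J (fun x => k • y x) (fun x => k • y' x) :=
  ⟨fun p hp q hq => (h.locInt p hp q hq).smul k, fun x hx t ht => by
    rw [intervalIntegral.integral_smul, ← h.sub_eq x hx t ht, smul_sub]⟩

/-- The product rule for the inner product of two indefinite integrals. -/
theorem IsPrim.inner_sub_inner {H : Type*} [NormedAddCommGroup H] [InnerProductSpace ℂ H]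
    [CompleteSpace H] (hJ : J.OrdConnected) {y y' g g' : ℝ → H} (h : IsPrim J y y')
    (hg : IsPrim J g g') {p q : ℝ} (hp : p ∈ J) (hq : q ∈ J) :
    IntervalIntegrable (fun x => inner ℂ (y x) (g' x) + inner ℂ (y' x) (g x)) volume p q ∧
    inner ℂ (y q) (g q) - inner ℂ (y p) (g p) =
      ∫ x in p..q, (inner ℂ (y x) (g' x) + inner ℂ (y' x) (g x)) := by
  have hsub := hJ.uIcc_subset hp hq
  have cy := (h.continuousOn hJ).mono hsub
  have cg := (hg.continuousOn hJ).mono hsub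
  have iy := h.locInt p hp q hq
  have ig := hg.locInt p hp q hq
  obtain ⟨C, hC⟩ := isCompact_uIcc.exists_bound_of_continuousOn cy
  obtain ⟨D, hD⟩ := isCompact_uIcc.exists_bound_of_continuousOn cg
  have i1 : IntervalIntegrable (fun x => inner ℂ (y x) (g' x)) volume p q := by
    refine (ig.norm.const_mul C).mono_fun' ?_ ?_
    · exact ((cy.mono uIoc_subset_uIcc).aestronglyMeasurable measurableSet_uIoc).inner
        ig.aestronglyMeasurable_restrict_uIoc
    · rw [EventuallyLE, ae_restrict_iff' measurableSet_uIoc]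
      refine Eventually.of_forall fun x hx => (norm_inner_le_norm _ _).trans ?_
      have := hC x (uIoc_subset_uIcc hx)
      gcongr
  have i2 : IntervalIntegrable (fun x => inner ℂ (y' x) (g x)) volume p q := by
    refine (iy.norm.mul_const D).mono_fun' ?_ ?_
    · exact iy.aestronglyMeasurable_restrict_uIoc.inner
        ((cg.mono uIoc_subset_uIcc).aestronglyMeasurable measurableSet_uIoc)
    · rw [EventuallyLE, ae_restrict_iff' measurableSet_uIoc]
      refine Eventually.of_forall fun x hx => (norm_inner_le_norm _ _).trans ?_
      have := hD x (uIoc_subset_uIcc hx)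
      gcongr
  refine ⟨i1.add i2, ?_⟩
  refine (integral_eq_sub_of_absolutelyContinuous (F := fun x => inner ℂ (y x) (g x))
    ?_ (i1.add i2) ?_).symm
  -- Increments of the inner product are dominated by those of the primitive of D‖y'‖ + C‖g'‖, which
  -- is absolutely continuous.
  · have hw : IntervalIntegrable (fun x => D * ‖y' x‖ + C * ‖g' x‖) volume p q :=
      (iy.norm.const_mul D).add (ig.norm.const_mul C)
    refine absolutelyContinuousOnInterval_of_dist_le
      (hw.absolutelyContinuousOnInterval_intervalIntegral (c := p) left_mem_uIcc) ?_
    intro s hs t ht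
    have hC0 : 0 ≤ C := (norm_nonneg _).trans (hC s hs)
    have hD0 : 0 ≤ D := (norm_nonneg _).trans (hD s hs)
    have hw' : ∀ x ∈ uIcc p q, IntervalIntegrable (fun x => D * ‖y' x‖ + C * ‖g' x‖) volume p x :=
      fun x hx => hw.mono_set (uIcc_subset_uIcc_left hx)
    rw [Real.dist_eq, intervalIntegral.integral_interval_sub_left (hw' s hs) (hw' t ht),
      dist_eq_norm]
    have e : inner ℂ (y s) (g s) - inner ℂ (y t) (g t)
        = inner ℂ (y s - y t) (g s) + inner ℂ (y t) (g s - g t) := by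
      rw [inner_sub_left, inner_sub_right]; ring
    have hts : uIcc t s ⊆ uIcc p q := uIcc_subset_uIcc ht hs
    rw [e, intervalIntegral.integral_add ((iy.norm.const_mul D).mono_set hts)
      ((ig.norm.const_mul C).mono_set hts), intervalIntegral.integral_const_mul,
      intervalIntegral.integral_const_mul]
    have a1 := h.dist_le hJ hp hq iy.norm ht hs fun x _ => le_rfl
    have a2 := hg.dist_le hJ hp hq ig.norm ht hs fun x _ => le_rfl
    have b1 : ‖inner ℂ (y s - y t) (g s)‖ ≤ D * |∫ x in t..s, ‖y' x‖| := by
      rw [mul_comm]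
      exact (norm_inner_le_norm _ _).trans (mul_le_mul a1 (hD s hs) (norm_nonneg _) (abs_nonneg _))
    have b2 : ‖inner ℂ (y t) (g s - g t)‖ ≤ C * |∫ x in t..s, ‖g' x‖| :=
      (norm_inner_le_norm _ _).trans (mul_le_mul (hC t ht) a2 (norm_nonneg _) hC0)
    refine (norm_add_le _ _).trans ((add_le_add b1 b2).trans (le_of_eq ?_))
    rcases le_total t s with hle | hle
    · have p1 := intervalIntegral.integral_nonneg (μ := volume) (f := fun x => ‖y' x‖) hle
        fun _ _ => norm_nonneg _
      have p2 := intervalIntegral.integral_nonneg (μ := volume) (f := fun x => ‖g' x‖) hle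
          fun _ _ => norm_nonneg _
      rw [abs_of_nonneg p1, abs_of_nonneg p2, abs_of_nonneg (by positivity)]
    · have p1 := intervalIntegral.integral_nonneg (μ := volume) (f := fun x => ‖y' x‖) hle
        fun _ _ => norm_nonneg _
      have p2 := intervalIntegral.integral_nonneg (μ := volume) (f := fun x => ‖g' x‖) hle
          fun _ _ => norm_nonneg _
      rw [intervalIntegral.integral_symm s t, intervalIntegral.integral_symm s t, abs_neg, abs_neg,
        abs_of_nonneg p1, abs_of_nonneg p2, mul_neg, mul_neg, ← neg_add, abs_neg,
        abs_of_nonneg (by positivity)]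
  · filter_upwards [h.hasDerivAt_ae hJ hp hq, hg.hasDerivAt_ae hJ hp hq] with x h1 h2 hx
    exact (h1 hx).inner ℂ (h2 hx)

end primitives

/-! ### The initial value problem and the Lagrange identity. -/

section initialValueProblem

variable {H : Type*} [NormedAddCommGroup H] [InnerProductSpace ℂ H]

/-- A potential on the interval `J` that is integrable on its compact subintervals. -/
structure LocPotential (J : Set ℝ) (V : ℝ → H →L[ℂ] H) : Prop where
  ordConnected : J.OrdConnected
  meas : ∀ y : ℝ → H, AEStronglyMeasurable y (volume.restrict J) →
    AEStronglyMeasurable (fun x => V x (y x)) (volume.restrict J)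
  locInt : LocInt J (fun x => ‖V x‖)

/-- The second derivative of a solution of `(τ - z) u = f`. -/
def secondDeriv (V : ℝ → H →L[ℂ] H) (z : ℂ) (f u : ℝ → H) : ℝ → H :=
  fun x => V x (u x) - z • u x - f x

/-- `u` is a solution of `(τ - z) u = f` on `J` with derivative `u'`. -/
structure Sol (J : Set ℝ) (V : ℝ → H →L[ℂ] H) (z : ℂ) (f u u' : ℝ → H) : Prop where
  prim : IsPrim J u u'
  prim' : IsPrim J u' (secondDeriv V z f u)

/-- The operator of the first order system for `(u, u')`. -/
def sysOp (V : ℝ → H →L[ℂ] H) (z : ℂ) (x : ℝ) : H × H →L[ℝ] H × H :=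
  ((ContinuousLinearMap.snd ℂ H H).prod
    ((V x - z • ContinuousLinearMap.id ℂ H) ∘L ContinuousLinearMap.fst ℂ H H)).restrictScalars ℝ

theorem sysOp_apply (V : ℝ → H →L[ℂ] H) (z : ℂ) (x : ℝ) (p : H × H) :
    sysOp V z x p = (p.2, V x p.1 - z • p.1) := by
  simp [sysOp]

theorem norm_sysOp_le (V : ℝ → H →L[ℂ] H) (z : ℂ) (x : ℝ) :
    ‖sysOp V z x‖ ≤ 1 + ‖V x‖ + ‖z‖ := by
  refine ContinuousLinearMap.opNorm_le_bound _ (by positivity) fun p => ?_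
  rw [sysOp_apply, Prod.norm_def]
  have h1 : ‖p.1‖ ≤ ‖p‖ := norm_fst_le p
  have h2 : ‖p.2‖ ≤ ‖p‖ := norm_snd_le p
  have h3 := norm_nonneg (V x)
  have h4 := norm_nonneg z
  have h5 := norm_nonneg p
  refine max_le ?_ ?_
  · nlinarith [mul_nonneg h3 h5, mul_nonneg h4 h5]
  · have a1 : ‖V x p.1‖ ≤ ‖V x‖ * ‖p‖ := (V x).le_of_opNorm_le_of_le le_rfl h1
    have a2 : ‖z • p.1‖ ≤ ‖z‖ * ‖p‖ := by rw [norm_smul]; gcongr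
    have := norm_sub_le (V x p.1) (z • p.1)
    nlinarith

variable {J : Set ℝ} {V : ℝ → H →L[ℂ] H} {z : ℂ}

/-- The field `meas` speaks of functions measurable on the larger set, so `y` is extended by zero
outside `J'`. -/
theorem LocPotential.mono {J' : Set ℝ} (hV : LocPotential J V) (h : J' ⊆ J)
    (hJ' : J'.OrdConnected) : LocPotential J' V where
  ordConnected := hJ'
  locInt := hV.locInt.mono h
  meas y hy := by
    have h1 := hV.meas (J'.indicator y) (by
      rw [aestronglyMeasurable_indicator_iff hJ'.measurableSet]
      exact hy.mono_measure (Measure.restrict_mono_measure Measure.restrict_le_self _) )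
    refine (h1.mono_measure (Measure.restrict_mono h le_rfl)).congr ?_
    rw [EventuallyEq, ae_restrict_iff' hJ'.measurableSet]
    exact Eventually.of_forall fun x hx => by simp [hx]

theorem LocPotential.volterraFamily (hV : LocPotential J V) (z : ℂ) :
    VolterraFamily J (sysOp V z) (fun x => 1 + ‖V x‖ + ‖z‖) where
  ordConnected := hV.ordConnected
  meas Y hY := by
    simp only [sysOp_apply]
    exact hY.snd.prodMk ((hV.meas _ hY.fst).sub (hY.fst.const_smul z))
  bound := norm_sysOp_le V z
  integrable p hp q hq :=
    (intervalIntegrable_const.add (hV.locInt p hp q hq)).add intervalIntegrable_const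

/-- The function is the second component of the system operator with parameter 0 applied to (u, 0).
-/
theorem LocPotential.locInt_apply (hV : LocPotential J V) {u : ℝ → H} (hu : ContinuousOn u J) :
    LocInt J (fun x => V x (u x)) := fun p hp q hq => by
  have := (hV.volterraFamily 0).intervalIntegrable_apply
    (hu.prodMk (continuousOn_const (c := (0 : H)))) hp hq
  simp only [sysOp_apply, zero_smul, sub_zero] at this
  rw [intervalIntegrable_iff] at this ⊢
  exact this.snd

theorem LocPotential.locInt_secondDeriv (hV : LocPotential J V) {f u : ℝ → H}
    (hu : ContinuousOn u J) (hf : LocInt J f) : LocInt J (secondDeriv V z f u) :=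
  ((hV.locInt_apply hu).sub
    (locInt_of_continuousOn hV.ordConnected (hu.const_smul z))).sub hf

variable {f u u' : ℝ → H}

namespace Sol

theorem continuousOn (hJ : J.OrdConnected) (h : Sol J V z f u u') : ContinuousOn u J :=
  h.prim.continuousOn hJ

theorem continuousOn' (hJ : J.OrdConnected) (h : Sol J V z f u u') : ContinuousOn u' J :=
  h.prim'.continuousOn hJ

theorem mono {J' : Set ℝ} (h : Sol J V z f u u') (hJ : J' ⊆ J) : Sol J' V z f u u' :=
  ⟨h.prim.mono hJ, h.prim'.mono hJ⟩

theorem congr_ae (hJ : J.OrdConnected) {g : ℝ → H} (h : Sol J V z f u u')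
    (hg : f =ᵐ[volume.restrict J] g) : Sol J V z g u u' :=
  ⟨h.prim, h.prim'.congr_ae hJ (by
    filter_upwards [hg] with x hx
    simp only [secondDeriv, hx])⟩

theorem add {g v v' : ℝ → H} (h : Sol J V z f u u') (hv : Sol J V z g v v') :
    Sol J V z (fun x => f x + g x) (fun x => u x + v x) (fun x => u' x + v' x) := by
  refine ⟨h.prim.add hv.prim, ?_⟩
  convert h.prim'.add hv.prim' using 1
  funext x
  simp only [secondDeriv, map_add, smul_add]
  abel

theorem sub {g v v' : ℝ → H} (h : Sol J V z f u u') (hv : Sol J V z g v v') :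
    Sol J V z (fun x => f x - g x) (fun x => u x - v x) (fun x => u' x - v' x) := by
  refine ⟨h.prim.sub hv.prim, ?_⟩
  convert h.prim'.sub hv.prim' using 1
  funext x
  simp only [secondDeriv, map_sub, smul_sub]
  abel

theorem const_smul (h : Sol J V z f u u') (k : ℂ) :
    Sol J V z (fun x => k • f x) (fun x => k • u x) (fun x => k • u' x) := by
  refine ⟨h.prim.const_smul k, ?_⟩
  convert h.prim'.const_smul k using 1
  funext x
  simp only [secondDeriv, map_smul, smul_sub, smul_comm k z]

/-- Change of the spectral parameter. -/
theorem change_param (h : Sol J V z f u u') (w : ℂ) :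
    Sol J V w (fun x => f x + (z - w) • u x) u u' := by
  refine ⟨h.prim, ?_⟩
  convert h.prim' using 1
  funext x
  simp only [secondDeriv, sub_smul]
  abel

theorem zero : Sol J V z 0 0 0 := by
  have h : IsPrim J (0 : ℝ → H) 0 := ⟨LocInt.zero, fun x _ t _ => by simp⟩
  refine ⟨h, ?_⟩
  convert h using 1
  funext x
  simp [secondDeriv]

variable [CompleteSpace H]

/-- The pair (u, u') solves the homogeneous first order Volterra equation based at `c`. -/
theorem eqOn_zero (hV : LocPotential J V) (h : Sol J V z 0 u u') {c : ℝ} (hc : c ∈ J)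
    (h0 : u c = 0) (h0' : u' c = 0) : EqOn u 0 J ∧ EqOn u' 0 J := by
  have hA := hV.volterraFamily z
  have hD : ContinuousOn (fun x => (u x, u' x)) J :=
    (h.continuousOn hV.ordConnected).prodMk (h.continuousOn' hV.ordConnected)
  have key := hA.eq_zero hc hD (fun x hx => by
    have hi := hA.intervalIntegrable_apply hD hc hx
    have e1 := (ContinuousLinearMap.fst ℝ H H).intervalIntegral_comp_comm hi
    have e2 := (ContinuousLinearMap.snd ℝ H H).intervalIntegral_comp_comm hi
    simp only [sysOp_apply, ContinuousLinearMap.coe_fst', ContinuousLinearMap.coe_snd'] at e1 e2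
    have p1 := h.prim.eq_add hc hx
    have p2 := h.prim'.eq_add hc hx
    rw [h0, zero_add] at p1
    simp only [h0', zero_add, secondDeriv, Pi.zero_apply, sub_zero] at p2
    refine Prod.ext ?_ ?_
    · simp only [sysOp_apply]; rw [p1]; exact e1
    · simp only [sysOp_apply]; rw [p2]; exact e2)
  exact ⟨fun x hx => (Prod.ext_iff.1 (key x hx)).1, fun x hx => (Prod.ext_iff.1 (key x hx)).2⟩

theorem eqOn (hV : LocPotential J V) {g v v' : ℝ → H} (h : Sol J V z f u u')
    (hv : Sol J V z g v v') (hfg : f =ᵐ[volume.restrict J] g) {c : ℝ} (hc : c ∈ J)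
    (h0 : u c = v c) (h0' : u' c = v' c) : EqOn u v J ∧ EqOn u' v' J := by
  have h1 := ((h.sub hv).congr_ae (g := 0) hV.ordConnected (by
    filter_upwards [hfg] with x hx
    simp [hx])).eqOn_zero hV hc (by simp [h0]) (by simp [h0'])
  exact ⟨fun x hx => sub_eq_zero.1 (h1.1 hx), fun x hx => sub_eq_zero.1 (h1.2 hx)⟩

end Sol

variable [CompleteSpace H]

/-- The Volterra equation is that of the first order system, with `f` integrated into the free term
(y₀, y₁ - ∫ f). The explicit Gronwall bound later turns convergence of data and right-hand sides
into convergence of solutions. -/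
theorem exists_sol (hV : LocPotential J V) (z : ℂ) (hf : LocInt J f) {c : ℝ} (hc : c ∈ J)
    (y₀ y₁ : H) :
    ∃ u u' : ℝ → H, Sol J V z f u u' ∧ u c = y₀ ∧ u' c = y₁ ∧
      ∀ x ∈ J, max ‖u x‖ ‖u' x‖ ≤ (max ‖y₀‖ ‖y₁‖ + |∫ s in c..x, ‖f s‖|) *
        Real.exp |∫ s in c..x, (1 + ‖V s‖ + ‖z‖)| := by
  have hA := hV.volterraFamily z
  have hF : IsPrim J (fun x => y₁ - ∫ s in c..x, f s) (fun x => -f x) :=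
    IsPrim.of_base hc (fun p hp q hq => (hf p hp q hq).neg) fun x hx => by
      simp [sub_eq_add_neg]
  have hFc := hF.continuousOn hV.ordConnected
  obtain ⟨Y, hYc, hY, hYb⟩ := hA.exists_solution hc
    (G := fun x => (y₀, y₁ - ∫ s in c..x, f s)) (continuousOn_const.prodMk hFc)
  have hu : ContinuousOn (fun x => (Y x).1) J := continuous_fst.comp_continuousOn hYc
  have hu' : ContinuousOn (fun x => (Y x).2) J := continuous_snd.comp_continuousOn hYc
  have hc0 : Y c = (y₀, y₁) := by simpa using hY c hc
  have hsd : LocInt J (secondDeriv V z f fun x => (Y x).1) := hV.locInt_secondDeriv hu hf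
  refine ⟨fun x => (Y x).1, fun x => (Y x).2, ⟨?_, ?_⟩, by simp [hc0], by simp [hc0], ?_⟩
  · refine IsPrim.of_base hc (locInt_of_continuousOn hV.ordConnected hu') fun x hx => ?_
    have e1 := (ContinuousLinearMap.fst ℝ H H).intervalIntegral_comp_comm
      (hA.intervalIntegrable_apply hYc hc hx)
    simp only [sysOp_apply, ContinuousLinearMap.coe_fst'] at e1
    rw [hc0, e1]
    have := congrArg Prod.fst (hY x hx)
    simpa only [sysOp_apply, Prod.fst_add] using this
  · refine IsPrim.of_base hc hsd fun x hx => ?_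
    have e1 := (ContinuousLinearMap.snd ℝ H H).intervalIntegral_comp_comm
      (hA.intervalIntegrable_apply hYc hc hx)
    have i1 : IntervalIntegrable (fun s => V s (Y s).1 - z • (Y s).1) volume c x :=
      ((hV.locInt_apply hu).sub
        (locInt_of_continuousOn hV.ordConnected (hu.const_smul z))) c hc x hx
    simp only [sysOp_apply, ContinuousLinearMap.coe_snd'] at e1
    simp only [secondDeriv]
    rw [intervalIntegral.integral_sub i1 (hf c hc x hx), e1, hc0]
    have := congrArg Prod.snd (hY x hx)
    simp only [sysOp_apply, Prod.snd_add] at this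
    rw [this]
    abel
  · intro x hx
    refine hYb x hx _ fun s hs => ?_
    have hsJ := hV.ordConnected.uIcc_subset hc hx hs
    have h1 : ‖∫ r in c..s, f r‖ ≤ |∫ r in c..x, ‖f r‖| := by
      refine intervalIntegral.norm_integral_le_abs_integral_norm.trans ?_
      refine intervalIntegral.abs_integral_mono_interval ?_
        (Eventually.of_forall fun x => norm_nonneg _) (hf c hc x hx).norm
      intro r hr
      rw [mem_uIcc] at hs
      rw [mem_uIoc] at hr ⊢
      grind
    rw [Prod.norm_def]
    refine max_le ?_ ?_
    · exact (le_max_left _ _).trans (le_add_of_nonneg_right (abs_nonneg _))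
    · refine (norm_sub_le _ _).trans (add_le_add (le_max_right _ _) h1)

/-- By uniqueness every solution is the one constructed in `exists_sol` and inherits its bound. -/
theorem Sol.bound (hV : LocPotential J V) (h : Sol J V z f u u') (hf : LocInt J f) {c x : ℝ}
    (hc : c ∈ J) (hx : x ∈ J) : max ‖u x‖ ‖u' x‖ ≤
      (max ‖u c‖ ‖u' c‖ + |∫ s in c..x, ‖f s‖|) *
        Real.exp |∫ s in c..x, (1 + ‖V s‖ + ‖z‖)| := by
  obtain ⟨v, v', hv, h0, h1, hb⟩ := exists_sol hV z hf hc (u c) (u' c)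
  obtain ⟨e, e'⟩ := h.eqOn hV hv (by rfl) hc h0.symm h1.symm
  rw [e hx, e' hx]
  exact hb x hx

/-- The Lagrange identity. -/
theorem Sol.wronskian_sub (hV : LocPotential J V)
    (hsa : ∀ᵐ x ∂(volume.restrict J), IsSelfAdjoint (V x)) {w : ℂ} {g v v' : ℝ → H}
    (h : Sol J V z f u u') (hv : Sol J V w g v v') {p q : ℝ} (hp : p ∈ J) (hq : q ∈ J) :
    wronskian u u' v v' q - wronskian u u' v v' p =
      ∫ x in p..q, ((starRingEnd ℂ z - w) * inner ℂ (u x) (v x) - inner ℂ (u x) (g x)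
        + inner ℂ (f x) (v x)) := by
  obtain ⟨i1, e1⟩ := h.prim.inner_sub_inner hV.ordConnected hv.prim' hp hq
  obtain ⟨i2, e2⟩ := h.prim'.inner_sub_inner hV.ordConnected hv.prim hp hq
  have : wronskian u u' v v' q - wronskian u u' v v' p =
      (inner ℂ (u q) (v' q) - inner ℂ (u p) (v' p))
        - (inner ℂ (u' q) (v q) - inner ℂ (u' p) (v p)) := by
    simp only [wronskian]; ring
  rw [this, e1, e2, ← intervalIntegral.integral_sub i1 i2]
  refine integral_congr_of_ae hV.ordConnected ?_ hp hq
  filter_upwards [hsa] with x hx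
  -- Self-adjointness removes the potential from the integrand.
  have hs : inner ℂ (V x (u x)) (v x) = inner ℂ (u x) (V x (v x)) := by
    rw [← ContinuousLinearMap.adjoint_inner_right, hx.adjoint_eq]
  simp only [secondDeriv, inner_sub_left, inner_sub_right, inner_smul_left, inner_smul_right, hs]
  ring

end initialValueProblem

/-! ### The interval [a, b), boundary values at `a`, and Green's formula. -/

section interval

variable {H : Type*} [NormedAddCommGroup H] [InnerProductSpace ℂ H]

/-- The half-open interval `[a, b)`. -/
def ivlC (a : ℝ) (b : EReal) : Set ℝ := {x | a ≤ x ∧ (x : EReal) < b}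

variable {a : ℝ} {b : EReal}

theorem ordConnected_ivlC : (ivlC a b).OrdConnected :=
  ⟨fun _ hx _ hy _ hz => ⟨hx.1.trans hz.1, (EReal.coe_le_coe_iff.2 hz.2).trans_lt hy.2⟩⟩

theorem ordConnected_ivl : (ivl a b).OrdConnected :=
  ⟨fun _ hx _ hy _ hz => ⟨hx.1.trans_le hz.1, (EReal.coe_le_coe_iff.2 hz.2).trans_lt hy.2⟩⟩

theorem ivl_subset_ivlC : ivl a b ⊆ ivlC a b := fun _ hx => ⟨hx.1.le, hx.2⟩

theorem left_mem_ivlC (hab : (a : EReal) < b) : a ∈ ivlC a b := ⟨le_rfl, hab⟩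

/-- The null set {a} is immaterial, so square integrability on (a, b) and Cauchy problems based at
`a` fit together. -/
theorem restrict_ivlC : volume.restrict (ivlC a b) = ivlMeasure a b := by
  refine (Measure.restrict_congr_set ?_).symm
  have h1 : ∀ᵐ x : ℝ, x ≠ a := by simp [ae_iff, measure_singleton]
  filter_upwards [h1] with x hx
  refine propext ⟨fun h => ivl_subset_ivlC h, fun h => ⟨lt_of_le_of_ne h.1 (Ne.symm hx), h.2⟩⟩

theorem exists_mem_ivl (hab : (a : EReal) < b) : ∃ c, c ∈ ivl a b := by
  obtain ⟨c, h1, h2⟩ := EReal.lt_iff_exists_real_btwn.1 hab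
  exact ⟨c, EReal.coe_lt_coe_iff.1 h1, h2⟩

theorem exists_gt_mem_ivl {x : ℝ} (hx : x ∈ ivlC a b) : ∃ c ∈ ivl a b, x < c := by
  obtain ⟨c, h1, h2⟩ := EReal.lt_iff_exists_real_btwn.1 hx.2
  exact ⟨c, ⟨hx.1.trans_lt (EReal.coe_lt_coe_iff.1 h1), h2⟩, EReal.coe_lt_coe_iff.1 h1⟩

/-- Regularity of `a` enters here: ‖V‖ is integrable up to `a`, which may therefore be the base
point of initial value problems. -/
theorem IsPotential.locPotential [CompleteSpace H] [TopologicalSpace.SeparableSpace H]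
    {V : ℝ → H →L[ℂ] H} (hV : IsPotential a b V) : LocPotential (ivlC a b) V where
  ordConnected := ordConnected_ivlC
  meas y hy := by
    rw [restrict_ivlC] at hy ⊢
    exact aestronglyMeasurable_apply hV.weaklyMeasurable hy
  locInt := by
    obtain ⟨c, hc, hi⟩ := hV.regular_left
    have key : ∀ q ∈ ivlC a b, IntervalIntegrable (fun x => ‖V x‖) volume a q := by
      intro q hq
      have h1 : IntervalIntegrable (fun x => ‖V x‖) volume a c :=
        (intervalIntegrable_iff_integrableOn_Ioc_of_le hc.1.le).2 hi
      by_cases hqc : q ≤ c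
      · exact h1.mono_set (uIcc_subset_uIcc_left ⟨by simpa using Or.inl hq.1, by simp [hqc]⟩)
      · push Not at hqc
        have hq' : q ∈ ivl a b := ⟨hc.1.trans hqc, hq.2⟩
        exact h1.trans ((hV.locallyIntegrable.integrableOn_compact_subset
          (ordConnected_ivl.uIcc_subset hc hq') isCompact_uIcc).intervalIntegrable)
    exact fun p hp q hq => (key p hp).symm.trans (key q hq)

theorem IsPotential.selfAdjoint_ivlC [CompleteSpace H] {V : ℝ → H →L[ℂ] H}
    (hV : IsPotential a b V) : ∀ᵐ x ∂(volume.restrict (ivlC a b)), IsSelfAdjoint (V x) := by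
  rw [restrict_ivlC]
  exact hV.selfAdjoint

theorem locInt_of_memLp {H : Type*} [NormedAddCommGroup H] {f : ℝ → H}
    (hf : MemLp f 2 (ivlMeasure a b)) : LocInt (ivlC a b) f := by
  intro p hp q hq
  rw [← restrict_ivlC] at hf
  have : IsFiniteMeasure (volume.restrict (uIoc p q)) := ⟨by simp [uIoc]⟩
  rw [intervalIntegrable_iff]
  exact (hf.mono_measure (restrict_uIoc_le ordConnected_ivlC hp hq)).integrable one_le_two

theorem Sol.hasBoundaryValues {V : ℝ → H →L[ℂ] H} {z : ℂ} {f u u' : ℝ → H}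
    (hab : (a : EReal) < b) (h : Sol (ivlC a b) V z f u u') :
    HasBoundaryValues a u u' (u a) (u' a) := by
  obtain ⟨c, hc⟩ := exists_mem_ivl hab
  have hmem : ivlC a b ∈ 𝓝[>] a := by
    filter_upwards [Ioo_mem_nhdsGT hc.1] with x hx
    exact ⟨hx.1.le, (EReal.coe_lt_coe_iff.2 hx.2).trans hc.2⟩
  have key : ∀ g : ℝ → H, ContinuousOn g (ivlC a b) → Tendsto g (𝓝[>] a) (𝓝 (g a)) := fun g hg =>
    (hg a (left_mem_ivlC hab)).mono_left (nhdsWithin_le_iff.2 hmem)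
  exact ⟨key u (h.continuousOn ordConnected_ivlC), key u' (h.continuousOn' ordConnected_ivlC)⟩

theorem isW21Loc_of_isPrim [CompleteSpace H] {u u' u'' : ℝ → H} (h : IsPrim (ivl a b) u u')
    (h' : IsPrim (ivl a b) u' u'') : IsW21Loc a b u u' u'' where
  hasDerivAt x hx := h.hasDerivAt (h'.continuousOn ordConnected_ivl) ((isOpen_ivl a b).mem_nhds hx)
  locallyIntegrable := by
    intro x hx
    obtain ⟨l, r, hlr, hI⟩ := mem_nhds_iff_exists_Ioo_subset.1 ((isOpen_ivl a b).mem_nhds hx)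
    obtain ⟨p, hp1, hp2⟩ := exists_between hlr.1
    obtain ⟨q, hq1, hq2⟩ := exists_between hlr.2
    refine ⟨Ioc p q, mem_nhdsWithin_of_mem_nhds (Ioc_mem_nhds hp2 hq1), ?_⟩
    exact (intervalIntegrable_iff_integrableOn_Ioc_of_le (hp2.trans hq1).le).1
      (h'.locInt p (hI ⟨hp1, hp2.trans hlr.2⟩) q (hI ⟨hlr.1.trans hq1, hq2⟩))
  integral_eq x hx t ht := h'.sub_eq x hx t ht

theorem IsW21Loc.isPrim' {u u' u'' : ℝ → H} (h : IsW21Loc a b u u' u'') :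
    IsPrim (ivl a b) u' u'' :=
  ⟨fun _ hp _ hq => (h.locallyIntegrable.integrableOn_compact_subset
    (ordConnected_ivl.uIcc_subset hp hq) isCompact_uIcc).intervalIntegrable, h.integral_eq⟩

theorem IsW21Loc.isPrim [CompleteSpace H] {u u' u'' : ℝ → H} (h : IsW21Loc a b u u' u'') :
    IsPrim (ivl a b) u u' := by
  have hl := locInt_of_continuousOn ordConnected_ivl (h.isPrim'.continuousOn ordConnected_ivl)
  exact ⟨hl, fun x hx t ht => (intervalIntegral.integral_eq_sub_of_hasDerivAt
    (fun s hs => h.hasDerivAt s (ordConnected_ivl.uIcc_subset hx ht hs)) (hl x hx t ht)).symm⟩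

variable {V : ℝ → H →L[ℂ] H} {z : ℂ} {f u u' : ℝ → H}

theorem tau_secondDeriv {H : Type*} [NormedAddCommGroup H] [InnerProductSpace ℂ H]
    (V : ℝ → H →L[ℂ] H) (z : ℂ) (f u : ℝ → H) :
    tau V u (secondDeriv V z f u) = fun x => f x + z • u x := by
  ext x
  simp only [tau, secondDeriv]
  abel

theorem Sol.isW21Loc [CompleteSpace H] (h : Sol (ivlC a b) V z f u u') :
    IsW21Loc a b u u' (secondDeriv V z f u) :=
  isW21Loc_of_isPrim (h.prim.mono ivl_subset_ivlC) (h.prim'.mono ivl_subset_ivlC)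

/-- A function in `W^{2,1}_loc((a,b))` with `(τ - z) u = f` extends to a solution on `[a,b)`. -/
theorem IsW21Loc.exists_sol [CompleteSpace H] (hab : (a : EReal) < b)
    (hV : LocPotential (ivlC a b) V)
    {u'' : ℝ → H} (h : IsW21Loc a b u u' u'') (hf : LocInt (ivlC a b) f)
    (hu : ∀ᵐ x ∂(ivlMeasure a b), tau V u u'' x = f x + z • u x) :
    ∃ v v' : ℝ → H, Sol (ivlC a b) V z f v v' ∧ EqOn u v (ivl a b) ∧ EqOn u' v' (ivl a b) := by
  have hs : Sol (ivl a b) V z f u u' := by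
    refine ⟨h.isPrim, h.isPrim'.congr_ae ordConnected_ivl ?_⟩
    filter_upwards [hu] with x hx
    simp only [tau, secondDeriv] at hx ⊢
    rw [sub_sub, add_comm (z • u x), ← hx]
    abel
  -- The Cauchy problem is restarted at an interior point. Its solution lives on all of [a, b) and
  -- agrees with `u` on (a, b) by uniqueness.
  obtain ⟨c, hc⟩ := exists_mem_ivl hab
  obtain ⟨v, v', hv, h0, h1, -⟩ := WeylTitchmarsh.exists_sol hV z hf (ivl_subset_ivlC hc) (u c)
      (u' c)
  exact ⟨v, v', hv, hs.eqOn (hV.mono ivl_subset_ivlC ordConnected_ivl) (hv.mono ivl_subset_ivlC)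
    (by rfl) hc h0.symm h1.symm⟩

theorem HasBoundaryValues.eq {v v' : ℝ → H} {y₀ y₁ : H} (hab : (a : EReal) < b)
    (h : HasBoundaryValues a u u' y₀ y₁) (hv : Sol (ivlC a b) V z f v v')
    (e : EqOn u v (ivl a b)) (e' : EqOn u' v' (ivl a b)) : y₀ = v a ∧ y₁ = v' a := by
  obtain ⟨c, hc⟩ := exists_mem_ivl hab
  have hmem : ivl a b ∈ 𝓝[>] a := by
    filter_upwards [Ioo_mem_nhdsGT hc.1] with x hx
    exact ⟨hx.1, (EReal.coe_lt_coe_iff.2 hx.2).trans hc.2⟩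
  have hb := hv.hasBoundaryValues hab
  exact ⟨tendsto_nhds_unique (h.1.congr' (by filter_upwards [hmem] with x hx using e hx)) hb.1,
    tendsto_nhds_unique (h.2.congr' (by filter_upwards [hmem] with x hx using e' hx)) hb.2⟩

theorem Sol.isMaxDomain [CompleteSpace H] (h : Sol (ivlC a b) V z f u u')
    (hu : MemLp u 2 (ivlMeasure a b))
    (hf : MemLp f 2 (ivlMeasure a b)) : IsMaxDomain a b V u u' (secondDeriv V z f u) where
  w21 := h.isW21Loc
  memLp := hu
  tau_memLp := by
    rw [tau_secondDeriv]
    exact hf.add (hu.const_smul z)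

theorem integrable_inner_of_memLp {u v : ℝ → H} (hu : MemLp u 2 (ivlMeasure a b))
    (hv : MemLp v 2 (ivlMeasure a b)) :
    Integrable (fun x => inner ℂ (u x) (v x)) (ivlMeasure a b) := by
  refine (L2.integrable_inner (𝕜 := ℂ) (hu.toLp u) (hv.toLp v)).congr ?_
  filter_upwards [hu.coeFn_toLp, hv.coeFn_toLp] with x h1 h2
  rw [h1, h2]

theorem inner_toLp {u v : ℝ → H} (hu : MemLp u 2 (ivlMeasure a b))
    (hv : MemLp v 2 (ivlMeasure a b)) :
    inner ℂ (hu.toLp u) (hv.toLp v) = ∫ x, inner ℂ (u x) (v x) ∂(ivlMeasure a b) := by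
  rw [L2.inner_def]
  refine integral_congr_ae ?_
  filter_upwards [hu.coeFn_toLp, hv.coeFn_toLp] with x h1 h2
  rw [h1, h2]

/-- The filter of left neighbourhoods of `b`. -/
abbrev nearRight (b : EReal) : Filter ℝ := comap (fun x : ℝ => (x : EReal)) (𝓝[<] b)

theorem eventually_nearRight {x : ℝ} (hx : (x : EReal) < b) :
    ∀ᶠ t in nearRight b, x < t ∧ (t : EReal) < b := by
  refine ⟨Ioo (x : EReal) b, Ioo_mem_nhdsLT hx, fun t ht => ?_⟩
  exact ⟨EReal.coe_lt_coe_iff.1 ht.1, ht.2⟩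

theorem nearRight_neBot (hab : (a : EReal) < b) : (nearRight b).NeBot := by
  rw [comap_neBot_iff]
  intro s hs
  obtain ⟨l, hl, hs'⟩ := (mem_nhdsLT_iff_exists_Ioo_subset' hab).1 hs
  obtain ⟨c, h1, h2⟩ := EReal.lt_iff_exists_real_btwn.1 (show l < b from hl)
  exact ⟨c, hs' ⟨h1, h2⟩⟩

theorem tendsto_integral_nearRight (hab : (a : EReal) < b) {F : ℝ → ℂ}
    (hF : Integrable F (ivlMeasure a b)) :
    Tendsto (fun t => ∫ x in a..t, F x) (nearRight b) (𝓝 (∫ x, F x ∂(ivlMeasure a b))) := by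
  have hcov : AECover (ivlMeasure a b) (nearRight b) (fun t => Ioc a t) := by
    refine ⟨?_, fun t => measurableSet_Ioc⟩
    rw [ae_restrict_iff' (isOpen_ivl a b).measurableSet]
    refine Eventually.of_forall fun x hx => ?_
    filter_upwards [eventually_nearRight hx.2] with t ht
    exact ⟨hx.1, ht.1.le⟩
  refine (hcov.integral_tendsto_of_countably_generated hF).congr' ?_
  filter_upwards [eventually_nearRight hab] with t ht
  rw [intervalIntegral.integral_of_le ht.1.le, Measure.restrict_restrict measurableSet_Ioc,
    inter_eq_left.2]
  exact fun x hx => ⟨hx.1, (EReal.coe_le_coe_iff.2 hx.2).trans_lt ht.2⟩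

/-- Green's formula: at a limit-point endpoint only the boundary term at `a` remains. -/
theorem IsPotential.wronskian_left [CompleteSpace H] [TopologicalSpace.SeparableSpace H]
    (hab : (a : EReal) < b)
    (hV : IsPotential a b V) {w : ℂ} {g v v' : ℝ → H}
    (h : Sol (ivlC a b) V z f u u') (hv : Sol (ivlC a b) V w g v v')
    (hu2 : MemLp u 2 (ivlMeasure a b)) (hf2 : MemLp f 2 (ivlMeasure a b))
    (hv2 : MemLp v 2 (ivlMeasure a b)) (hg2 : MemLp g 2 (ivlMeasure a b)) :
    wronskian u u' v v' a = (w - starRingEnd ℂ z) * inner ℂ (hu2.toLp u) (hv2.toLp v)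
      + inner ℂ (hu2.toLp u) (hg2.toLp g)
      - inner ℂ (hf2.toLp f) (hv2.toLp v) := by
  rw [inner_toLp, inner_toLp, inner_toLp]
  have i1 : Integrable (fun x => inner ℂ (u x) (v x)) (ivlMeasure a b) :=
    integrable_inner_of_memLp hu2 hv2
  have i2 : Integrable (fun x => inner ℂ (u x) (g x)) (ivlMeasure a b) :=
    integrable_inner_of_memLp hu2 hg2
  have i3 : Integrable (fun x => inner ℂ (f x) (v x)) (ivlMeasure a b) :=
    integrable_inner_of_memLp hf2 hv2
  have hlim := tendsto_integral_nearRight hab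
    (((i1.const_mul (starRingEnd ℂ z - w)).sub i2).add i3)
  -- The limit-point hypothesis enters here: the Wronskian at `t` tends to zero and only its value
  -- at `a` survives.
  have hlim2 := (hV.limitPoint_right u u' _ v v' _ (h.isMaxDomain hu2 hf2)
    (hv.isMaxDomain hv2 hg2)).sub_const (wronskian u u' v v' a)
  have := nearRight_neBot hab
  have key := tendsto_nhds_unique (hlim2.congr' (by
    filter_upwards [eventually_nearRight hab] with t ht
    exact h.wronskian_sub hV.locPotential hV.selfAdjoint_ivlC hv (left_mem_ivlC hab)
      ⟨ht.1.le, ht.2⟩)) hlim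
  rw [integral_add' ((i1.const_mul _).sub i2) i3, integral_sub' (i1.const_mul _) i2,
    integral_const_mul] at key
  linear_combination -key

end interval

/-! ### The boundary forms 𝒞₁, 𝒞₂ as rotated Cauchy data. -/

section boundaryForms

variable {H : Type*} [NormedAddCommGroup H] [InnerProductSpace ℂ H] [CompleteSpace H]

/-- The boundary form `𝒞₁ = cos(α) y₀ + sin(α) y₁`. -/
def bc1 (α : H →L[ℂ] H) (y₀ y₁ : H) : H := opCos α y₀ + opSin α y₁

/-- The boundary form `𝒞₂ = -sin(α) y₀ + cos(α) y₁`. -/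
def bc2 (α : H →L[ℂ] H) (y₀ y₁ : H) : H := (-opSin α) y₀ + opCos α y₁

variable {α : H →L[ℂ] H}

/-- No hypothesis on `α` is needed: off the self-adjoint operators the functional calculus takes the
value 0. Only cos² + sin² = 1 requires self-adjointness. -/
theorem isSelfAdjoint_opSin (α : H →L[ℂ] H) : IsSelfAdjoint (opSin α) := cfc_predicate _ _

theorem isSelfAdjoint_opCos (α : H →L[ℂ] H) : IsSelfAdjoint (opCos α) := cfc_predicate _ _

theorem opSin_mul_opCos (α : H →L[ℂ] H) : opSin α * opCos α = opCos α * opSin α :=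
  cfc_commute_cfc _ _ _

theorem opCos_mul_self_add (hα : IsSelfAdjoint α) :
    opCos α * opCos α + opSin α * opSin α = 1 := by
  rw [opCos, opSin, ← cfc_mul _ _ α, ← cfc_mul _ _ α, ← cfc_add α _ _]
  rw [← cfc_one ℝ α]
  refine cfc_congr fun x _ => ?_
  have := Real.cos_sq_add_sin_sq x
  simp only [Pi.one_apply]
  linarith

theorem opSin_opCos_apply (α : H →L[ℂ] H) (x : H) : opSin α (opCos α x) = opCos α (opSin α x) :=
  DFunLike.congr_fun (opSin_mul_opCos α) x

theorem opCos_opCos_apply (hα : IsSelfAdjoint α) (x : H) :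
    opCos α (opCos α x) = x - opSin α (opSin α x) :=
  eq_sub_of_add_eq (DFunLike.congr_fun (opCos_mul_self_add hα) x)

theorem inner_opSin_left (α : H →L[ℂ] H) (x y : H) :
    inner ℂ (opSin α x) y = inner ℂ x (opSin α y) := by
  rw [← ContinuousLinearMap.adjoint_inner_right, (isSelfAdjoint_opSin α).adjoint_eq]

theorem inner_opCos_left (α : H →L[ℂ] H) (x y : H) :
    inner ℂ (opCos α x) y = inner ℂ x (opCos α y) := by
  rw [← ContinuousLinearMap.adjoint_inner_right, (isSelfAdjoint_opCos α).adjoint_eq]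

/-- Since cos(α) and sin(α) commute and cos² + sin² = 1, the rotation by `α` and the map (𝒞₁, 𝒞₂)
are mutually inverse. This lemma and the next three are the components of that fact. -/
theorem bc1_rotate (hα : IsSelfAdjoint α) (h k : H) :
    bc1 α (opCos α h - opSin α k) (opSin α h + opCos α k) = h := by
  simp only [bc1, map_sub, map_add, opSin_opCos_apply, opCos_opCos_apply hα]
  abel

theorem bc2_rotate (hα : IsSelfAdjoint α) (h k : H) :
    bc2 α (opCos α h - opSin α k) (opSin α h + opCos α k) = k := by
  simp only [bc2, map_sub, map_add, opSin_opCos_apply, opCos_opCos_apply hα,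
    neg_apply]
  abel

theorem rotate_bc_fst (hα : IsSelfAdjoint α) (y₀ y₁ : H) :
    opCos α (bc1 α y₀ y₁) - opSin α (bc2 α y₀ y₁) = y₀ := by
  simp only [bc1, bc2, map_add, opSin_opCos_apply, opCos_opCos_apply hα,
    neg_apply, map_neg]
  abel

theorem rotate_bc_snd (hα : IsSelfAdjoint α) (y₀ y₁ : H) :
    opSin α (bc1 α y₀ y₁) + opCos α (bc2 α y₀ y₁) = y₁ := by
  simp only [bc1, bc2, map_add, opSin_opCos_apply, opCos_opCos_apply hα,
    neg_apply, map_neg]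
  abel

/-- The rotation preserves the form appearing in Green's formula. The boundary term at `a` can thus
be read off from 𝒞₁ and 𝒞₂, and it vanishes when both functions satisfy 𝒞₁ = 0. -/
theorem symplectic_bc (hα : IsSelfAdjoint α) (y₀ y₁ w₀ w₁ : H) :
    inner ℂ y₀ w₁ - inner ℂ y₁ w₀ =
      inner ℂ (bc1 α y₀ y₁) (bc2 α w₀ w₁) - inner ℂ (bc2 α y₀ y₁) (bc1 α w₀ w₁) := by
  simp only [bc1, bc2, neg_apply, inner_add_left, inner_add_right,
    inner_neg_left, inner_neg_right, inner_opSin_left, inner_opCos_left, opSin_opCos_apply,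
    opCos_opCos_apply hα, inner_sub_right]
  ring

theorem bc1_add (α : H →L[ℂ] H) (y₀ y₁ w₀ w₁ : H) :
    bc1 α (y₀ + w₀) (y₁ + w₁) = bc1 α y₀ y₁ + bc1 α w₀ w₁ := by
  simp only [bc1, map_add]; abel

theorem bc2_add (α : H →L[ℂ] H) (y₀ y₁ w₀ w₁ : H) :
    bc2 α (y₀ + w₀) (y₁ + w₁) = bc2 α y₀ y₁ + bc2 α w₀ w₁ := by
  simp only [bc2, map_add]; abel

theorem bc1_sub (α : H →L[ℂ] H) (y₀ y₁ w₀ w₁ : H) :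
    bc1 α (y₀ - w₀) (y₁ - w₁) = bc1 α y₀ y₁ - bc1 α w₀ w₁ := by
  simp only [bc1, map_sub]; abel

theorem bc1_smul (α : H →L[ℂ] H) (k : ℂ) (y₀ y₁ : H) :
    bc1 α (k • y₀) (k • y₁) = k • bc1 α y₀ y₁ := by
  simp only [bc1, map_smul, smul_add]

theorem bc2_smul (α : H →L[ℂ] H) (k : ℂ) (y₀ y₁ : H) :
    bc2 α (k • y₀) (k • y₁) = k • bc2 α y₀ y₁ := by
  simp only [bc2, map_smul, smul_add]

end boundaryForms

/-! ### Cauchy data and truncations in terms of L¹ and L² norms. -/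

section estimates

variable {H : Type*} [NormedAddCommGroup H] [InnerProductSpace ℂ H]
variable {a : ℝ} {b : EReal}

theorem Icc_subset_ivlC {c : ℝ} (hc : c ∈ ivl a b) : Icc a c ⊆ ivlC a b := fun _ hx =>
  ⟨hx.1, (EReal.coe_le_coe_iff.2 hx.2).trans_lt hc.2⟩

theorem Ioc_subset_ivl {c : ℝ} (hc : c ∈ ivl a b) : Ioc a c ⊆ ivl a b := fun _ hx =>
  ⟨hx.1, (EReal.coe_le_coe_iff.2 hx.2).trans_lt hc.2⟩

theorem restrict_Ioc_ivlMeasure {c : ℝ} (hc : c ∈ ivl a b) :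
    (ivlMeasure a b).restrict (Ioc a c) = volume.restrict (Ioc a c) := by
  rw [Measure.restrict_restrict measurableSet_Ioc, inter_eq_left.2 (Ioc_subset_ivl hc)]

/-- The Cauchy data at `a` are controlled by integrals over a neighbourhood of `a`. -/
theorem exists_data_bound [CompleteSpace H] {V : ℝ → H →L[ℂ] H} (hV : LocPotential (ivlC a b) V)
    (z : ℂ) {c : ℝ} (hc : c ∈ ivl a b) :
    ∃ K : ℝ, 0 < K ∧ ∀ f u u' : ℝ → H, Sol (ivlC a b) V z f u u' → LocInt (ivlC a b) f →
      max ‖u a‖ ‖u' a‖ ≤ K * ((∫ x in a..c, ‖u x‖) + ∫ x in a..c, ‖f x‖) := by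
  have hac := hc.1
  have hcC := ivl_subset_ivlC hc
  have haC : a ∈ ivlC a b := Icc_subset_ivlC hc (left_mem_Icc.2 hac.le)
  set w : ℝ → ℝ := fun x => 1 + ‖V x‖ + ‖z‖ with hw
  have hw0 : ∀ x, 0 ≤ w x := fun x => by positivity
  have hwi : IntervalIntegrable w volume a c := (hV.volterraFamily z).integrable a haC c hcC
  set E := Real.exp |∫ s in a..c, w s| with hE
  have hE0 : 0 < E := Real.exp_pos _
  -- On [a, a + 2ε] the coefficients have so small an integral that `u'` stays near `u' a` and `u`
  -- is nearly affine.
  obtain ⟨ε, hε0, hε1, hεc, hκ⟩ : ∃ ε : ℝ, 0 < ε ∧ ε ≤ 1 / 2 ∧ a + 2 * ε ≤ c ∧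
      E * (∫ s in a..(a + 2 * ε), w s) ≤ 1 / 4 := by
    have hcont : ContinuousWithinAt (fun x => E * ∫ s in a..x, w s) (uIcc a c) a :=
      (intervalIntegral.continuousOn_primitive_interval' hwi left_mem_uIcc a
        left_mem_uIcc).const_mul E
    have h1 : Tendsto (fun x => E * ∫ s in a..x, w s) (𝓝[>] a) (𝓝 0) := by
      have := hcont.tendsto
      simp only [intervalIntegral.integral_same, mul_zero] at this
      refine this.mono_left (nhdsWithin_le_iff.2 ?_)
      rw [uIcc_of_le hac.le]
      filter_upwards [Ioo_mem_nhdsGT hac] with x hx using ⟨hx.1.le, hx.2.le⟩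
    obtain ⟨x, hx1, hx2⟩ := ((h1.eventually (ge_mem_nhds (show (0 : ℝ) < 1 / 4 by norm_num))).and
      (Ioo_mem_nhdsGT (show a < min c (a + 1) from lt_min hac (by linarith)))).exists
    refine ⟨(x - a) / 2, ?_, ?_, ?_, ?_⟩
    · linarith [hx2.1]
    · linarith [hx2.2, min_le_right c (a + 1)]
    · linarith [hx2.2, min_le_left c (a + 1)]
    · rwa [mul_div_cancel₀ _ two_ne_zero, add_sub_cancel]
  -- The proof ends with N ≤ 2I/ε² + D, where D = N/4 + 5φ/4. Absorbing N/4 gives N ≤ (8/3)I/ε² +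
  -- (5/3)φ, and 3/ε² dominates both coefficients because ε ≤ 1/2.
  refine ⟨3 / ε ^ 2, by positivity, fun f u u' hu hf => ?_⟩
  set N := max ‖u a‖ ‖u' a‖ with hN
  have hN0 : 0 ≤ N := (norm_nonneg _).trans (le_max_left _ _)
  have hfi := (hf a haC c hcC).norm
  set φ := ∫ x in a..c, ‖f x‖ with hφ
  have hφ0 : 0 ≤ φ := intervalIntegral.integral_nonneg hac.le fun _ _ => norm_nonneg _
  have huc : ContinuousOn u (Icc a c) :=
    (hu.continuousOn ordConnected_ivlC).mono (Icc_subset_ivlC hc)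
  have huc' : ContinuousOn u' (Icc a c) :=
    (hu.continuousOn' ordConnected_ivlC).mono (Icc_subset_ivlC hc)
  set I := ∫ x in a..c, ‖u x‖ with hI
  have hmono : ∀ g : ℝ → ℝ, (∀ x, 0 ≤ g x) → IntervalIntegrable g volume a c → ∀ p ∈ Icc a c,
      ∫ x in a..p, g x ≤ ∫ x in a..c, g x := fun g hg hgi p hp =>
    intervalIntegral.integral_mono_interval le_rfl hp.1 hp.2 (Eventually.of_forall hg) hgi
  have hsup : ∀ x ∈ Icc a c, ‖u x‖ ≤ (N + φ) * E := by
    intro x hx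
    refine (le_max_left _ _).trans ((hu.bound hV hf haC (Icc_subset_ivlC hc hx)).trans ?_)
    have h1 : |∫ s in a..x, ‖f s‖| ≤ φ := by
      rw [abs_of_nonneg (intervalIntegral.integral_nonneg hx.1 fun _ _ => norm_nonneg _)]
      exact hmono _ (fun _ => norm_nonneg _) hfi x hx
    have h2 : |∫ s in a..x, (1 + ‖V s‖ + ‖z‖)| ≤ |∫ s in a..c, w s| := by
      rw [abs_of_nonneg (intervalIntegral.integral_nonneg hx.1 fun _ _ => hw0 _),
        abs_of_nonneg (intervalIntegral.integral_nonneg hac.le fun _ _ => hw0 _)]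
      exact hmono _ hw0 hwi x hx
    have h3 := Real.exp_le_exp.2 h2
    gcongr
  set D := (N + φ) / 4 + φ with hD
  have hD0 : 0 ≤ D := by positivity
  have hder : ∀ s ∈ Icc a (a + 2 * ε), ‖u' s - u' a‖ ≤ D := by
    intro s hs
    have hsc : s ∈ Icc a c := ⟨hs.1, hs.2.trans hεc⟩
    have hi : IntervalIntegrable (fun x => (N + φ) * E * w x + ‖f x‖) volume a c :=
      (hwi.const_mul _).add hfi
    refine (hu.prim'.dist_le ordConnected_ivlC haC hcC hi left_mem_uIcc
      (by rw [uIcc_of_le hac.le]; exact hsc) fun x hx => ?_).trans ?_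
    · rw [uIoc_of_le hac.le] at hx
      have hx' := hsup x ⟨hx.1.le, hx.2⟩
      have h1 : ‖V x (u x)‖ ≤ ‖V x‖ * ((N + φ) * E) := (V x).le_of_opNorm_le_of_le le_rfl hx'
      have h2 : ‖z • u x‖ ≤ ‖z‖ * ((N + φ) * E) := by rw [norm_smul]; gcongr
      have h3 := norm_sub_le (V x (u x) - z • u x) (f x)
      have h4 := norm_sub_le (V x (u x)) (z • u x)
      have h5 : 0 ≤ (N + φ) * E := by positivity
      simp only [secondDeriv, hw]
      linarith
    · have hsub : uIcc a s ⊆ uIcc a c := by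
        rw [uIcc_of_le hac.le, uIcc_of_le hs.1]
        exact Icc_subset_Icc_right hsc.2
      rw [intervalIntegral.integral_add ((hwi.const_mul _).mono_set hsub) (hfi.mono_set hsub),
        intervalIntegral.integral_const_mul]
      have h1 : ∫ x in a..s, w x ≤ ∫ x in a..(a + 2 * ε), w x :=
        intervalIntegral.integral_mono_interval le_rfl hs.1 hs.2 (Eventually.of_forall hw0)
          (hwi.mono_set (by
            rw [uIcc_of_le hac.le, uIcc_of_le (by linarith)]
            exact Icc_subset_Icc_right hεc))
      have h2 := hmono _ (fun _ => norm_nonneg _) hfi s hsc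
      have h3 : 0 ≤ ∫ x in a..s, w x := intervalIntegral.integral_nonneg hs.1 fun _ _ => hw0 _
      have h4 : 0 ≤ ∫ x in a..s, ‖f x‖ :=
        intervalIntegral.integral_nonneg hs.1 fun _ _ => norm_nonneg _
      rw [abs_of_nonneg (by positivity)]
      have h5 : (N + φ) * E * ∫ x in a..s, w x ≤ (N + φ) * (1 / 4) := by
        rw [mul_assoc]
        gcongr
        exact (mul_le_mul_of_nonneg_left h1 hE0.le).trans hκ
      linarith
  have hstep : ∀ x ∈ Icc a (a + 2 * ε), ∀ y ∈ Icc a (a + 2 * ε), x ≤ y →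
      ‖u y - u x - (y - x) • u' a‖ ≤ (y - x) * D := by
    intro x hx y hy hxy
    have hxc : x ∈ ivlC a b := Icc_subset_ivlC hc ⟨hx.1, hx.2.trans hεc⟩
    have hyc : y ∈ ivlC a b := Icc_subset_ivlC hc ⟨hy.1, hy.2.trans hεc⟩
    rw [hu.prim.sub_eq x hxc y hyc, ← intervalIntegral.integral_const,
      ← intervalIntegral.integral_sub (hu.prim.locInt x hxc y hyc) intervalIntegrable_const]
    have := intervalIntegral.norm_integral_le_of_norm_le_const (a := x) (b := y) (C := D)
      (f := fun s => u' s - u' a) fun s hs => by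
        rw [uIoc_of_le hxy] at hs
        exact hder s ⟨hx.1.trans hs.1.le, hs.2.trans hy.2⟩
    rwa [abs_of_nonneg (by linarith), mul_comm] at this
  have hni : IntervalIntegrable (fun x => ‖u x‖) volume a c := by
    refine ContinuousOn.intervalIntegrable ?_
    rw [uIcc_of_le hac.le]
    exact huc.norm
  have hsubi : ∀ p ∈ Icc a c, ∀ q ∈ Icc a c, IntervalIntegrable (fun x => ‖u x‖) volume p q :=
    fun p hp q hq => hni.mono_set (by
      rw [uIcc_of_le hac.le]
      exact ordConnected_Icc.uIcc_subset hp hq)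
  have m0 : a ∈ Icc a c := ⟨le_rfl, hac.le⟩
  have m1 : a + ε ∈ Icc a c := ⟨by linarith, by linarith⟩
  have m2 : a + 2 * ε ∈ Icc a c := ⟨by linarith, by linarith⟩
  have hle1 : ∫ x in a..(a + ε), ‖u x‖ ≤ I := hmono _ (fun _ => norm_nonneg _) hni _ m1
  have hle2 : ∫ x in a..(a + 2 * ε), ‖u x‖ ≤ I := hmono _ (fun _ => norm_nonneg _) hni _ m2
  have hI0 : 0 ≤ I := intervalIntegral.integral_nonneg hac.le fun _ _ => norm_nonneg _
  -- The difference u(x + ε) - u(x) is close to ε u'(a); averaging it over [a, a + ε] recovers u'(a)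
  -- from the integral of ‖u‖.
  have hu1 : ε * (ε * ‖u' a‖) ≤ I + ε * (ε * D) := by
    have hshift : IntervalIntegrable (fun x => ‖u (x + ε)‖) volume a (a + ε) := by
      have h := (hsubi _ m1 _ m2).comp_add_right ε
      convert h using 1 <;> ring
    have hi1 := hsubi _ m0 _ m1
    have h1 : ∫ x in a..(a + ε), ε * ‖u' a‖ ≤
        ∫ x in a..(a + ε), (‖u (x + ε)‖ + ‖u x‖ + ε * D) := by
      refine intervalIntegral.integral_mono_on (by linarith) intervalIntegrable_const
        ((hshift.add hi1).add intervalIntegrable_const) fun x hx => ?_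
      have h := hstep x ⟨hx.1, by linarith [hx.2]⟩ (x + ε) ⟨by linarith [hx.1], by linarith [hx.2]⟩
        (by linarith)
      rw [add_sub_cancel_left] at h
      have h2 : ‖ε • u' a‖ = ε * ‖u' a‖ := by rw [norm_smul, Real.norm_of_nonneg hε0.le]
      have h3 : ε • u' a = (u (x + ε) - u x) - (u (x + ε) - u x - ε • u' a) := by abel
      have h4 := norm_sub_le (u (x + ε) - u x) (u (x + ε) - u x - ε • u' a)
      have h5 := norm_sub_le (u (x + ε)) (u x)
      rw [← h3, h2] at h4
      linarith
    rw [intervalIntegral.integral_add (hshift.add hi1) intervalIntegrable_const,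
      intervalIntegral.integral_add hshift hi1, intervalIntegral.integral_const,
      intervalIntegral.integral_const, intervalIntegral.integral_comp_add_right
        (fun x => ‖u x‖)] at h1
    have h6 := intervalIntegral.integral_add_adjacent_intervals hi1 (hsubi _ m1 _ m2)
    have h7 : a + ε + ε = a + 2 * ε := by ring
    rw [h7, add_sub_cancel_left, smul_eq_mul, smul_eq_mul] at h1
    linarith
  -- In the same way u(a) is recovered by averaging u(x) - (x - a)u'(a).
  have hu0 : ε * ‖u a‖ ≤ I + ε * (ε * (‖u' a‖ + D)) := by
    have hi1 := hsubi _ m0 _ m1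
    have h1 : ∫ x in a..(a + ε), ‖u a‖ ≤
        ∫ x in a..(a + ε), (‖u x‖ + ε * (‖u' a‖ + D)) := by
      refine intervalIntegral.integral_mono_on (by linarith) intervalIntegrable_const
        (hi1.add intervalIntegrable_const) fun x hx => ?_
      have h := hstep a ⟨le_rfl, by linarith⟩ x ⟨hx.1, by linarith [hx.2]⟩ hx.1
      have hxa : 0 ≤ x - a := by linarith [hx.1]
      have hxε : x - a ≤ ε := by linarith [hx.2]
      have h2 : ‖(x - a) • u' a‖ = (x - a) * ‖u' a‖ := by
        rw [norm_smul, Real.norm_of_nonneg hxa]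
      have h3 : u a = u x - (x - a) • u' a - (u x - u a - (x - a) • u' a) := by abel
      have h4 := norm_sub_le (u x - (x - a) • u' a) (u x - u a - (x - a) • u' a)
      have h5 := norm_sub_le (u x) ((x - a) • u' a)
      rw [← h3] at h4
      have h6 : (x - a) * (‖u' a‖ + D) ≤ ε * (‖u' a‖ + D) := by gcongr
      linarith
    rw [intervalIntegral.integral_add hi1 intervalIntegrable_const,
      intervalIntegral.integral_const, intervalIntegral.integral_const, add_sub_cancel_left,
      smul_eq_mul, smul_eq_mul] at h1
    linarith
  have e1 : ‖u' a‖ ≤ I / ε ^ 2 + D := by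
    rw [← sub_le_iff_le_add, le_div_iff₀ (by positivity)]
    nlinarith
  have e0 : ‖u a‖ ≤ 2 * (I / ε ^ 2) + D := by
    have h1 : ε ^ 2 * (I / ε ^ 2) = I := by field_simp
    have h2 : 0 ≤ I / ε ^ 2 := by positivity
    have h3 : ε * ‖u a‖ ≤ ε * (2 * (I / ε ^ 2) + D) := by
      have : ε * (ε * (‖u' a‖ + D)) ≤ ε * (ε * (I / ε ^ 2 + D + D)) := by gcongr
      have h4 : ε * (ε * D) ≤ ε * (1 / 2 * D) := by gcongr
      have h5 : ε * ε * (I / ε ^ 2) ≤ ε * (1 / 2) * (I / ε ^ 2) := by gcongr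
      nlinarith
    exact le_of_mul_le_mul_left h3 hε0
  have hNle : N ≤ 2 * (I / ε ^ 2) + D := by
    refine max_le e0 (e1.trans ?_)
    have : 0 ≤ I / ε ^ 2 := by positivity
    linarith
  have h6 : 2 ≤ 3 / ε ^ 2 := by
    rw [le_div_iff₀ (by positivity)]
    nlinarith
  have h7 : 2 * φ ≤ 3 / ε ^ 2 * φ := by gcongr
  have h8 : 3 / ε ^ 2 * (I + φ) = 3 * (I / ε ^ 2) + 3 / ε ^ 2 * φ := by ring
  have h9 : 0 ≤ I / ε ^ 2 := by positivity
  rw [h8]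
  linarith

/-- `L²(a,b) ⊆ L¹(a,c)`. -/
theorem exists_integral_norm_le (hc : c ∈ ivl a b) :
    ∃ K : ℝ, 0 ≤ K ∧ ∀ g : L2 H a b, ∫ x in a..c, ‖g x‖ ≤ K * ‖g‖ := by
  refine ⟨((volume.restrict (Ioc a c) univ) ^ (1 / (1 : ℝ≥0∞).toReal - 1 /
      (2 : ℝ≥0∞).toReal)).toReal,
    by positivity, fun g => ?_⟩
  have hle : volume.restrict (Ioc a c) ≤ ivlMeasure a b :=
    Measure.restrict_mono (Ioc_subset_ivl hc) le_rfl
  have hg := (Lp.memLp g).mono_measure hle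
  have h1 := eLpNorm_le_eLpNorm_mul_rpow_measure_univ (p := 1) (q := 2) one_le_two hg.1
  have h2 : eLpNorm g 2 (volume.restrict (Ioc a c)) ≤ eLpNorm g 2 (ivlMeasure a b) :=
    eLpNorm_mono_measure _ hle
  rw [intervalIntegral.integral_of_le hc.1.le, integral_norm_eq_lintegral_enorm hg.1,
    ← eLpNorm_one_eq_lintegral_enorm, mul_comm, Lp.norm_def, ← ENNReal.toReal_mul]
  refine ENNReal.toReal_mono ?_ (h1.trans (by gcongr))
  refine ENNReal.mul_ne_top (Lp.eLpNorm_ne_top g) (ENNReal.rpow_ne_top_of_nonneg ?_ (by simp))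
  norm_num

/-- Truncations of functions continuous on `[a,b)` are square integrable. -/
theorem memLp_indicator {H : Type*} [NormedAddCommGroup H] {u : ℝ → H}
    (hu : ContinuousOn u (ivlC a b)) {c : ℝ} (hc : c ∈ ivl a b) :
    MemLp ((Ioc a c).indicator u) 2 (ivlMeasure a b) := by
  rw [memLp_indicator_iff_restrict measurableSet_Ioc, restrict_Ioc_ivlMeasure hc]
  have huc := hu.mono (Icc_subset_ivlC hc)
  obtain ⟨C, hC⟩ := isCompact_Icc.exists_bound_of_continuousOn huc
  refine MemLp.of_bound ((huc.mono Ioc_subset_Icc_self).aestronglyMeasurable measurableSet_Ioc) C ?_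
  rw [ae_restrict_iff' measurableSet_Ioc]
  exact Eventually.of_forall fun x hx => hC x (Ioc_subset_Icc_self hx)

theorem exists_norm_indicator_le {H : Type*} [NormedAddCommGroup H] (hc : c ∈ ivl a b) :
    ∃ K : ℝ, 0 ≤ K ∧ ∀ (u : ℝ → H) (hu : MemLp ((Ioc a c).indicator u) 2 (ivlMeasure a b)) (M : ℝ),
      0 ≤ M → (∀ x ∈ Ioc a c, ‖u x‖ ≤ M) → ‖hu.toLp _‖ ≤ K * M := by
  refine ⟨((volume.restrict (Ioc a c) univ) ^ ((2 : ℝ≥0∞).toReal⁻¹)).toReal, by positivity,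
    fun u hu M hM hb => ?_⟩
  rw [Lp.norm_toLp, eLpNorm_indicator_eq_eLpNorm_restrict measurableSet_Ioc,
    restrict_Ioc_ivlMeasure hc]
  have h1 := eLpNorm_le_of_ae_bound (p := 2) (μ := volume.restrict (Ioc a c)) (f := u) (C := M) (by
    rw [ae_restrict_iff' measurableSet_Ioc]
    exact Eventually.of_forall hb)
  refine (ENNReal.toReal_mono ?_ h1).trans ?_
  · refine ENNReal.mul_ne_top ?_ ENNReal.ofReal_ne_top
    simp
  · rw [ENNReal.toReal_mul, ENNReal.toReal_ofReal hM]

end estimates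

/-! ### The solutions φ_α(z, ·)k and their truncations. -/

section fundamentalSolutions

variable {H : Type*} [NormedAddCommGroup H] [InnerProductSpace ℂ H] [CompleteSpace H]

section ivp

variable {J : Set ℝ} {V : ℝ → H →L[ℂ] H}

/-- The solution of `τ u = z u` with Cauchy data `y₀`, `y₁` at `c`. -/
def ivp (hV : LocPotential J V) (z : ℂ) {c : ℝ} (hc : c ∈ J) (y₀ y₁ : H) : ℝ → H :=
  (exists_sol hV z (f := 0) LocInt.zero hc y₀ y₁).choose

/-- The derivative of `ivp`. -/
def ivpDeriv (hV : LocPotential J V) (z : ℂ) {c : ℝ} (hc : c ∈ J) (y₀ y₁ : H) : ℝ → H :=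
  (exists_sol hV z (f := 0) LocInt.zero hc y₀ y₁).choose_spec.choose

variable (hV : LocPotential J V) (z : ℂ) {c : ℝ} (hc : c ∈ J)

theorem sol_ivp (y₀ y₁ : H) : Sol J V z 0 (ivp hV z hc y₀ y₁) (ivpDeriv hV z hc y₀ y₁) :=
  (exists_sol hV z (f := 0) LocInt.zero hc y₀ y₁).choose_spec.choose_spec.1

theorem ivp_base (y₀ y₁ : H) : ivp hV z hc y₀ y₁ c = y₀ :=
  (exists_sol hV z (f := 0) LocInt.zero hc y₀ y₁).choose_spec.choose_spec.2.1

theorem ivpDeriv_base (y₀ y₁ : H) : ivpDeriv hV z hc y₀ y₁ c = y₁ :=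
  (exists_sol hV z (f := 0) LocInt.zero hc y₀ y₁).choose_spec.choose_spec.2.2.1

theorem ivp_bound (y₀ y₁ : H) {x : ℝ} (hx : x ∈ J) :
    max ‖ivp hV z hc y₀ y₁ x‖ ‖ivpDeriv hV z hc y₀ y₁ x‖ ≤
      max ‖y₀‖ ‖y₁‖ * Real.exp |∫ s in c..x, (1 + ‖V s‖ + ‖z‖)| := by
  have := (exists_sol hV z (f := 0) LocInt.zero hc y₀ y₁).choose_spec.choose_spec.2.2.2 x hx
  simp only [Pi.zero_apply, norm_zero, intervalIntegral.integral_zero, abs_zero, add_zero] at this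
  exact this

theorem eqOn_ivp {u u' : ℝ → H} (h : Sol J V z 0 u u') :
    EqOn u (ivp hV z hc (u c) (u' c)) J ∧ EqOn u' (ivpDeriv hV z hc (u c) (u' c)) J :=
  h.eqOn hV (sol_ivp hV z hc _ _) (by rfl) hc (ivp_base hV z hc _ _).symm
    (ivpDeriv_base hV z hc _ _).symm

theorem ivp_add (y₀ y₁ w₀ w₁ : H) {x : ℝ} (hx : x ∈ J) :
    ivp hV z hc (y₀ + w₀) (y₁ + w₁) x = ivp hV z hc y₀ y₁ x + ivp hV z hc w₀ w₁ x ∧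
    ivpDeriv hV z hc (y₀ + w₀) (y₁ + w₁) x
      = ivpDeriv hV z hc y₀ y₁ x + ivpDeriv hV z hc w₀ w₁ x := by
  have h := ((sol_ivp hV z hc y₀ y₁).add (sol_ivp hV z hc w₀ w₁)).congr_ae (g := 0)
    hV.ordConnected (by simp [EventuallyEq])
  obtain ⟨e1, e2⟩ := eqOn_ivp hV z hc h
  simp only [ivp_base, ivpDeriv_base] at e1 e2
  exact ⟨(e1 hx).symm, (e2 hx).symm⟩

theorem ivp_smul (k : ℂ) (y₀ y₁ : H) {x : ℝ} (hx : x ∈ J) :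
    ivp hV z hc (k • y₀) (k • y₁) x = k • ivp hV z hc y₀ y₁ x ∧
    ivpDeriv hV z hc (k • y₀) (k • y₁) x = k • ivpDeriv hV z hc y₀ y₁ x := by
  have h := ((sol_ivp hV z hc y₀ y₁).const_smul k).congr_ae (g := 0)
    hV.ordConnected (by simp [EventuallyEq])
  obtain ⟨e1, e2⟩ := eqOn_ivp hV z hc h
  simp only [ivp_base, ivpDeriv_base] at e1 e2
  exact ⟨(e1 hx).symm, (e2 hx).symm⟩

end ivp

variable {a : ℝ} {b : EReal} {V : ℝ → H →L[ℂ] H}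

/-- The solution `φ_α(z, ·) k`. -/
def phiSol (hab : (a : EReal) < b) (hV : LocPotential (ivlC a b) V) (α : H →L[ℂ] H) (z : ℂ)
    (k : H) : ℝ → H :=
  ivp hV z (left_mem_ivlC hab) (-opSin α k) (opCos α k)

/-- The derivative of `phiSol`. -/
def phiSolDeriv (hab : (a : EReal) < b) (hV : LocPotential (ivlC a b) V) (α : H →L[ℂ] H) (z : ℂ)
    (k : H) : ℝ → H :=
  ivpDeriv hV z (left_mem_ivlC hab) (-opSin α k) (opCos α k)

variable (hab : (a : EReal) < b) (hV : LocPotential (ivlC a b) V) {α : H →L[ℂ] H}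

theorem sol_phiSol (z : ℂ) (k : H) :
    Sol (ivlC a b) V z 0 (phiSol hab hV α z k) (phiSolDeriv hab hV α z k) := sol_ivp _ _ _ _ _

theorem bc1_phiSol (hα : IsSelfAdjoint α) (z : ℂ) (k : H) :
    bc1 α (phiSol hab hV α z k a) (phiSolDeriv hab hV α z k a) = 0 := by
  rw [phiSol, phiSolDeriv, ivp_base, ivpDeriv_base]
  simpa using bc1_rotate hα 0 k

theorem bc2_phiSol (hα : IsSelfAdjoint α) (z : ℂ) (k : H) :
    bc2 α (phiSol hab hV α z k a) (phiSolDeriv hab hV α z k a) = k := by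
  rw [phiSol, phiSolDeriv, ivp_base, ivpDeriv_base]
  simpa using bc2_rotate hα 0 k

/-- The truncation of `k ↦ φ_α(z, ·) k` to `(a, c)` is a bounded operator from `H` to `L²`
which is bounded from below. -/
theorem exists_truncPhi (hα : IsSelfAdjoint α) (z : ℂ) {c : ℝ} (hc : c ∈ ivl a b) :
    ∃ Φ : H →L[ℂ] L2 H a b,
      (∀ k, Φ k =ᵐ[ivlMeasure a b] (Ioc a c).indicator (phiSol hab hV α z k)) ∧
      ∃ K : ℝ, 0 ≤ K ∧ ∀ k, ‖k‖ ≤ K * ‖Φ k‖ := by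
  have hcont : ∀ k, ContinuousOn (phiSol hab hV α z k) (ivlC a b) := fun k =>
    (sol_phiSol hab hV z k).continuousOn ordConnected_ivlC
  have hmem := fun k => memLp_indicator (hcont k) hc
  have haC := left_mem_ivlC hab
  have hsub := Icc_subset_ivlC (a := a) hc
  obtain ⟨K, hK0, hK⟩ := exists_norm_indicator_le (H := H) hc
  set E := Real.exp |∫ s in a..c, (1 + ‖V s‖ + ‖z‖)| with hE
  set S := max ‖opSin α‖ ‖opCos α‖ with hS
  have hsup : ∀ k, ∀ x ∈ Ioc a c, ‖phiSol hab hV α z k x‖ ≤ S * ‖k‖ * E := by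
    intro k x hx
    have hxC : x ∈ ivlC a b := hsub (Ioc_subset_Icc_self hx)
    refine (le_max_left _ _).trans ((ivp_bound hV z haC _ _ hxC).trans ?_)
    have h1 : max ‖-opSin α k‖ ‖opCos α k‖ ≤ S * ‖k‖ := by
      rw [norm_neg]
      exact max_le ((opSin α).le_of_opNorm_le (le_max_left _ _) k)
        ((opCos α).le_of_opNorm_le (le_max_right _ _) k)
    have h2 := Real.exp_le_exp.2 ((hV.volterraFamily z).abs_integral_mono haC
      (ivl_subset_ivlC hc) (x := x) (by rw [uIcc_of_le hc.1.le]; exact Ioc_subset_Icc_self hx))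
    have h3 := (norm_nonneg _).trans (le_max_left ‖-opSin α k‖ ‖opCos α k‖)
    gcongr
  have hL0 : ∀ x ∈ Ioc a c, x ∈ ivlC a b := fun x hx => hsub (Ioc_subset_Icc_self hx)
  let L : H →ₗ[ℂ] L2 H a b :=
    { toFun := fun k => (hmem k).toLp _
      map_add' := fun k l => by
        rw [← MemLp.toLp_add]
        refine MemLp.toLp_congr _ _ (Eventually.of_forall fun x => ?_)
        by_cases hx : x ∈ Ioc a c
        · simp only [indicator_of_mem hx, Pi.add_apply, phiSol, map_add, neg_add]
          exact (ivp_add hV z haC _ _ _ _ (hL0 x hx)).1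
        · simp [indicator_of_notMem hx]
      map_smul' := fun r k => by
        rw [RingHom.id_apply, ← MemLp.toLp_const_smul]
        refine MemLp.toLp_congr _ _ (Eventually.of_forall fun x => ?_)
        by_cases hx : x ∈ Ioc a c
        · simp only [indicator_of_mem hx, Pi.smul_apply, phiSol, map_smul, ← smul_neg]
          exact (ivp_smul hV z haC r _ _ (hL0 x hx)).1
        · simp [indicator_of_notMem hx] }
  have hLb : ∀ k, ‖L k‖ ≤ K * (S * E) * ‖k‖ := by
    intro k
    refine (hK _ (hmem k) (S * ‖k‖ * E) ?_ (hsup k)).trans (le_of_eq (by ring))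
    have : 0 ≤ S := (norm_nonneg _).trans (le_max_left _ _)
    positivity
  have hL : ∀ k, L k =ᵐ[ivlMeasure a b] (Ioc a c).indicator (phiSol hab hV α z k) := fun k =>
    (hmem k).coeFn_toLp
  refine ⟨L.mkContinuous _ hLb, hL, ?_⟩
  -- The lower bound: `k` is the value of 𝒞₂ on the Cauchy data, which are controlled by the norm
  -- over (a, c). It makes the range of Φ closed and Φ*Φ invertible.
  obtain ⟨K₁, hK₁, h1⟩ := exists_data_bound hV z hc
  obtain ⟨K₂, hK₂, h2⟩ := exists_integral_norm_le (H := H) hc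
  refine ⟨(‖opSin α‖ + ‖opCos α‖) * (K₁ * K₂), by positivity, fun k => ?_⟩
  have e1 := h1 0 _ _ (sol_phiSol hab hV (α := α) z k) LocInt.zero
  simp only [Pi.zero_apply, norm_zero, intervalIntegral.integral_zero, add_zero] at e1
  have e2 : ∫ x in a..c, ‖phiSol hab hV α z k x‖ = ∫ x in a..c, ‖L k x‖ := by
    rw [intervalIntegral.integral_of_le hc.1.le, intervalIntegral.integral_of_le hc.1.le]
    refine integral_congr_ae ?_
    have := hL k
    rw [Filter.EventuallyEq, ae_restrict_iff' (isOpen_ivl a b).measurableSet] at this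
    rw [Filter.EventuallyEq, ae_restrict_iff' measurableSet_Ioc]
    filter_upwards [this] with x hx hxm
    rw [hx (Ioc_subset_ivl hc hxm), indicator_of_mem hxm]
  rw [e2] at e1
  have e3 := e1.trans (mul_le_mul_of_nonneg_left (h2 (L k)) hK₁.le)
  have e4 : ‖k‖ ≤ (‖opSin α‖ + ‖opCos α‖) *
      max ‖phiSol hab hV α z k a‖ ‖phiSolDeriv hab hV α z k a‖ := by
    have h := bc2_phiSol hab hV hα z k
    calc ‖k‖ = ‖bc2 α (phiSol hab hV α z k a) (phiSolDeriv hab hV α z k a)‖ := by rw [h]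
      _ ≤ ‖(-opSin α) (phiSol hab hV α z k a)‖ + ‖opCos α (phiSolDeriv hab hV α z k a)‖ :=
        norm_add_le _ _
      _ ≤ ‖opSin α‖ * max ‖phiSol hab hV α z k a‖ ‖phiSolDeriv hab hV α z k a‖ +
          ‖opCos α‖ * max ‖phiSol hab hV α z k a‖ ‖phiSolDeriv hab hV α z k a‖ := by
        refine add_le_add ?_ ?_
        · rw [neg_apply, norm_neg]
          exact (opSin α).le_of_opNorm_le_of_le le_rfl (le_max_left _ _)
        · exact (opCos α).le_of_opNorm_le_of_le le_rfl (le_max_right _ _)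
      _ = _ := by ring
  refine e4.trans ?_
  rw [mul_assoc, mul_assoc K₁]
  exact mul_le_mul_of_nonneg_left e3 (by positivity)

theorem inner_truncPhi {z : ℂ} {c : ℝ} (hc : c ∈ ivl a b) {Φ : H →L[ℂ] L2 H a b}
    (hΦ : ∀ k, Φ k =ᵐ[ivlMeasure a b] (Ioc a c).indicator (phiSol hab hV α z k)) (k : H)
    (f : L2 H a b) :
    inner ℂ (Φ k) f = ∫ x in a..c, inner ℂ (phiSol hab hV α z k x) (f x) := by
  rw [L2.inner_def, intervalIntegral.integral_of_le hc.1.le, ← restrict_Ioc_ivlMeasure hc,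
    ← integral_indicator measurableSet_Ioc]
  refine integral_congr_ae ?_
  filter_upwards [hΦ k] with x hx
  rw [hx]
  by_cases hxm : x ∈ Ioc a c
  · simp [indicator_of_mem hxm]
  · simp [indicator_of_notMem hxm]

end fundamentalSolutions

/-! ### The boundary value problem: a priori estimate and closed range. -/

section boundaryValueProblem

variable {H : Type*} [NormedAddCommGroup H] [InnerProductSpace ℂ H] [CompleteSpace H]
variable {a : ℝ} {b : EReal} {V : ℝ → H →L[ℂ] H} {α : H →L[ℂ] H} {z : ℂ}

/-- `u ∈ dom(H_α)` and `(H_α - z) u = f`. -/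
def SolvesBVP (a : ℝ) (b : EReal) (V : ℝ → H →L[ℂ] H) (α : H →L[ℂ] H) (z : ℂ)
    (f u : L2 H a b) : Prop :=
  ∃ v v' : ℝ → H, Sol (ivlC a b) V z f v v' ∧ u =ᵐ[ivlMeasure a b] v ∧ bc1 α (v a) (v' a) = 0

theorem SolvesBVP.add {f g u v : L2 H a b} (h : SolvesBVP a b V α z f u)
    (h' : SolvesBVP a b V α z g v) : SolvesBVP a b V α z (f + g) (u + v) := by
  obtain ⟨y, y', hy, hu, hb⟩ := h
  obtain ⟨w, w', hw, hv, hb'⟩ := h'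
  refine ⟨_, _, (hy.add hw).congr_ae ordConnected_ivlC ?_, ?_, ?_⟩
  · rw [restrict_ivlC]; exact (Lp.coeFn_add f g).symm
  · filter_upwards [Lp.coeFn_add u v, hu, hv] with x h1 h2 h3
    rw [h1, Pi.add_apply, h2, h3]
  · rw [bc1_add, hb, hb', add_zero]

theorem SolvesBVP.smul {f u : L2 H a b} (h : SolvesBVP a b V α z f u) (k : ℂ) :
    SolvesBVP a b V α z (k • f) (k • u) := by
  obtain ⟨y, y', hy, hu, hb⟩ := h
  refine ⟨_, _, (hy.const_smul k).congr_ae ordConnected_ivlC ?_, ?_, ?_⟩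
  · rw [restrict_ivlC]; exact (Lp.coeFn_smul k f).symm
  · filter_upwards [Lp.coeFn_smul k u, hu] with x h1 h2
    rw [h1, Pi.smul_apply, h2]
  · rw [bc1_smul, hb, smul_zero]

theorem SolvesBVP.sub {f g u v : L2 H a b} (h : SolvesBVP a b V α z f u)
    (h' : SolvesBVP a b V α z g v) : SolvesBVP a b V α z (f - g) (u - v) := by
  have := h.add (h'.smul (-1))
  simpa only [neg_smul, one_smul, ← sub_eq_add_neg] using this

theorem SolvesBVP.change_param {f u : L2 H a b} (h : SolvesBVP a b V α z f u) (w : ℂ) :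
    SolvesBVP a b V α w (f + (z - w) • u) u := by
  obtain ⟨y, y', hy, hu, hb⟩ := h
  refine ⟨y, y', (hy.change_param w).congr_ae ordConnected_ivlC ?_, hu, hb⟩
  rw [restrict_ivlC]
  filter_upwards [Lp.coeFn_add f ((z - w) • u), Lp.coeFn_smul (z - w) u, hu] with x h1 h2 h3
  rw [h1, Pi.add_apply, h2, Pi.smul_apply, h3]

theorem toLp_eq_of_ae {H : Type*} [NormedAddCommGroup H] [InnerProductSpace ℂ H] {u : L2 H a b}
    {v : ℝ → H} (h : u =ᵐ[ivlMeasure a b] v)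
    (hv : MemLp v 2 (ivlMeasure a b)) : hv.toLp v = u :=
  Lp.ext (hv.coeFn_toLp.trans h.symm)

theorem memLp_of_ae {H : Type*} [NormedAddCommGroup H] [InnerProductSpace ℂ H] {u : L2 H a b}
    {v : ℝ → H} (h : u =ᵐ[ivlMeasure a b] v) :
    MemLp v 2 (ivlMeasure a b) :=
  (memLp_congr_ae h).1 (Lp.memLp u)

variable [TopologicalSpace.SeparableSpace H]

theorem mem_graphHalpha_iff (hab : (a : EReal) < b) (hV : IsPotential a b V) (z : ℂ)
    (p : L2 H a b × L2 H a b) :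
    p ∈ graphHalpha a b V α ↔ SolvesBVP a b V α z (p.2 - z • p.1) p.1 := by
  constructor
  · rintro ⟨u, u', u'', u₀, u₁, hu, h1, h2, hb, hc⟩
    obtain ⟨v, v', hv, e, e'⟩ := hu.exists_sol hab hV.locPotential (f := ⇑(p.2 - z • p.1)) (z := z)
      (locInt_of_memLp (Lp.memLp _)) (by
        filter_upwards [h1, h2, Lp.coeFn_sub p.2 (z • p.1), Lp.coeFn_smul z p.1] with x x1 x2 x3 x4
        rw [x3, Pi.sub_apply, x4, Pi.smul_apply, x1, x2]
        abel)
    obtain ⟨b0, b1⟩ := hb.eq hab hv e e'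
    refine ⟨v, v', hv, h1.trans ?_, ?_⟩
    · rw [EventuallyEq, ae_restrict_iff' (isOpen_ivl a b).measurableSet]
      exact Eventually.of_forall fun x hx => e hx
    · rw [bc1, ← b0, ← b1, add_comm, hc]
  · rintro ⟨v, v', hv, h1, hc⟩
    refine ⟨v, v', _, v a, v' a, hv.isW21Loc, h1, ?_, hv.hasBoundaryValues hab, ?_⟩
    · rw [tau_secondDeriv]
      filter_upwards [h1, Lp.coeFn_sub p.2 (z • p.1), Lp.coeFn_smul z p.1] with x x1 x3 x4
      rw [x3, Pi.sub_apply, x4, Pi.smul_apply, x1]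
      abel
    · rw [bc1, add_comm] at hc
      exact hc

/-- Green's formula for elements of `L²`. -/
theorem IsPotential.green_formula (hab : (a : EReal) < b) (hV : IsPotential a b V) {w : ℂ}
    {f g u x : L2 H a b} {v v' y y' : ℝ → H} (h : Sol (ivlC a b) V z f v v')
    (hu : u =ᵐ[ivlMeasure a b] v) (h' : Sol (ivlC a b) V w g y y')
    (hx : x =ᵐ[ivlMeasure a b] y) :
    inner ℂ (v a) (y' a) - inner ℂ (v' a) (y a) =
      (w - starRingEnd ℂ z) * inner ℂ u x + inner ℂ u g - inner ℂ f x := by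
  have := hV.wronskian_left hab h h' (memLp_of_ae hu) (Lp.memLp f) (memLp_of_ae hx) (Lp.memLp g)
  rwa [toLp_eq_of_ae hu, toLp_eq_of_ae hx, Lp.toLp_coeFn, Lp.toLp_coeFn] at this

/-- Green's formula for `u` against itself: with 𝒞₁u = 0 it reduces to 2i Im z ‖u‖² = (f, u) - (u,
f). -/
theorem SolvesBVP.norm_le (hab : (a : EReal) < b) (hV : IsPotential a b V) (hα : IsSelfAdjoint α)
    {f u : L2 H a b} (h : SolvesBVP a b V α z f u) : |z.im| * ‖u‖ ≤ ‖f‖ := by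
  obtain ⟨v, v', hv, hu, hb⟩ := h
  have e := hV.green_formula hab hv hu hv hu
  rw [symplectic_bc hα, hb, inner_zero_left, inner_zero_right, sub_zero] at e
  have h1 : (z - starRingEnd ℂ z) * inner ℂ u u = inner ℂ f u - inner ℂ u f := by
    linear_combination -e
  have h2 : ‖(z - starRingEnd ℂ z) * inner ℂ u u‖ = 2 * |z.im| * ‖u‖ ^ 2 := by
    rw [norm_mul, inner_self_eq_norm_sq_to_K, Complex.sub_conj]
    simp
  have h3 : ‖inner ℂ f u - inner ℂ u f‖ ≤ 2 * (‖f‖ * ‖u‖) := by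
    refine (norm_sub_le _ _).trans ?_
    have h4 := norm_inner_le_norm (𝕜 := ℂ) f u
    have h5 := norm_inner_le_norm (𝕜 := ℂ) u f
    linarith
  rw [← h1, h2] at h3
  by_cases hu0 : ‖u‖ = 0
  · rw [hu0, mul_zero]; positivity
  · have : 0 < ‖u‖ := lt_of_le_of_ne (norm_nonneg _) (Ne.symm hu0)
    refine le_of_mul_le_mul_right ?_ this
    nlinarith

theorem SolvesBVP.unique (hab : (a : EReal) < b) (hV : IsPotential a b V) (hα : IsSelfAdjoint α)
    (hz : z.im ≠ 0) {f u v : L2 H a b} (h : SolvesBVP a b V α z f u)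
    (h' : SolvesBVP a b V α z f v) : u = v := by
  have := (h.sub h').norm_le hab hV hα
  rw [sub_self, norm_zero] at this
  have h0 : 0 < |z.im| := abs_pos.2 hz
  have : ‖u - v‖ ≤ 0 := by
    by_contra hc
    push Not at hc
    nlinarith
  exact sub_eq_zero.1 (norm_le_zero_iff.1 this)

/-- The range of `H_α - z`. -/
def rangeBVP (a : ℝ) (b : EReal) (V : ℝ → H →L[ℂ] H) (α : H →L[ℂ] H) (z : ℂ) :
    Submodule ℂ (L2 H a b) where
  carrier := {f | ∃ u, SolvesBVP a b V α z f u}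
  zero_mem' := ⟨0, 0, 0, (Sol.zero).congr_ae ordConnected_ivlC (by
    rw [restrict_ivlC]; exact (Lp.coeFn_zero _ _ _).symm), Lp.coeFn_zero _ _ _, by simp [bc1]⟩
  add_mem' := fun ⟨u, hu⟩ ⟨v, hv⟩ => ⟨u + v, hu.add hv⟩
  smul_mem' := fun k _ ⟨u, hu⟩ => ⟨k • u, hu.smul k⟩

/-- For convergent right-hand sides the solutions are Cauchy by `SolvesBVP.norm_le`, and so are
their Cauchy data by `exists_data_bound`. The solution with the limiting data is their pointwise
limit by `Sol.bound`, hence represents the L² limit, and the boundary condition passes to the limit.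
-/
theorem isClosed_rangeBVP (hab : (a : EReal) < b) (hV : IsPotential a b V)
    (hα : IsSelfAdjoint α) (hz : z.im ≠ 0) :
    IsClosed (rangeBVP a b V α z : Set (L2 H a b)) := by
  have h0 : 0 < |z.im| := abs_pos.2 hz
  refine isClosed_of_closure_subset fun f hf => ?_
  obtain ⟨F, hF, hlim⟩ := mem_closure_iff_seq_limit.1 hf
  choose u hu using hF
  have hucs : CauchySeq u := by
    rw [Metric.cauchySeq_iff]
    intro ε hε
    obtain ⟨N, hN⟩ := Metric.cauchySeq_iff.1 hlim.cauchySeq (|z.im| * ε) (by positivity)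
    refine ⟨N, fun m hm n hn => ?_⟩
    have h1 := ((hu m).sub (hu n)).norm_le hab hV hα
    have h2 := hN m hm n hn
    rw [dist_eq_norm] at h2 ⊢
    exact lt_of_mul_lt_mul_left (h1.trans_lt h2) h0.le
  obtain ⟨u₀, hu₀⟩ := cauchySeq_tendsto_of_complete hucs
  choose v v' hv huv hb using hu
  obtain ⟨c, hc⟩ := exists_mem_ivl hab
  have hP := hV.locPotential
  obtain ⟨K, hK, hdata⟩ := exists_data_bound hP z hc
  obtain ⟨K₂, hK₂, hL1⟩ := exists_integral_norm_le (H := H) hc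
  have hL1' : ∀ g : L2 H a b, ∀ y : ℝ → H, g =ᵐ[ivlMeasure a b] y →
      ∫ x in a..c, ‖y x‖ ≤ K₂ * ‖g‖ := by
    intro g y hgy
    refine le_of_eq_of_le ?_ (hL1 g)
    rw [intervalIntegral.integral_of_le hc.1.le, intervalIntegral.integral_of_le hc.1.le]
    refine integral_congr_ae ?_
    have := ae_restrict_of_ae (s := Ioc a c) hgy
    rw [restrict_Ioc_ivlMeasure hc] at this
    filter_upwards [this] with x hx
    rw [hx]
  have hdiff : ∀ m n, max ‖v m a - v n a‖ ‖v' m a - v' n a‖ ≤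
      K * (K₂ * ‖u m - u n‖ + K₂ * ‖F m - F n‖) := by
    intro m n
    have hs := (hv m).sub (hv n)
    refine (hdata _ _ _ hs ?_).trans ?_
    · exact (locInt_of_memLp (Lp.memLp (F m))).sub (locInt_of_memLp (Lp.memLp (F n)))
    · refine mul_le_mul_of_nonneg_left (add_le_add (hL1' _ _ ?_) (hL1' _ _ ?_)) hK.le
      · filter_upwards [Lp.coeFn_sub (u m) (u n), huv m, huv n] with x h1 h2 h3
        rw [h1, Pi.sub_apply, h2, h3]
      · exact Lp.coeFn_sub (F m) (F n)
  have hcauchy : CauchySeq (fun n => (v n a, v' n a)) := by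
    rw [Metric.cauchySeq_iff]
    intro ε hε
    obtain ⟨N₁, hN₁⟩ := Metric.cauchySeq_iff.1 hlim.cauchySeq (ε / (2 * (K * (K₂ + 1))))
      (by positivity)
    obtain ⟨N₂, hN₂⟩ := Metric.cauchySeq_iff.1 hucs (ε / (2 * (K * (K₂ + 1)))) (by positivity)
    refine ⟨max N₁ N₂, fun m hm n hn => ?_⟩
    have h1 := hN₁ m (le_of_max_le_left hm) n (le_of_max_le_left hn)
    have h2 := hN₂ m (le_of_max_le_right hm) n (le_of_max_le_right hn)
    rw [dist_eq_norm] at h1 h2 ⊢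
    refine (hdiff m n).trans_lt ?_
    rw [lt_div_iff₀ (by positivity)] at h1 h2
    have p1 : 0 ≤ K * ‖u m - u n‖ := by positivity
    have p2 : 0 ≤ K * ‖F m - F n‖ := by positivity
    nlinarith
  obtain ⟨⟨y₀, y₁⟩, hy⟩ := cauchySeq_tendsto_of_complete hcauchy
  have hy0 : Tendsto (fun n => v n a) atTop (𝓝 y₀) := (continuous_fst.tendsto _).comp hy
  have hy1 : Tendsto (fun n => v' n a) atTop (𝓝 y₁) := (continuous_snd.tendsto _).comp hy
  have hfl : LocInt (ivlC a b) f := locInt_of_memLp (Lp.memLp f)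
  obtain ⟨w, w', hw, hw0, hw1, -⟩ := exists_sol hP z hfl (left_mem_ivlC hab) y₀ y₁
  have hpt : ∀ x ∈ ivl a b, Tendsto (fun n => v n x) atTop (𝓝 (w x)) := by
    intro x hx
    obtain ⟨K₃, hK₃, hL3⟩ := exists_integral_norm_le (H := H) hx
    have hbd : ∀ n, ‖v n x - w x‖ ≤ (max ‖v n a - y₀‖ ‖v' n a - y₁‖ + K₃ * ‖F n - f‖) *
        Real.exp |∫ s in a..x, (1 + ‖V s‖ + ‖z‖)| := by
      intro n
      have hs := (hv n).sub hw
      have h1 := hs.bound hP ((locInt_of_memLp (Lp.memLp (F n))).sub hfl) (left_mem_ivlC hab)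
        (ivl_subset_ivlC hx)
      rw [hw0, hw1] at h1
      refine (le_max_left _ _).trans (h1.trans ?_)
      have h2 : |∫ s in a..x, ‖F n s - f s‖| ≤ K₃ * ‖F n - f‖ := by
        rw [abs_of_nonneg (intervalIntegral.integral_nonneg hx.1.le fun _ _ => norm_nonneg _)]
        refine le_of_eq_of_le ?_ (hL3 (F n - f))
        rw [intervalIntegral.integral_of_le hx.1.le, intervalIntegral.integral_of_le hx.1.le]
        refine integral_congr_ae ?_
        have := ae_restrict_of_ae (s := Ioc a x) (Lp.coeFn_sub (F n) f)
        rw [restrict_Ioc_ivlMeasure hx] at this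
        filter_upwards [this] with t ht
        rw [ht, Pi.sub_apply]
      gcongr
    rw [tendsto_iff_norm_sub_tendsto_zero]
    refine squeeze_zero (fun _ => norm_nonneg _) hbd ?_
    have t1 := tendsto_iff_norm_sub_tendsto_zero.1 hy0
    have t2 := tendsto_iff_norm_sub_tendsto_zero.1 hy1
    have t3 := tendsto_iff_norm_sub_tendsto_zero.1 hlim
    have := ((t1.max t2).add (t3.const_mul K₃)).mul_const
      (Real.exp |∫ s in a..x, (1 + ‖V s‖ + ‖z‖)|)
    simpa using this
  refine ⟨u₀, w, w', hw, ?_, ?_⟩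
  · obtain ⟨ns, hns, hae⟩ := (tendstoInMeasure_of_tendsto_Lp hu₀).exists_seq_tendsto_ae
    have h3 : ∀ᵐ x ∂(ivlMeasure a b), x ∈ ivl a b :=
      ae_restrict_mem (isOpen_ivl a b).measurableSet
    filter_upwards [hae, h3, ae_all_iff.2 huv] with x h1 h2 h4
    simp only [h4] at h1
    exact tendsto_nhds_unique h1 ((hpt x h2).comp hns.tendsto_atTop)
  · rw [hw0, hw1]
    have hlim : Tendsto (fun n => bc1 α (v n a) (v' n a)) atTop (𝓝 (bc1 α y₀ y₁)) :=
      (((opCos α).continuous.tendsto _).comp hy0).add (((opSin α).continuous.tendsto _).comp hy1)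
    simp only [hb] at hlim
    exact (tendsto_nhds_unique hlim tendsto_const_nhds)

end boundaryValueProblem

/-! ### The resolvent of H_α and its analyticity. -/

section resolvent

variable {H : Type*} [NormedAddCommGroup H] [InnerProductSpace ℂ H] [CompleteSpace H]
variable {a : ℝ} {b : EReal} {V : ℝ → H →L[ℂ] H} {α : H →L[ℂ] H} {z : ℂ}

/-- Letting `k` vary, pairing with φ_α(w, ·)k determines 𝒞₁ at `a`. -/
theorem wronskian_phiSol_left (hab : (a : EReal) < b) (hV : LocPotential (ivlC a b) V)
    (hα : IsSelfAdjoint α) (w : ℂ) (k : H) (v v' : ℝ → H) :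
    wronskian (phiSol hab hV α w k) (phiSolDeriv hab hV α w k) v v' a
      = -inner ℂ k (bc1 α (v a) (v' a)) := by
  rw [wronskian, symplectic_bc hα, bc1_phiSol hab hV hα, bc2_phiSol hab hV hα, inner_zero_left,
    zero_sub]

variable [TopologicalSpace.SeparableSpace H]

/-- The boundary value of a solution with vanishing Cauchy data at `c` is determined by `f`. -/
theorem wronskian_phiSol (hab : (a : EReal) < b) (hV : IsPotential a b V) {c : ℝ}
    (hc : c ∈ ivl a b) {f : ℝ → H} {v v' : ℝ → H}
    (hv : Sol (ivlC a b) V z f v v') (k : H) :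
    wronskian (phiSol hab hV.locPotential α (starRingEnd ℂ z) k)
        (phiSolDeriv hab hV.locPotential α (starRingEnd ℂ z) k) v v' c -
      wronskian (phiSol hab hV.locPotential α (starRingEnd ℂ z) k)
        (phiSolDeriv hab hV.locPotential α (starRingEnd ℂ z) k) v v' a =
      -∫ x in a..c, inner ℂ (phiSol hab hV.locPotential α (starRingEnd ℂ z) k x) (f x) := by
  rw [(sol_phiSol hab hV.locPotential (starRingEnd ℂ z) k).wronskian_sub hV.locPotential
    hV.selfAdjoint_ivlC hv (left_mem_ivlC hab) (ivl_subset_ivlC hc),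
    ← intervalIntegral.integral_neg]
  simp

/-- Solving from `c` with zero data gives a solution that vanishes beyond `c`, hence is square
integrable. Its 𝒞₁ at `a`, tested against `k`, is up to sign the inner product of φ_α(z̄, ·)k with
`f`, which is zero. -/
theorem exists_solvesBVP_of_orthogonal (hab : (a : EReal) < b) (hV : IsPotential a b V)
    (hα : IsSelfAdjoint α) {c : ℝ} (hc : c ∈ ivl a b) {Φ : H →L[ℂ] L2 H a b}
    (hΦ : ∀ k, Φ k =ᵐ[ivlMeasure a b]
      (Ioc a c).indicator (phiSol hab hV.locPotential α (starRingEnd ℂ z) k))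
    {f : L2 H a b} (hf : ∀ᵐ x ∂(ivlMeasure a b), x ∉ Ioc a c → f x = 0)
    (ho : ∀ k, inner ℂ (Φ k) f = 0) : ∃ u, SolvesBVP a b V α z f u := by
  have hP := hV.locPotential
  have hcC := ivl_subset_ivlC hc
  obtain ⟨v, v', hv, h0, h1, -⟩ := exists_sol hP z (locInt_of_memLp (Lp.memLp f)) hcC 0 0
  have hsub : ivlC c b ⊆ ivlC a b := fun x hx => ⟨hc.1.le.trans hx.1, hx.2⟩
  have hvan : ∀ x ∈ ivl a b, x ∉ Ioc a c → v x = 0 := by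
    intro x hx hxc
    have hcx : c < x := by
      by_contra h
      exact hxc ⟨hx.1, not_lt.1 h⟩
    have h2 : ⇑f =ᵐ[volume.restrict (ivlC c b)] (0 : ℝ → H) := by
      rw [restrict_ivlC]
      have h3 : ivl c b ⊆ ivl a b := fun x hx => ⟨hc.1.trans hx.1, hx.2⟩
      have h4 := ae_restrict_mem (μ := volume) (isOpen_ivl c b).measurableSet
      filter_upwards [ae_restrict_of_ae_restrict_of_subset h3 hf, h4] with y hy hy'
      exact hy fun h => absurd hy'.1 (not_lt.2 h.2)
    exact ((hv.mono hsub).eqOn (hP.mono hsub ordConnected_ivlC) Sol.zero h2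
      (left_mem_ivlC hc.2) h0 h1).1 ⟨hcx.le, hx.2⟩
  have hmem := memLp_indicator (hv.continuousOn ordConnected_ivlC) hc
  refine ⟨hmem.toLp _, v, v', hv, ?_, ?_⟩
  · refine hmem.coeFn_toLp.trans ?_
    rw [EventuallyEq, ae_restrict_iff' (isOpen_ivl a b).measurableSet]
    refine Eventually.of_forall fun x hx => ?_
    by_cases hxc : x ∈ Ioc a c
    · simp [indicator_of_mem hxc]
    · simp [indicator_of_notMem hxc, hvan x hx hxc]
  · refine ext_inner_left ℂ fun k => ?_
    have e := wronskian_phiSol (α := α) hab hV hc hv k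
    rw [← inner_truncPhi hab hP hc hΦ, ho k, wronskian_phiSol_left hab hP hα] at e
    rw [inner_zero_right]
    simpa [wronskian, h0, h1] using e

/-- Let P be the projection onto the closed range of Φ. The residual gc - P gc is supported in (a,
c] and orthogonal to every Φ k, so by `exists_solvesBVP_of_orthogonal` it lies in the range of H_α -
z. It is then orthogonal to `g`, hence to itself. -/
theorem eq_phiSol_of_orthogonal (hab : (a : EReal) < b) (hV : IsPotential a b V)
    (hα : IsSelfAdjoint α) {g : L2 H a b} (hg : ∀ f ∈ rangeBVP a b V α z, inner ℂ f g = 0)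
    {c : ℝ} (hc : c ∈ ivl a b) :
    ∃ k, ∀ᵐ x ∂(ivlMeasure a b), x ∈ Ioc a c →
      g x = phiSol hab hV.locPotential α (starRingEnd ℂ z) k x := by
  obtain ⟨Φ, hΦ, K, hK, hb⟩ := exists_truncPhi hab hV.locPotential hα (starRingEnd ℂ z) hc
  have hgm : MemLp ((Ioc a c).indicator g) 2 (ivlMeasure a b) :=
    (Lp.memLp g).indicator measurableSet_Ioc
  set gc := hgm.toLp _ with hgc
  have hgce : gc =ᵐ[ivlMeasure a b] (Ioc a c).indicator g := hgm.coeFn_toLp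
  have hcl : IsClosed (Φ.range : Set (L2 H a b)) := by
    have : AntilipschitzWith ⟨K, hK⟩ Φ := ContinuousLinearMap.antilipschitz_of_bound _ hb
    exact this.isClosed_range Φ.uniformContinuous
  have : CompleteSpace Φ.range := hcl.completeSpace_coe
  obtain ⟨k, hk⟩ := (Φ.range.orthogonalProjectionOnto gc).2
  have horth : ∀ l, inner ℂ (Φ l) (gc - Φ k) = 0 := by
    intro l
    have := Φ.range.sub_starProjection_mem_orthogonal gc
    rw [Submodule.mem_orthogonal] at this
    have h1 := this (Φ l) ⟨l, rfl⟩
    rw [Submodule.starProjection_apply, ← hk] at h1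
    exact h1
  have hsupp : ∀ᵐ x ∂(ivlMeasure a b), x ∉ Ioc a c → (gc - Φ k) x = 0 := by
    filter_upwards [Lp.coeFn_sub gc (Φ k), hgce, hΦ k] with x h1 h2 h3 hx
    rw [h1, Pi.sub_apply, h2, h3, indicator_of_notMem hx, indicator_of_notMem hx, sub_zero]
  have h1 := hg _ (exists_solvesBVP_of_orthogonal hab hV hα hc hΦ hsupp horth)
  have h2 : inner ℂ (gc - Φ k) g = inner ℂ (gc - Φ k) gc := by
    rw [L2.inner_def, L2.inner_def]
    refine integral_congr_ae ?_
    filter_upwards [hsupp, hgce] with x h1 h2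
    by_cases hx : x ∈ Ioc a c
    · rw [h2, indicator_of_mem hx]
    · rw [h1 hx, inner_zero_left, inner_zero_left]
  have h3 : inner ℂ (gc - Φ k) (gc - Φ k) = 0 := by
    rw [inner_sub_right, ← h2, h1, ← inner_conj_symm, horth k]
    simp
  have h4 : gc = Φ k := sub_eq_zero.1 (inner_self_eq_zero.1 h3)
  refine ⟨k, ?_⟩
  have h5 := hΦ k
  rw [← h4] at h5
  filter_upwards [hgce, h5] with x h6 h7 hx
  rw [h6, indicator_of_mem hx, indicator_of_mem hx] at h7
  exact h7

/-- Injectivity of Φ makes `k` independent of `c`, so `g` equals φ_α(z̄, ·)k on all of (a, b). Being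
square integrable, it lies in the kernel of H_α - z̄, which is trivial. -/
theorem eq_zero_of_orthogonal_range (hab : (a : EReal) < b) (hV : IsPotential a b V)
    (hα : IsSelfAdjoint α) (hz : z.im ≠ 0) {g : L2 H a b}
    (hg : ∀ f ∈ rangeBVP a b V α z, inner ℂ f g = 0) : g = 0 := by
  have hP := hV.locPotential
  obtain ⟨c₀, hc₀⟩ := exists_mem_ivl hab
  obtain ⟨k, hk⟩ := eq_phiSol_of_orthogonal hab hV hα hg hc₀
  obtain ⟨Φ, hΦ, K, hK, hb⟩ := exists_truncPhi hab hP hα (starRingEnd ℂ z) hc₀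
  have hall : ∀ c ∈ ivl a b, c₀ ≤ c → ∀ᵐ x ∂(ivlMeasure a b), x ∈ Ioc a c →
      g x = phiSol hab hP α (starRingEnd ℂ z) k x := by
    intro c hc hcc
    obtain ⟨l, hl⟩ := eq_phiSol_of_orthogonal hab hV hα hg hc
    have hlk : Φ l = Φ k := by
      refine Lp.ext ?_
      filter_upwards [hΦ l, hΦ k, hk, hl] with x h1 h2 h3 h4
      rw [h1, h2]
      by_cases hx : x ∈ Ioc a c₀
      · rw [indicator_of_mem hx, indicator_of_mem hx, ← h3 hx, ← h4 ⟨hx.1, hx.2.trans hcc⟩]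
      · rw [indicator_of_notMem hx, indicator_of_notMem hx]
    have hlk' : l = k := by
      have := hb (l - k)
      rw [map_sub, hlk, sub_self, norm_zero, mul_zero] at this
      exact sub_eq_zero.1 (norm_le_zero_iff.1 this)
    rwa [hlk'] at hl
  -- Only rational `c` are used, so that countably many null sets are discarded.
  have hgφ : g =ᵐ[ivlMeasure a b] phiSol hab hP α (starRingEnd ℂ z) k := by
    have h1 : ∀ᵐ x ∂(ivlMeasure a b), ∀ q : ℚ, (q : ℝ) ∈ ivl a b → c₀ ≤ q → x ∈ Ioc a (q : ℝ) →
        g x = phiSol hab hP α (starRingEnd ℂ z) k x := by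
      rw [ae_all_iff]
      intro q
      by_cases hq : (q : ℝ) ∈ ivl a b ∧ c₀ ≤ q
      · filter_upwards [hall q hq.1 hq.2] with x hx _ _ using hx
      · exact Eventually.of_forall fun x h1 h2 => absurd ⟨h1, h2⟩ hq
    filter_upwards [h1, ae_restrict_mem (isOpen_ivl a b).measurableSet] with x hx hxI
    have hm : max x c₀ ∈ ivlC a b := by
      rcases max_choice x c₀ with e | e <;> rw [e]
      exacts [ivl_subset_ivlC hxI, ivl_subset_ivlC hc₀]
    obtain ⟨c, hc, hcm⟩ := exists_gt_mem_ivl hm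
    obtain ⟨q, hq1, hq2⟩ := exists_rat_btwn hcm
    have hq1' := max_lt_iff.1 hq1
    exact hx q ⟨hxI.1.trans hq1'.1, (EReal.coe_lt_coe_iff.2 hq2).trans hc.2⟩ hq1'.2.le
      ⟨hxI.1, hq1'.1.le⟩
  have hbvp : SolvesBVP a b V α (starRingEnd ℂ z) 0 g :=
    ⟨_, _, (sol_phiSol hab hP _ k).congr_ae ordConnected_ivlC (by
      rw [restrict_ivlC]; exact (Lp.coeFn_zero _ _ _).symm), hgφ, bc1_phiSol hab hP hα _ k⟩
  have h0 : SolvesBVP a b V α (starRingEnd ℂ z) 0 0 := by simpa using hbvp.smul 0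
  exact hbvp.unique hab hV hα (by simpa using hz) h0

/-- The range is closed with trivial orthogonal complement, hence everything; the a priori estimate
bounds the inverse by 1/|Im z|. -/
theorem exists_resolvent (hab : (a : EReal) < b) (hV : IsPotential a b V)
    (hα : IsSelfAdjoint α) (hz : z.im ≠ 0) :
    ∃ R : L2 H a b →L[ℂ] L2 H a b, ∀ f, SolvesBVP a b V α z f (R f) := by
  have hcl := isClosed_rangeBVP hab hV hα hz
  have : CompleteSpace (rangeBVP a b V α z) := hcl.completeSpace_coe
  have htop : rangeBVP a b V α z = ⊤ := by
    rw [← Submodule.orthogonal_eq_bot_iff, Submodule.eq_bot_iff]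
    intro g hg
    exact eq_zero_of_orthogonal_range hab hV hα hz ((Submodule.mem_orthogonal _ _).1 hg)
  have hex : ∀ f, ∃ u, SolvesBVP a b V α z f u := fun f => by
    have : f ∈ rangeBVP a b V α z := htop ▸ Submodule.mem_top
    exact this
  choose R hR using hex
  let L : L2 H a b →ₗ[ℂ] L2 H a b :=
    { toFun := R
      map_add' := fun f g => (hR (f + g)).unique hab hV hα hz ((hR f).add (hR g))
      map_smul' := fun k f => (hR (k • f)).unique hab hV hα hz ((hR f).smul k) }
  refine ⟨L.mkContinuous |z.im|⁻¹ fun f => ?_, hR⟩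
  have h0 : 0 < |z.im| := abs_pos.2 hz
  rw [inv_mul_eq_div, le_div_iff₀ h0, mul_comm]
  exact (hR f).norm_le hab hV hα

theorem mem_graph_Halpha_iff (hab : (a : EReal) < b) (hV : IsPotential a b V) (z : ℂ)
    (u g : L2 H a b) : (u, g) ∈ (Halpha a b V α).graph ↔ SolvesBVP a b V α z (g - z • u) u := by
  rw [graph_Halpha, mem_graphHalpha_iff hab hV z]

/-- The resolvent set of `H_α` in terms of the boundary value problem. -/
theorem mem_resolventSet_iff (hab : (a : EReal) < b) (hV : IsPotential a b V) (z : ℂ) :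
    z ∈ resolventSet (Halpha a b V α) ↔ ∃ R : L2 H a b →L[ℂ] L2 H a b,
      (∀ f, SolvesBVP a b V α z f (R f)) ∧ ∀ f u, SolvesBVP a b V α z f u → R f = u := by
  constructor
  · rintro ⟨R, h1, h2⟩
    refine ⟨R, fun f => ?_, fun f u hu => ?_⟩
    · obtain ⟨h, e⟩ := h1 f
      have := (mem_graph_Halpha_iff hab hV z _ _).1 ((Halpha a b V α).mem_graph ⟨R f, h⟩)
      rwa [e] at this
    · have hg : (u, f + z • u) ∈ (Halpha a b V α).graph := by
        rw [mem_graph_Halpha_iff hab hV z, add_sub_cancel_right]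
        exact hu
      obtain ⟨y, hy, hy'⟩ := (LinearPMap.mem_graph_iff _).1 hg
      have := h2 y
      simp only at hy hy'
      rw [hy', hy, add_sub_cancel_right] at this
      exact this
  · rintro ⟨R, h1, h2⟩
    refine ⟨R, fun f => ?_, fun u => ?_⟩
    · have hg : (R f, f + z • R f) ∈ (Halpha a b V α).graph := by
        rw [mem_graph_Halpha_iff hab hV z, add_sub_cancel_right]
        exact h1 f
      obtain ⟨y, hy, hy'⟩ := (LinearPMap.mem_graph_iff _).1 hg
      simp only at hy hy'
      have hd : R f ∈ (Halpha a b V α).domain := hy ▸ y.2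
      have : y = ⟨R f, hd⟩ := Subtype.ext hy
      refine ⟨hd, ?_⟩
      rw [← this, hy', add_sub_cancel_right]
    · exact h2 _ _ ((mem_graph_Halpha_iff hab hV z _ _).1 ((Halpha a b V α).mem_graph u))

theorem nonreal_subset_resolventSet (hab : (a : EReal) < b) (hV : IsPotential a b V)
    (hα : IsSelfAdjoint α) : {z : ℂ | z.im ≠ 0} ⊆ resolventSet (Halpha a b V α) := by
  intro z hz
  obtain ⟨R, hR⟩ := exists_resolvent hab hV hα hz
  exact (mem_resolventSet_iff hab hV z).2 ⟨R, hR, fun f u hu => (hR f).unique hab hV hα hz hu⟩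

/-- The resolvent of `H_α` is analytic. -/
theorem exists_analytic_resolvent (hab : (a : EReal) < b) (hV : IsPotential a b V) :
    ∃ R : ℂ → L2 H a b →L[ℂ] L2 H a b,
      (∀ z ∈ resolventSet (Halpha a b V α), (∀ f, SolvesBVP a b V α z f (R z f)) ∧
        ∀ f u, SolvesBVP a b V α z f u → R z f = u) ∧
      AnalyticOnNhd ℂ R (resolventSet (Halpha a b V α)) := by
  have hex : ∀ z, ∃ R : L2 H a b →L[ℂ] L2 H a b, z ∈ resolventSet (Halpha a b V α) →
      (∀ f, SolvesBVP a b V α z f (R f)) ∧ ∀ f u, SolvesBVP a b V α z f u → R f = u := by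
    intro z
    by_cases hz : z ∈ resolventSet (Halpha a b V α)
    · obtain ⟨R, hR⟩ := (mem_resolventSet_iff hab hV z).1 hz
      exact ⟨R, fun _ => hR⟩
    · exact ⟨0, fun h => absurd h hz⟩
  choose R hR using hex
  refine ⟨R, hR, fun z hz => ?_⟩
  obtain ⟨h1, h2⟩ := hR z hz
  -- The resolvent identity solved for R(w), namely R(w) = R(z)(1 - (w - z)R(z))⁻¹. The same formula
  -- shows that such `w` belong to the resolvent set.
  have hT : ∀ w, IsUnit (1 - (w - z) • R z) → R w = R z * Ring.inverse (1 - (w - z) • R z) := by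
    intro w hw
    have e1 : (1 - (w - z) • R z) * Ring.inverse (1 - (w - z) • R z) = 1 :=
      Ring.mul_inverse_cancel _ hw
    have e2 : Ring.inverse (1 - (w - z) • R z) * (1 - (w - z) • R z) = 1 :=
      Ring.inverse_mul_cancel _ hw
    set T := Ring.inverse (1 - (w - z) • R z) with hTdef
    have hT1 : ∀ f, T f - (w - z) • R z (T f) = f := fun f => DFunLike.congr_fun e1 f
    have hT2 : ∀ f, T (f - (w - z) • R z f) = f := fun f => DFunLike.congr_fun e2 f
    have s1 : ∀ f, SolvesBVP a b V α w f (R z (T f)) := by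
      intro f
      have := (h1 (T f)).change_param w
      rwa [← neg_sub w z, neg_smul, ← sub_eq_add_neg, hT1] at this
    have s2 : ∀ f u, SolvesBVP a b V α w f u → R z (T f) = u := by
      intro f u hu
      have h3 := h2 _ _ (hu.change_param z)
      have h4 : f = (f + (w - z) • u) - (w - z) • R z (f + (w - z) • u) := by
        rw [h3, add_sub_cancel_right]
      rw [h4, hT2, h3]
    have hw' : w ∈ resolventSet (Halpha a b V α) :=
      (mem_resolventSet_iff hab hV w).2 ⟨R z * T, s1, s2⟩
    ext1 f
    exact (hR w hw').2 _ _ (s1 f)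
  have hlin : AnalyticAt ℂ (fun w : ℂ => 1 - (w - z) • R z) z := by fun_prop
  have hinv : AnalyticAt ℂ (fun w : ℂ => Ring.inverse (1 - (w - z) • R z)) z := by
    have h3 : AnalyticAt ℂ Ring.inverse ((1 : L2 H a b →L[ℂ] L2 H a b) - (z - z) • R z) := by
      have := analyticAt_inverse (𝕜 := ℂ) (1 : (L2 H a b →L[ℂ] L2 H a b)ˣ)
      simpa using this
    exact AnalyticAt.fun_comp (g := Ring.inverse) h3 hlin
  have hunit : ∀ᶠ w in 𝓝 z, IsUnit (1 - (w - z) • R z) := by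
    have ho := Units.isOpen (R := L2 H a b →L[ℂ] L2 H a b)
    exact hlin.continuousAt.eventually (ho.mem_nhds (by simp))
  refine ((analyticAt_const (v := R z)).mul hinv).congr ?_
  filter_upwards [hunit] with w hw using (hT w hw).symm

end resolvent

/-! ### The Weyl–Titchmarsh function: construction, Herglotz property, extension. -/

section weylFunction

variable {H : Type*} [NormedAddCommGroup H] [InnerProductSpace ℂ H]
variable {a : ℝ} {b : EReal}

theorem coeFn_zero_ivlC : ⇑(0 : L2 H a b) =ᵐ[volume.restrict (ivlC a b)] (0 : ℝ → H) := by
  rw [restrict_ivlC]; exact Lp.coeFn_zero _ _ _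

variable [CompleteSpace H] {V : ℝ → H →L[ℂ] H} {α β : H →L[ℂ] H} {z : ℂ}

theorem norm_bc2_le (α : H →L[ℂ] H) (y₀ y₁ : H) :
    ‖bc2 α y₀ y₁‖ ≤ (‖opSin α‖ + ‖opCos α‖) * max ‖y₀‖ ‖y₁‖ := by
  have h1 : ‖(-opSin α) y₀‖ ≤ ‖opSin α‖ * max ‖y₀‖ ‖y₁‖ := by
    rw [neg_apply, norm_neg]
    exact (opSin α).le_of_opNorm_le_of_le le_rfl (le_max_left _ _)
  have h2 : ‖opCos α y₁‖ ≤ ‖opCos α‖ * max ‖y₀‖ ‖y₁‖ :=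
    (opCos α).le_of_opNorm_le_of_le le_rfl (le_max_right _ _)
  rw [add_mul]
  exact (norm_add_le _ _).trans (add_le_add h1 h2)

/-- The initial value `ψ_α(z, a)`. -/
def psiInit (a : ℝ) (b : EReal) (V : ℝ → H →L[ℂ] H) (α : H →L[ℂ] H) (z : ℂ) : H →L[ℂ] H :=
  opCos α - opSin α * weylM a b V α z

/-- The initial value `ψ_α'(z, a)`. -/
def psiInit' (a : ℝ) (b : EReal) (V : ℝ → H →L[ℂ] H) (α : H →L[ℂ] H) (z : ℂ) : H →L[ℂ] H :=
  opSin α + opCos α * weylM a b V α z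

/-- The solution `ψ_α(z, ·) h`. -/
def psiSol (hab : (a : EReal) < b) (hV : LocPotential (ivlC a b) V) (α : H →L[ℂ] H) (z : ℂ)
    (h : H) : ℝ → H :=
  ivp hV z (left_mem_ivlC hab) (psiInit a b V α z h) (psiInit' a b V α z h)

/-- The derivative of `psiSol`. -/
def psiSolDeriv (hab : (a : EReal) < b) (hV : LocPotential (ivlC a b) V) (α : H →L[ℂ] H) (z : ℂ)
    (h : H) : ℝ → H :=
  ivpDeriv hV z (left_mem_ivlC hab) (psiInit a b V α z h) (psiInit' a b V α z h)

theorem sol_psiSol (hab : (a : EReal) < b) (hV : LocPotential (ivlC a b) V) (z : ℂ) (h : H) :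
    Sol (ivlC a b) V z 0 (psiSol hab hV α z h) (psiSolDeriv hab hV α z h) := sol_ivp _ _ _ _ _

theorem bc1_psiSol (hab : (a : EReal) < b) (hV : LocPotential (ivlC a b) V)
    (hα : IsSelfAdjoint α) (z : ℂ) (h : H) :
    bc1 α (psiSol hab hV α z h a) (psiSolDeriv hab hV α z h a) = h := by
  rw [psiSol, psiSolDeriv, ivp_base, ivpDeriv_base]
  exact bc1_rotate hα h _

theorem bc2_psiSol (hab : (a : EReal) < b) (hV : LocPotential (ivlC a b) V)
    (hα : IsSelfAdjoint α) (z : ℂ) (h : H) :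
    bc2 α (psiSol hab hV α z h a) (psiSolDeriv hab hV α z h a) = weylM a b V α z h := by
  rw [psiSol, psiSolDeriv, ivp_base, ivpDeriv_base]
  exact bc2_rotate hα h _

variable [TopologicalSpace.SeparableSpace H]

theorem mem_weylRelation_iff (hab : (a : EReal) < b) (hV : IsPotential a b V) (f g : H) :
    (f, g) ∈ weylRelation a b V α z ↔ ∃ u u' : ℝ → H, Sol (ivlC a b) V z 0 u u' ∧
      MemLp u 2 (ivlMeasure a b) ∧ bc1 α (u a) (u' a) = f ∧ bc2 α (u a) (u' a) = g := by
  constructor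
  · rintro ⟨u, u', u₀, u₁, ⟨u'', hw, hτ⟩, hu2, hb, h1, h2⟩
    obtain ⟨v, v', hv, e, e'⟩ := hw.exists_sol hab hV.locPotential (f := 0) (z := z)
      LocInt.zero (by simpa using hτ)
    obtain ⟨b0, b1⟩ := hb.eq hab hv e e'
    refine ⟨v, v', hv, (memLp_congr_ae ?_).1 hu2, ?_, ?_⟩
    · rw [EventuallyEq, ae_restrict_iff' (isOpen_ivl a b).measurableSet]
      exact Eventually.of_forall fun x hx => e hx
    · rw [bc1, ← b0, ← b1]; exact h1.symm
    · rw [bc2, ← b0, ← b1]; exact h2.symm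
  · rintro ⟨u, u', hu, hu2, h1, h2⟩
    refine ⟨u, u', u a, u' a, ⟨_, hu.isW21Loc, ?_⟩, hu2, hu.hasBoundaryValues hab, h1.symm, h2.symm⟩
    rw [tau_secondDeriv]
    simp

/-- Square integrable solutions are controlled by their norm. -/
theorem exists_data_bound_L2 (hV : IsPotential a b V) (hab : (a : EReal) < b) (z : ℂ) :
    ∃ K : ℝ, 0 ≤ K ∧ ∀ (u u' : ℝ → H) (x : L2 H a b), Sol (ivlC a b) V z 0 u u' →
      x =ᵐ[ivlMeasure a b] u → max ‖u a‖ ‖u' a‖ ≤ K * ‖x‖ := by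
  obtain ⟨c, hc⟩ := exists_mem_ivl hab
  obtain ⟨K₁, hK₁, h1⟩ := exists_data_bound hV.locPotential z hc
  obtain ⟨K₂, hK₂, h2⟩ := exists_integral_norm_le (H := H) hc
  refine ⟨K₁ * K₂, by positivity, fun u u' x hu hx => ?_⟩
  have e1 := h1 0 u u' hu LocInt.zero
  simp only [Pi.zero_apply, norm_zero, intervalIntegral.integral_zero, add_zero] at e1
  have e2 : ∫ t in a..c, ‖u t‖ = ∫ t in a..c, ‖x t‖ := by
    rw [intervalIntegral.integral_of_le hc.1.le, intervalIntegral.integral_of_le hc.1.le]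
    refine integral_congr_ae ?_
    have := ae_restrict_of_ae (s := Ioc a c) hx
    rw [restrict_Ioc_ivlMeasure hc] at this
    filter_upwards [this] with t ht
    rw [ht]
  rw [e2] at e1
  rw [mul_assoc]
  exact e1.trans (mul_le_mul_of_nonneg_left (h2 x) hK₁.le)

/-- This is injectivity of 𝒞₁ on 𝒟_z: otherwise H_α would have a nonreal eigenvalue. -/
theorem data_eq_zero_of_bc1 (hab : (a : EReal) < b) (hV : IsPotential a b V)
    (hα : IsSelfAdjoint α) (hz : z.im ≠ 0) {u u' : ℝ → H} (hu : Sol (ivlC a b) V z 0 u u')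
    (hu2 : MemLp u 2 (ivlMeasure a b)) (hb : bc1 α (u a) (u' a) = 0) : u a = 0 ∧ u' a = 0 := by
  have h1 : SolvesBVP a b V α z 0 (hu2.toLp u) :=
    ⟨u, u', hu.congr_ae ordConnected_ivlC coeFn_zero_ivlC.symm, hu2.coeFn_toLp, hb⟩
  have h0 : SolvesBVP a b V α z 0 0 := by simpa using h1.smul 0
  have h2 := h1.unique hab hV hα hz h0
  obtain ⟨K, hK, hK'⟩ := exists_data_bound_L2 hV hab z
  have h3 := hK' u u' _ hu hu2.coeFn_toLp
  rw [h2, norm_zero, mul_zero] at h3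
  exact ⟨norm_le_zero_iff.1 ((le_max_left _ _).trans h3),
    norm_le_zero_iff.1 ((le_max_right _ _).trans h3)⟩

/-- Existence of square integrable solutions with prescribed `𝒞₁ u`. -/
theorem exists_memLp_sol (hab : (a : EReal) < b) (hV : IsPotential a b V)
    (hα : IsSelfAdjoint α) (hz : z.im ≠ 0) (h : H) :
    ∃ u u' : ℝ → H, Sol (ivlC a b) V z 0 u u' ∧ MemLp u 2 (ivlMeasure a b) ∧
      bc1 α (u a) (u' a) = h := by
  have hP := hV.locPotential
  obtain ⟨c, hc⟩ := exists_mem_ivl hab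
  have hcC := ivl_subset_ivlC hc
  obtain ⟨Φ, hΦ, K, hK, hΦb⟩ := exists_truncPhi hab hP hα (starRingEnd ℂ z) hc
  -- The lower bound for Φ makes Φ*Φ invertible, and g = (Φ*Φ)⁻¹h. Using K + 1 instead of K avoids
  -- dividing by zero.
  obtain ⟨g, hg⟩ : ∃ g, ∀ k, inner ℂ (Φ k) (Φ g) = inner ℂ k h := by
    have hunit : IsUnit (ContinuousLinearMap.adjoint Φ ∘L Φ) := by
      refine ContinuousLinearMap.isUnit_of_forall_le_norm_inner_map _
        (c := Real.toNNReal ((K + 1) ^ 2)⁻¹) (Real.toNNReal_pos.2 (by positivity)) fun x => ?_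
      rw [ContinuousLinearMap.comp_apply, ContinuousLinearMap.adjoint_inner_left,
        inner_self_eq_norm_sq_to_K]
      have h1 := hΦb x
      have h2 : ‖x‖ ^ 2 ≤ ((K + 1) * ‖Φ x‖) ^ 2 := by
        refine pow_le_pow_left₀ (norm_nonneg _) (h1.trans ?_) 2
        have := norm_nonneg (Φ x)
        nlinarith
      rw [Real.coe_toNNReal _ (by positivity), ← div_eq_mul_inv, div_le_iff₀ (by positivity)]
      rw [norm_pow, RCLike.norm_ofReal, abs_norm]
      linarith
    obtain ⟨g, hg⟩ := (ContinuousLinearMap.isUnit_iff_bijective.1 hunit).2 h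
    refine ⟨g, fun k => ?_⟩
    rw [← hg, ContinuousLinearMap.comp_apply, ContinuousLinearMap.adjoint_inner_right]
  -- As Φ g is supported in (a, c], w = R(z)Φ g solves the homogeneous equation beyond `c`. There
  -- `v` coincides with `w`, so it is square integrable; to the left of `c` it continues as a
  -- homogeneous solution.
  obtain ⟨R, hR⟩ := exists_resolvent hab hV hα hz
  obtain ⟨w, w', hw, hRw, hwb⟩ := hR (Φ g)
  set v := ivp hP z hcC (w c) (w' c) with hv
  set v' := ivpDeriv hP z hcC (w c) (w' c) with hv'
  have hvs : Sol (ivlC a b) V z 0 v v' := sol_ivp hP z hcC _ _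
  have hvc : v c = w c := ivp_base hP z hcC _ _
  have hvc' : v' c = w' c := ivpDeriv_base hP z hcC _ _
  have hsub : ivlC c b ⊆ ivlC a b := fun x hx => ⟨hc.1.le.trans hx.1, hx.2⟩
  have h2 : ⇑(Φ g) =ᵐ[volume.restrict (ivlC c b)] (0 : ℝ → H) := by
    rw [restrict_ivlC]
    have h3 : ivl c b ⊆ ivl a b := fun x hx => ⟨hc.1.trans hx.1, hx.2⟩
    have h4 := ae_restrict_mem (μ := volume) (isOpen_ivl c b).measurableSet
    filter_upwards [ae_restrict_of_ae_restrict_of_subset h3 (hΦ g), h4] with y hy hy'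
    rw [hy, indicator_of_notMem fun h => absurd hy'.1 (not_lt.2 h.2), Pi.zero_apply]
  have hEq := ((hvs.mono hsub).eqOn (hP.mono hsub ordConnected_ivlC) (hw.mono hsub) h2.symm
      (left_mem_ivlC hc.2) hvc hvc').1
  have hmem : MemLp v 2 (ivlMeasure a b) := by
    have m1 := memLp_indicator (hvs.continuousOn ordConnected_ivlC) hc
    have m2 := (memLp_of_ae hRw).indicator (measurableSet_Ioc (a := a) (b := c)).compl
    refine (memLp_congr_ae ?_).1 (m1.add m2)
    rw [EventuallyEq, ae_restrict_iff' (isOpen_ivl a b).measurableSet]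
    refine Eventually.of_forall fun x hx => ?_
    rw [Pi.add_apply]
    by_cases hxc : x ∈ Ioc a c
    · simp [hxc]
    · have : c < x := by
        by_contra h
        exact hxc ⟨hx.1, not_lt.1 h⟩
      rw [indicator_of_notMem hxc, indicator_of_mem (mem_compl hxc), zero_add,
        hEq ⟨this.le, hx.2⟩]
  refine ⟨v, v', hvs, hmem, ext_inner_left ℂ fun k => ?_⟩
  -- The Wronskians of `v` and `w` with φ_α(z̄, ·)k agree at `c`. Between `c` and `a` the first is
  -- constant, while the second changes by (Φ k, Φ g) = (k, h). As 𝒞₁w = 0, it follows that 𝒞₁v = h.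
  have e1 := wronskian_phiSol (α := α) hab hV hc hvs k
  have e2 := wronskian_phiSol (α := α) hab hV hc hw k
  rw [wronskian_phiSol_left hab hP hα] at e1 e2
  rw [← inner_truncPhi hab hP hc hΦ, hg, hwb] at e2
  simp only [Pi.zero_apply, inner_zero_right, intervalIntegral.integral_zero, neg_zero,
    wronskian, hvc, hvc', sub_neg_eq_add] at e1 e2
  linear_combination e1 - e2

/-- Green's formula for `u` against itself, followed by Cauchy–Schwarz in the boundary form. -/
theorem abs_im_mul_norm_sq_le (hab : (a : EReal) < b) (hV : IsPotential a b V)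
    (hα : IsSelfAdjoint α) {u u' : ℝ → H} (hu : Sol (ivlC a b) V z 0 u u') {x : L2 H a b}
    (hx : x =ᵐ[ivlMeasure a b] u) :
    |z.im| * ‖x‖ ^ 2 ≤ ‖bc1 α (u a) (u' a)‖ * ‖bc2 α (u a) (u' a)‖ := by
  have hu0 := hu.congr_ae ordConnected_ivlC coeFn_zero_ivlC.symm
  have e := hV.green_formula hab hu0 hx hu0 hx
  rw [symplectic_bc hα, inner_zero_left, inner_zero_right, add_zero, sub_zero] at e
  have h2 : ‖(z - starRingEnd ℂ z) * inner ℂ x x‖ = 2 * |z.im| * ‖x‖ ^ 2 := by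
    rw [norm_mul, inner_self_eq_norm_sq_to_K, Complex.sub_conj]
    simp
  have h4 := norm_inner_le_norm (𝕜 := ℂ) (bc1 α (u a) (u' a)) (bc2 α (u a) (u' a))
  have h5 := norm_inner_le_norm (𝕜 := ℂ) (bc2 α (u a) (u' a)) (bc1 α (u a) (u' a))
  have h6 := norm_sub_le (inner ℂ (bc1 α (u a) (u' a)) (bc2 α (u a) (u' a)))
    (inner ℂ (bc2 α (u a) (u' a)) (bc1 α (u a) (u' a)))
  rw [e, h2] at h6
  linarith

/-- The Weyl--Titchmarsh function is well defined. -/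
theorem isWeylM_weylM (hab : (a : EReal) < b) (hV : IsPotential a b V)
    (hα : IsSelfAdjoint α) (hz : z.im ≠ 0) : IsWeylM a b V α z (weylM a b V α z) := by
  suffices h : ∃ M : H →L[ℂ] H, IsWeylM a b V α z M by
    rw [weylM, dif_pos h]
    exact h.choose_spec
  have hz0 : 0 < |z.im| := abs_pos.2 hz
  -- Injectivity of 𝒞₁ means that 𝒞₂u depends on 𝒞₁u only; linearity of `L` and the graph property
  -- both follow.
  have huniq : ∀ u u' v v' : ℝ → H, Sol (ivlC a b) V z 0 u u' → Sol (ivlC a b) V z 0 v v' →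
      MemLp u 2 (ivlMeasure a b) → MemLp v 2 (ivlMeasure a b) →
      bc1 α (u a) (u' a) = bc1 α (v a) (v' a) → bc2 α (u a) (u' a) = bc2 α (v a) (v' a) := by
    intro u u' v v' hu hv hu2 hv2 hb
    have hs := (hu.sub hv).congr_ae (g := 0) ordConnected_ivlC (by simp [EventuallyEq])
    obtain ⟨h0, h1⟩ := data_eq_zero_of_bc1 hab hV hα hz hs (hu2.sub hv2)
      (by rw [bc1_sub, hb, sub_self])
    rw [sub_eq_zero.1 h0, sub_eq_zero.1 h1]
  choose u u' hu hu2 hb using fun h => exists_memLp_sol (α := α) hab hV hα hz h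
  let L : H →ₗ[ℂ] H :=
    { toFun := fun h => bc2 α (u h a) (u' h a)
      map_add' := fun h k => by
        rw [← bc2_add]
        have hs := ((hu h).add (hu k)).congr_ae (g := 0) ordConnected_ivlC (by simp [EventuallyEq])
        refine huniq _ _ _ _ (hu _) hs (hu2 _) ((hu2 h).add (hu2 k)) ?_
        rw [bc1_add, hb, hb, hb]
      map_smul' := fun r h => by
        rw [RingHom.id_apply, ← bc2_smul]
        have hs := ((hu h).const_smul r).congr_ae (g := 0) ordConnected_ivlC
            (by simp [EventuallyEq])
        refine huniq _ _ _ _ (hu _) hs (hu2 _) ((hu2 h).const_smul r) ?_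
        rw [bc1_smul, hb, hb] }
  have hL : ∀ h, L h = bc2 α (u h a) (u' h a) := fun h => rfl
  obtain ⟨K, hK, hK'⟩ := exists_data_bound_L2 hV hab z
  set S := ‖opSin α‖ + ‖opCos α‖ with hS
  -- From ‖𝒞₂u‖ ≤ SK‖u‖ and |Im z| ‖u‖² ≤ ‖h‖ ‖𝒞₂u‖ one gets |Im z| ‖𝒞₂u‖² ≤ (SK)² ‖h‖ ‖𝒞₂u‖, and
  -- one factor ‖𝒞₂u‖ cancels.
  have hbound : ∀ h, ‖L h‖ ≤ (S * K) ^ 2 / |z.im| * ‖h‖ := by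
    intro h
    have h1 := abs_im_mul_norm_sq_le hab hV hα (hu h) (hu2 h).coeFn_toLp
    rw [hb, ← hL] at h1
    have h2 : ‖L h‖ ≤ S * K * ‖(hu2 h).toLp _‖ := by
      refine (norm_bc2_le α _ _).trans ?_
      rw [mul_assoc]
      exact mul_le_mul_of_nonneg_left (hK' _ _ _ (hu h) (hu2 h).coeFn_toLp) (by positivity)
    set n := ‖(hu2 h).toLp _‖ with hn
    rw [div_mul_eq_mul_div, le_div_iff₀ hz0]
    by_cases h0 : ‖L h‖ = 0
    · rw [h0, zero_mul]; positivity
    · have hpos : 0 < ‖L h‖ := lt_of_le_of_ne (norm_nonneg _) (Ne.symm h0)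
      refine le_of_mul_le_mul_right ?_ hpos
      have h3 : ‖L h‖ ^ 2 ≤ (S * K * n) ^ 2 := pow_le_pow_left₀ hpos.le h2 2
      calc ‖L h‖ * |z.im| * ‖L h‖ = ‖L h‖ ^ 2 * |z.im| := by ring
        _ ≤ (S * K * n) ^ 2 * |z.im| := by gcongr
        _ = (S * K) ^ 2 * (|z.im| * n ^ 2) := by ring
        _ ≤ (S * K) ^ 2 * (‖h‖ * ‖L h‖) := by gcongr
        _ = (S * K) ^ 2 * ‖h‖ * ‖L h‖ := by ring
  refine ⟨L.mkContinuous _ hbound, fun f g => ?_⟩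
  rw [mem_weylRelation_iff hab hV, LinearMap.mkContinuous_apply, hL]
  constructor
  · rintro ⟨v, v', hv, hv2, h1, rfl⟩
    exact huniq _ _ _ _ hv (hu f) hv2 (hu2 f) (by rw [h1, hb])
  · rintro rfl
    exact ⟨u f, u' f, hu f, hu2 f, hb f, rfl⟩

/-- The element of 𝒟_z with 𝒞₁u = h has 𝒞₂u = m(z)h; undoing the rotation gives it the Cauchy data
of ψ_α(z, ·)h. -/
theorem memLp_psiSol (hab : (a : EReal) < b) (hV : IsPotential a b V)
    (hα : IsSelfAdjoint α) (hz : z.im ≠ 0) (h : H) :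
    MemLp (psiSol hab hV.locPotential α z h) 2 (ivlMeasure a b) := by
  obtain ⟨u, u', hu, hu2, h1, h2⟩ := (mem_weylRelation_iff hab hV _ _).1
    ((isWeylM_weylM hab hV hα hz h _).2 rfl)
  have e := (eqOn_ivp hV.locPotential z (left_mem_ivlC hab) hu).1
  have e0 := rotate_bc_fst hα (u a) (u' a)
  have e1 := rotate_bc_snd hα (u a) (u' a)
  rw [h1, h2] at e0 e1
  refine (memLp_congr_ae ?_).1 hu2
  rw [EventuallyEq, ae_restrict_iff' (isOpen_ivl a b).measurableSet]
  refine Eventually.of_forall fun x hx => ?_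
  rw [e (ivl_subset_ivlC hx), ← e0, ← e1]
  rfl

/-- The operator `h ↦ ψ_α(z, ·) h` from `H` to `L²`. -/
theorem exists_psiOp (hab : (a : EReal) < b) (hV : IsPotential a b V)
    (hα : IsSelfAdjoint α) (hz : z.im ≠ 0) :
    ∃ Ψ : H →L[ℂ] L2 H a b, ∀ h, Ψ h =ᵐ[ivlMeasure a b] psiSol hab hV.locPotential α z h := by
  have hP := hV.locPotential
  have hm := fun h => memLp_psiSol hab hV hα hz h
  have haC := left_mem_ivlC hab
  have hz0 : 0 < |z.im| := abs_pos.2 hz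
  let L : H →ₗ[ℂ] L2 H a b :=
    { toFun := fun h => (hm h).toLp _
      map_add' := fun h k => by
        rw [← MemLp.toLp_add]
        refine MemLp.toLp_congr _ _ ?_
        filter_upwards [ae_restrict_mem (isOpen_ivl a b).measurableSet] with x hx
        simp only [Pi.add_apply, psiSol, map_add]
        exact (ivp_add hP z haC _ _ _ _ (ivl_subset_ivlC hx)).1
      map_smul' := fun r h => by
        rw [RingHom.id_apply, ← MemLp.toLp_const_smul]
        refine MemLp.toLp_congr _ _ ?_
        filter_upwards [ae_restrict_mem (isOpen_ivl a b).measurableSet] with x hx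
        simp only [Pi.smul_apply, psiSol, map_smul]
        exact (ivp_smul hP z haC r _ _ (ivl_subset_ivlC hx)).1 }
  have hL : ∀ h, L h =ᵐ[ivlMeasure a b] psiSol hab hP α z h := fun h => (hm h).coeFn_toLp
  -- The constant comes from |Im z| ‖Ψ h‖² ≤ ‖h‖ ‖m(z)h‖.
  refine ⟨L.mkContinuous (Real.sqrt (‖weylM a b V α z‖ / |z.im|)) fun h => ?_, hL⟩
  have h1 := abs_im_mul_norm_sq_le hab hV hα (sol_psiSol hab hP z h) (hL h)
  rw [bc1_psiSol hab hP hα, bc2_psiSol hab hP hα] at h1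
  have h2 := (weylM a b V α z).le_opNorm h
  refine le_of_sq_le_sq ?_ (by positivity)
  rw [mul_pow, Real.sq_sqrt (by positivity), div_mul_eq_mul_div, le_div_iff₀ hz0]
  nlinarith [norm_nonneg h]

/-- In operator form, m(z) - m(w)* = (z - w̄) Ψ_w* Ψ_z: Green's formula for ψ(w)k and ψ(z)h, whose
boundary forms are (k, m(w)k) and (h, m(z)h). -/
theorem inner_weylM_sub (hab : (a : EReal) < b) (hV : IsPotential a b V)
    (hα : IsSelfAdjoint α) {w : ℂ} {Ψ Ψ' : H →L[ℂ] L2 H a b}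
    (hΨ : ∀ h, Ψ h =ᵐ[ivlMeasure a b] psiSol hab hV.locPotential α z h)
    (hΨ' : ∀ h, Ψ' h =ᵐ[ivlMeasure a b] psiSol hab hV.locPotential α w h) (k h : H) :
    inner ℂ k (weylM a b V α z h) - inner ℂ (weylM a b V α w k) h
      = (z - starRingEnd ℂ w) * inner ℂ (Ψ' k) (Ψ h) := by
  have hP := hV.locPotential
  have e := hV.green_formula hab
    ((sol_psiSol (α := α) hab hP w k).congr_ae ordConnected_ivlC coeFn_zero_ivlC.symm) (hΨ' k)
    ((sol_psiSol (α := α) hab hP z h).congr_ae ordConnected_ivlC coeFn_zero_ivlC.symm) (hΨ h)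
  rw [symplectic_bc hα, bc1_psiSol hab hP hα, bc2_psiSol hab hP hα, bc1_psiSol hab hP hα,
    bc2_psiSol hab hP hα, inner_zero_left, inner_zero_right, add_zero, sub_zero] at e
  exact e

/-- In `inner_weylM_sub` with w = z̄ the factor z - w̄ vanishes. -/
theorem adjoint_weylM_conj (hab : (a : EReal) < b) (hV : IsPotential a b V)
    (hα : IsSelfAdjoint α) (hz : z.im ≠ 0) :
    ContinuousLinearMap.adjoint (weylM a b V α (starRingEnd ℂ z)) = weylM a b V α z := by
  obtain ⟨Ψ, hΨ⟩ := exists_psiOp hab hV hα hz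
  obtain ⟨Ψ', hΨ'⟩ := exists_psiOp (z := starRingEnd ℂ z) hab hV hα (by simpa using hz)
  ext h
  refine ext_inner_left ℂ fun k => ?_
  have := inner_weylM_sub hab hV hα hΨ hΨ' k h
  rw [Complex.conj_conj, sub_self, zero_mul] at this
  rw [ContinuousLinearMap.adjoint_inner_right]
  exact (sub_eq_zero.1 this).symm

theorem im_inner_weylM (hab : (a : EReal) < b) (hV : IsPotential a b V)
    (hα : IsSelfAdjoint α) {Ψ : H →L[ℂ] L2 H a b}
    (hΨ : ∀ h, Ψ h =ᵐ[ivlMeasure a b] psiSol hab hV.locPotential α z h) (h : H) :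
    (inner ℂ h (weylM a b V α z h)).im = z.im * ‖Ψ h‖ ^ 2 := by
  have e := inner_weylM_sub hab hV hα hΨ hΨ h h
  rw [← inner_conj_symm (weylM a b V α z h) h, Complex.sub_conj, Complex.sub_conj,
    inner_self_eq_norm_sq_to_K] at e
  have := congrArg Complex.im e
  simp only [Complex.coe_algebraMap, ← Complex.ofReal_pow] at this
  rw [mul_right_comm, ← Complex.ofReal_mul] at this
  simp only [Complex.mul_I_im, Complex.ofReal_re] at this
  linarith

/-- Since 𝒞₁ψ(z)h = h for every z, the difference satisfies the boundary condition. Consequently Ψ_z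
= (1 + (z - w)R(z))Ψ_w. -/
theorem solvesBVP_psi_sub (hab : (a : EReal) < b) (hV : IsPotential a b V)
    (hα : IsSelfAdjoint α) {w : ℂ} {Ψ Ψ' : H →L[ℂ] L2 H a b}
    (hΨ : ∀ h, Ψ h =ᵐ[ivlMeasure a b] psiSol hab hV.locPotential α z h)
    (hΨ' : ∀ h, Ψ' h =ᵐ[ivlMeasure a b] psiSol hab hV.locPotential α w h) (h : H) :
    SolvesBVP a b V α z ((z - w) • Ψ' h) (Ψ h - Ψ' h) := by
  have hP := hV.locPotential
  refine ⟨_, _, ((sol_psiSol (α := α) hab hP z h).sub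
    ((sol_psiSol (α := α) hab hP w h).change_param z)).congr_ae ordConnected_ivlC ?_, ?_, ?_⟩
  · rw [restrict_ivlC]
    filter_upwards [Lp.coeFn_smul (z - w) (Ψ' h), hΨ' h] with x h1 h2
    rw [h1, Pi.smul_apply, h2, Pi.zero_apply, zero_add, zero_sub, ← neg_smul, neg_sub]
  · filter_upwards [Lp.coeFn_sub (Ψ h) (Ψ' h), hΨ h, hΨ' h] with x h1 h2 h3
    rw [h1, Pi.sub_apply, h2, h3]
  · rw [bc1_sub, bc1_psiSol hab hP hα, bc1_psiSol hab hP hα, sub_self]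

/-- The Weyl--Titchmarsh function extends analytically to the resolvent set. -/
theorem exists_analytic_extension (hab : (a : EReal) < b) (hV : IsPotential a b V)
    (hα : IsSelfAdjoint α) :
    ∃ M : ℂ → H →L[ℂ] H, AnalyticOnNhd ℂ M (resolventSet (Halpha a b V α)) ∧
      ∀ z : ℂ, z.im ≠ 0 → M z = weylM a b V α z := by
  have hI : Complex.I.im ≠ 0 := by simp
  obtain ⟨R, hR, hRan⟩ := exists_analytic_resolvent (α := α) hab hV
  obtain ⟨Ψ, hΨ⟩ := exists_psiOp hab hV hα hI
  -- This is `inner_weylM_sub` with w = i after replacing Ψ_z by (1 + (z - i)R(z))Ψ_i, so only the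
  -- analytic resolvent depends on z in a nonpolynomial way.
  refine ⟨fun z => ContinuousLinearMap.adjoint (weylM a b V α Complex.I) +
    (z - starRingEnd ℂ Complex.I) • (ContinuousLinearMap.adjoint Ψ ∘L
      ((1 + (z - Complex.I) • R z) ∘L Ψ)), fun z hz => ?_, fun z hz => ?_⟩
  · have h1 : AnalyticAt ℂ (fun z => 1 + (z - Complex.I) • R z) z :=
      analyticAt_const.add ((analyticAt_id.sub analyticAt_const).smul (hRan z hz))
    have h2 : AnalyticAt ℂ (fun z => (1 + (z - Complex.I) • R z) ∘L Ψ) z :=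
      ((ContinuousLinearMap.compL ℂ H (L2 H a b) (L2 H a b)).flip Ψ).analyticAt _ |>.fun_comp h1
    have h3 : AnalyticAt ℂ (fun z => ContinuousLinearMap.adjoint Ψ ∘L
        ((1 + (z - Complex.I) • R z) ∘L Ψ)) z :=
      (ContinuousLinearMap.compL ℂ H (L2 H a b) H (ContinuousLinearMap.adjoint Ψ)).analyticAt _
        |>.fun_comp h2
    exact analyticAt_const.add ((analyticAt_id.sub analyticAt_const).smul h3)
  · obtain ⟨Ψ', hΨ'⟩ := exists_psiOp hab hV hα hz
    ext h
    refine ext_inner_left ℂ fun k => ?_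
    have e := inner_weylM_sub hab hV hα hΨ' hΨ k h
    have e2 := (hR z (nonreal_subset_resolventSet hab hV hα hz)).2 _ _
      (solvesBVP_psi_sub hab hV hα hΨ' hΨ h)
    have e3 : (1 + (z - Complex.I) • R z) (Ψ h) = Ψ' h := by
      rw [map_smul] at e2
      rw [add_apply, one_apply_eq_self, smul_apply, e2]
      abel
    rw [add_apply, smul_apply, ContinuousLinearMap.comp_apply, ContinuousLinearMap.comp_apply, e3,
      inner_add_right, inner_smul_right, ContinuousLinearMap.adjoint_inner_right,
      ContinuousLinearMap.adjoint_inner_right, ← e]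
    ring

theorem isHerglotz_weylM (hab : (a : EReal) < b) (hV : IsPotential a b V)
    (hα : IsSelfAdjoint α) : IsHerglotz (weylM a b V α) where
  analytic z hz := by
    obtain ⟨M, hM, hMe⟩ := exists_analytic_extension hab hV hα
    have hz' : z.im ≠ 0 := (show 0 < z.im from hz).ne'
    refine (hM z (nonreal_subset_resolventSet hab hV hα hz')).congr ?_
    filter_upwards [(isOpen_lt continuous_const Complex.continuous_im).mem_nhds hz] with w hw
    exact hMe w (show 0 < w.im from hw).ne'
  im_nonneg z hz u := by
    obtain ⟨Ψ, hΨ⟩ := exists_psiOp hab hV hα hz.ne'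
    rw [im_inner_weylM hab hV hα hΨ]
    positivity

end weylFunction

/-! ### Change of the boundary condition. -/

section transformation

variable {H : Type*} [NormedAddCommGroup H] [InnerProductSpace ℂ H] [CompleteSpace H]
variable {a : ℝ} {b : EReal} {V : ℝ → H →L[ℂ] H} {α β : H →L[ℂ] H} {z : ℂ}

/-- The block matrix undoes the rotation by `α` and applies the one by `β`. -/
theorem rotationMatrix_bc1 (hα : IsSelfAdjoint α) (M : H →L[ℂ] H) (y₀ y₁ : H)
    (h : bc2 α y₀ y₁ = M (bc1 α y₀ y₁)) :
    (rotationMatrix β α 0 0 + rotationMatrix β α 0 1 * M) (bc1 α y₀ y₁) = bc1 β y₀ y₁ := by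
  have h0 := rotate_bc_fst hα y₀ y₁
  have h1 := rotate_bc_snd hα y₀ y₁
  rw [h] at h0 h1
  generalize bc1 α y₀ y₁ = c at h0 h1 ⊢
  rw [bc1, ← h0, ← h1]
  simp [rotationMatrix, Matrix.mul_apply, Fin.sum_univ_two]
  abel

theorem rotationMatrix_bc2 (hα : IsSelfAdjoint α) (M : H →L[ℂ] H) (y₀ y₁ : H)
    (h : bc2 α y₀ y₁ = M (bc1 α y₀ y₁)) :
    (rotationMatrix β α 1 0 + rotationMatrix β α 1 1 * M) (bc1 α y₀ y₁) = bc2 β y₀ y₁ := by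
  have h0 := rotate_bc_fst hα y₀ y₁
  have h1 := rotate_bc_snd hα y₀ y₁
  rw [h] at h0 h1
  generalize bc1 α y₀ y₁ = c at h0 h1 ⊢
  rw [bc2, ← h0, ← h1]
  simp [rotationMatrix, Matrix.mul_apply, Fin.sum_univ_two]
  abel

variable [TopologicalSpace.SeparableSpace H]

/-- The Weyl--Titchmarsh functions for different boundary conditions are related by a linear
fractional transformation. -/
theorem weylM_transformation (hab : (a : EReal) < b) (hV : IsPotential a b V)
    (hα : IsSelfAdjoint α) (hβ : IsSelfAdjoint β) (hz : z.im ≠ 0) :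
    IsUnit (rotationMatrix β α 0 0 + rotationMatrix β α 0 1 * weylM a b V α z) ∧
      weylM a b V β z = (rotationMatrix β α 1 0 + rotationMatrix β α 1 1 * weylM a b V α z) *
        Ring.inverse (rotationMatrix β α 0 0 + rotationMatrix β α 0 1 * weylM a b V α z) := by
  have hmα := isWeylM_weylM hab hV hα hz
  have hmβ := isWeylM_weylM hab hV hβ hz
  have key : ∀ u u' : ℝ → H, Sol (ivlC a b) V z 0 u u' → MemLp u 2 (ivlMeasure a b) →
      bc2 α (u a) (u' a) = weylM a b V α z (bc1 α (u a) (u' a)) ∧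
      bc2 β (u a) (u' a) = weylM a b V β z (bc1 β (u a) (u' a)) := fun u u' hu hu2 =>
    ⟨(hmα _ _).1 ((mem_weylRelation_iff hab hV _ _).2 ⟨u, u', hu, hu2, rfl, rfl⟩),
      (hmβ _ _).1 ((mem_weylRelation_iff hab hV _ _).2 ⟨u, u', hu, hu2, rfl, rfl⟩)⟩
  have hunit : IsUnit (rotationMatrix β α 0 0 + rotationMatrix β α 0 1 * weylM a b V α z) := by
    -- On 𝒟_z one has (A + B m_α)𝒞₁ = 𝒞₁', where 𝒞₁ belongs to `α` and 𝒞₁' to `β`. Both forms are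
    -- bijections of 𝒟_z onto `H`, hence so is A + B m_α.
    rw [ContinuousLinearMap.isUnit_iff_bijective]
    constructor
    · rw [injective_iff_map_eq_zero]
      intro h hh
      obtain ⟨u, u', hu, hu2, h1⟩ := exists_memLp_sol hab hV hα hz h
      rw [← h1, rotationMatrix_bc1 hα _ _ _ (key u u' hu hu2).1] at hh
      obtain ⟨e0, e1⟩ := data_eq_zero_of_bc1 hab hV hβ hz hu hu2 hh
      rw [← h1, e0, e1]
      simp [bc1]
    · intro g
      obtain ⟨u, u', hu, hu2, h1⟩ := exists_memLp_sol hab hV hβ hz g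
      exact ⟨_, (rotationMatrix_bc1 hα _ _ _ (key u u' hu hu2).1).trans h1⟩
  refine ⟨hunit, ?_⟩
  have e : weylM a b V β z * (rotationMatrix β α 0 0 + rotationMatrix β α 0 1 * weylM a b V α z) =
      rotationMatrix β α 1 0 + rotationMatrix β α 1 1 * weylM a b V α z := by
    ext h
    obtain ⟨u, u', hu, hu2, h1⟩ := exists_memLp_sol hab hV hα hz h
    have hk := key u u' hu hu2
    rw [← h1, mul_apply_eq_comp, rotationMatrix_bc1 hα _ _ _ hk.1,
      rotationMatrix_bc2 hα _ _ _ hk.1, hk.2]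
  rw [← e, mul_assoc, Ring.mul_inverse_cancel _ hunit, mul_one]

end transformation

/-! ### Operator-valued solutions and their norm differentiability. -/

section operatorSolutions

variable {H : Type*} [NormedAddCommGroup H] [InnerProductSpace ℂ H] [CompleteSpace H]

section localTheory

variable {J : Set ℝ} {V : ℝ → H →L[ℂ] H} {z : ℂ} {Y Y' : ℝ → H →L[ℂ] H}

theorem IsPrim.congr {E : Type*} [NormedAddCommGroup E] [NormedSpace ℝ E] (hJ : J.OrdConnected)
    {u u' v v' : ℝ → E} (h : IsPrim J v v') (e : EqOn u v J) (e' : EqOn u' v' J) :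
    IsPrim J u u' := by
  have h1 : IsPrim J v u' := h.congr_ae hJ
    (ae_restrict_of_forall_mem hJ.measurableSet fun x hx => (e' hx).symm)
  exact ⟨h1.locInt, fun x hx t ht => by rw [e hx, e ht, h1.sub_eq x hx t ht]⟩

omit [CompleteSpace H] in
theorem Sol.congr (hJ : J.OrdConnected) {f u u' v v' : ℝ → H} (h : Sol J V z f v v')
    (e : EqOn u v J) (e' : EqOn u' v' J) : Sol J V z f u u' :=
  ⟨h.prim.congr hJ e e', h.prim'.congr hJ e' fun x hx => by simp only [secondDeriv, e hx]⟩

variable (hV : LocPotential J V) (hY : ∀ h, Sol J V z 0 (fun x => Y x h) (fun x => Y' x h))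
include hV hY

theorem opNorm_bound_of_sol {c x : ℝ} (hc : c ∈ J) (hx : x ∈ J) :
    max ‖Y x‖ ‖Y' x‖ ≤
      max ‖Y c‖ ‖Y' c‖ * Real.exp |∫ s in c..x, (1 + ‖V s‖ + ‖z‖)| := by
  have key : ∀ h : H, max ‖Y x h‖ ‖Y' x h‖ ≤
      max ‖Y c‖ ‖Y' c‖ * Real.exp |∫ s in c..x, (1 + ‖V s‖ + ‖z‖)| * ‖h‖ := by
    intro h
    have h1 := (hY h).bound hV LocInt.zero hc hx
    simp only [Pi.zero_apply, norm_zero, intervalIntegral.integral_zero, abs_zero,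
      add_zero] at h1
    have h2 : max ‖Y c h‖ ‖Y' c h‖ ≤ max ‖Y c‖ ‖Y' c‖ * ‖h‖ :=
      max_le ((Y c).le_of_opNorm_le (le_max_left _ _) h)
        ((Y' c).le_of_opNorm_le (le_max_right _ _) h)
    refine h1.trans ?_
    rw [mul_right_comm]
    gcongr
  have h0 : 0 ≤ max ‖Y c‖ ‖Y' c‖ * Real.exp |∫ s in c..x, (1 + ‖V s‖ + ‖z‖)| :=
    mul_nonneg ((norm_nonneg _).trans (le_max_left _ _)) (Real.exp_nonneg _)
  exact max_le (ContinuousLinearMap.opNorm_le_bound _ h0 fun h => (le_max_left _ _).trans (key h))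
    (ContinuousLinearMap.opNorm_le_bound _ h0 fun h => (le_max_right _ _).trans (key h))

/-- As `V` is only weakly measurable, the second derivative need not be integrable in the operator
norm. Still, its vectorwise bounds are uniform over the unit ball, and the resulting bound on Y'(t)
- Y'(s) gives norm continuity. -/
theorem continuousOn_opDeriv_of_sol : ContinuousOn Y' J := by
  refine continuousOn_of_uIcc fun p hp q hq => ?_
  have hA := hV.volterraFamily z
  have hw := hA.integrable p hp q hq
  have hsub := hV.ordConnected.uIcc_subset hp hq
  set K := max ‖Y p‖ ‖Y' p‖ * Real.exp |∫ s in p..q, (1 + ‖V s‖ + ‖z‖)| with hK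
  have hM : 0 ≤ max ‖Y p‖ ‖Y' p‖ := (norm_nonneg _).trans (le_max_left _ _)
  have hK0 : 0 ≤ K := mul_nonneg hM (Real.exp_nonneg _)
  have hYK : ∀ x ∈ uIcc p q, ‖Y x‖ ≤ K := fun x hx => by
    refine (le_max_left _ _).trans ((opNorm_bound_of_sol hV hY hp (hsub hx)).trans ?_)
    have := hA.abs_integral_mono hp hq hx
    rw [hK]
    gcongr
  have hd : ∀ s ∈ uIcc p q, ∀ t ∈ uIcc p q,
      ‖Y' t - Y' s‖ ≤ K * |∫ x in s..t, (1 + ‖V x‖ + ‖z‖)| := by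
    intro s hs t ht
    refine ContinuousLinearMap.opNorm_le_bound _ (by positivity) fun h => ?_
    have h1 := (hY h).prim'.dist_le hV.ordConnected hp hq (hw.const_mul (K * ‖h‖)) hs ht
      fun x hx => by
        have h2 : ‖Y x h‖ ≤ K * ‖h‖ := (Y x).le_of_opNorm_le (hYK x (uIoc_subset_uIcc hx)) h
        have h3 : ‖V x (Y x h)‖ ≤ ‖V x‖ * (K * ‖h‖) := (V x).le_of_opNorm_le_of_le le_rfl h2
        have h4 : ‖z • Y x h‖ ≤ ‖z‖ * (K * ‖h‖) := by rw [norm_smul]; gcongr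
        have h5 := norm_sub_le (V x (Y x h)) (z • Y x h)
        have h6 : 0 ≤ K * ‖h‖ := by positivity
        simp only [secondDeriv, Pi.zero_apply, sub_zero]
        linarith
    rw [intervalIntegral.integral_const_mul, abs_mul, abs_of_nonneg (by positivity)] at h1
    rw [sub_apply]
    exact h1.trans_eq (by ring)
  intro s hs
  have h1 : ContinuousOn (fun t => ∫ x in s..t, (1 + ‖V x‖ + ‖z‖)) (uIcc p q) :=
    intervalIntegral.continuousOn_primitive_interval' hw hs
  have h2 : Tendsto (fun t => K * |∫ x in s..t, (1 + ‖V x‖ + ‖z‖)|) (𝓝[uIcc p q] s) (𝓝 0) := by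
    have := (h1 s hs).tendsto.abs.const_mul K
    simpa using this
  refine tendsto_iff_norm_sub_tendsto_zero.2 (squeeze_zero' ?_ ?_ h2)
  · exact Eventually.of_forall fun _ => norm_nonneg _
  · filter_upwards [self_mem_nhdsWithin] with t ht using hd s hs t ht

/-- Norm continuity of `Y'` makes it integrable in operator norm. Norm differentiability of `Y` is
needed because taking adjoints preserves norm limits but in general not strong ones. -/
theorem isPrim_op_of_sol : IsPrim J Y Y' := by
  have hl := locInt_of_continuousOn hV.ordConnected (continuousOn_opDeriv_of_sol hV hY)
  refine ⟨hl, fun x hx t ht => ContinuousLinearMap.ext fun h => ?_⟩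
  rw [ContinuousLinearMap.intervalIntegral_apply (hl x hx t ht), sub_apply]
  exact (hY h).prim.sub_eq x hx t ht

end localTheory

variable {a : ℝ} {b : EReal} {V : ℝ → H →L[ℂ] H} {z : ℂ}

theorem exists_op_sol {J : Set ℝ} (hV : LocPotential J V) (z : ℂ) {c : ℝ} (hc : c ∈ J)
    (Y₀ Y₁ : H →L[ℂ] H) : ∃ Y Y' : ℝ → H →L[ℂ] H,
      (∀ h, Sol J V z 0 (fun x => Y x h) (fun x => Y' x h)) ∧ Y c = Y₀ ∧ Y' c = Y₁ := by
  have hb : ∀ x ∈ J, ∀ h, max ‖ivp hV z hc (Y₀ h) (Y₁ h) x‖ ‖ivpDeriv hV z hc (Y₀ h) (Y₁ h) x‖ ≤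
      max ‖Y₀‖ ‖Y₁‖ * Real.exp |∫ s in c..x, (1 + ‖V s‖ + ‖z‖)| * ‖h‖ := by
    intro x hx h
    refine (ivp_bound hV z hc (Y₀ h) (Y₁ h) hx).trans ?_
    have h2 : max ‖Y₀ h‖ ‖Y₁ h‖ ≤ max ‖Y₀‖ ‖Y₁‖ * ‖h‖ :=
      max_le (Y₀.le_of_opNorm_le (le_max_left _ _) h) (Y₁.le_of_opNorm_le (le_max_right _ _) h)
    rw [mul_right_comm]
    gcongr
  have hE : ∀ x, ∃ A B : H →L[ℂ] H, x ∈ J → ∀ h,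
      A h = ivp hV z hc (Y₀ h) (Y₁ h) x ∧ B h = ivpDeriv hV z hc (Y₀ h) (Y₁ h) x := by
    intro x
    by_cases hx : x ∈ J
    · refine ⟨LinearMap.mkContinuous
        { toFun := fun h => ivp hV z hc (Y₀ h) (Y₁ h) x
          map_add' := fun h k => by simp only [map_add, (ivp_add hV z hc _ _ _ _ hx).1]
          map_smul' := fun t h => by
            simp only [map_smul, (ivp_smul hV z hc t _ _ hx).1, RingHom.id_apply] } _
        fun h => (le_max_left _ _).trans (hb x hx h), LinearMap.mkContinuous
        { toFun := fun h => ivpDeriv hV z hc (Y₀ h) (Y₁ h) x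
          map_add' := fun h k => by simp only [map_add, (ivp_add hV z hc _ _ _ _ hx).2]
          map_smul' := fun t h => by
            simp only [map_smul, (ivp_smul hV z hc t _ _ hx).2, RingHom.id_apply] } _
        fun h => (le_max_right _ _).trans (hb x hx h), fun _ h => ⟨rfl, rfl⟩⟩
    · exact ⟨0, 0, fun h => absurd h hx⟩
  choose Y Y' hY using hE
  refine ⟨Y, Y', fun h => (sol_ivp hV z hc (Y₀ h) (Y₁ h)).congr hV.ordConnected
    (fun x hx => (hY x hx h).1) (fun x hx => (hY x hx h).2), ?_, ?_⟩
  · exact ContinuousLinearMap.ext fun h => by rw [(hY c hc h).1, ivp_base]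
  · exact ContinuousLinearMap.ext fun h => by rw [(hY c hc h).2, ivpDeriv_base]

/-- The fields `left` and `left_deriv` fix the values at `a` itself, so that the solution property
extends from (a, b) to [a, b). -/
theorem IsOpSolution.sol (hab : (a : EReal) < b) (hV : LocPotential (ivlC a b) V)
    {Y₀ Y₁ : H →L[ℂ] H} {Y Y' : ℝ → H →L[ℂ] H} (hY : IsOpSolution a b V z Y₀ Y₁ Y Y') (h : H) :
    Sol (ivlC a b) V z 0 (fun x => Y x h) (fun x => Y' x h) := by
  obtain ⟨y'', hw, ht⟩ := hY.solution h
  obtain ⟨v, v', hv, e, e'⟩ := hw.exists_sol hab hV (f := 0) (z := z) LocInt.zero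
      (by simpa using ht)
  obtain ⟨b0, b1⟩ := (hY.boundary h).eq hab hv e e'
  have hcase : ∀ x ∈ ivlC a b, x = a ∨ x ∈ ivl a b := fun x hx =>
    hx.1.eq_or_lt.imp Eq.symm fun hl => ⟨hl, hx.2⟩
  refine hv.congr hV.ordConnected (fun x hx => ?_) (fun x hx => ?_)
  · rcases hcase x hx with rfl | hx
    · simpa only [hY.left] using b0
    · exact e hx
  · rcases hcase x hx with rfl | hx
    · simpa only [hY.left_deriv] using b1
    · exact e' hx

/-- `opSolution` is a norm-differentiable solution on `[a, b)` of the initial value problem. -/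
theorem exists_deriv_opSolution (hab : (a : EReal) < b) (hV : LocPotential (ivlC a b) V) (z : ℂ)
    (Y₀ Y₁ : H →L[ℂ] H) : ∃ Y' : ℝ → H →L[ℂ] H,
      IsPrim (ivlC a b) (opSolution a b V z Y₀ Y₁) Y' ∧ ContinuousOn Y' (ivlC a b) ∧
      opSolution a b V z Y₀ Y₁ a = Y₀ ∧ Y' a = Y₁ := by
  have hex : ∃ Y Y' : ℝ → H →L[ℂ] H, IsOpSolution a b V z Y₀ Y₁ Y Y' := by
    obtain ⟨Y, Y', hY, h0, h1⟩ := exists_op_sol hV z (left_mem_ivlC hab) Y₀ Y₁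
    refine ⟨Y, Y', fun h => ⟨_, (hY h).isW21Loc, ?_⟩, fun h => ?_, h0, h1⟩
    · rw [tau_secondDeriv]
      exact Eventually.of_forall fun x => by simp
    · rw [← h0, ← h1]
      exact (hY h).hasBoundaryValues hab
  rw [opSolution, dif_pos hex]
  obtain ⟨Y', hY⟩ := hex.choose_spec
  have hs := hY.sol hab hV
  exact ⟨Y', isPrim_op_of_sol hV hs, continuousOn_opDeriv_of_sol hV hs, hY.left, hY.left_deriv⟩

end operatorSolutions

/-! ### Corner values of the Green's function. -/

section greenFunction

variable {H : Type*} [NormedAddCommGroup H] [InnerProductSpace ℂ H] [CompleteSpace H]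
variable {a : ℝ} {b : EReal} {V : ℝ → H →L[ℂ] H} {α : H →L[ℂ] H} {z : ℂ}

open ContinuousLinearMap (adjoint)

theorem tendsto_nhdsGT_of_continuousOn_ivlC {E : Type*} [TopologicalSpace E]
    (hab : (a : EReal) < b) {f : ℝ → E} (hf : ContinuousOn f (ivlC a b)) :
    Tendsto f (𝓝[>] a) (𝓝 (f a)) := by
  have hmem : ivlC a b ∈ 𝓝[>] a := by
    obtain ⟨c, hc⟩ := exists_mem_ivl hab
    filter_upwards [Ioo_mem_nhdsGT hc.1] with x hx
    exact ⟨hx.1.le, (EReal.coe_lt_coe_iff.2 hx.2).trans hc.2⟩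
  exact (hf a (left_mem_ivlC hab)).mono_left (nhdsWithin_le_iff.2 hmem)

theorem isStrongCornerLimit_mul {F G : ℝ → H →L[ℂ] H} {A B : H →L[ℂ] H}
    (hF : Tendsto F (𝓝[>] a) (𝓝 A)) (hG : Tendsto G (𝓝[>] a) (𝓝 B)) :
    IsStrongCornerLimit a (fun x x' => F x * adjoint (G x')) (A * adjoint B) := by
  intro h
  have hc : 𝓝[{p : ℝ × ℝ | a < p.1 ∧ p.1 < p.2}] ((a, a) : ℝ × ℝ) ≤ 𝓝[>] a ×ˢ 𝓝[>] a := by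
    rw [← nhdsWithin_prod_eq]
    exact nhdsWithin_mono _ fun p hp => ⟨hp.1, hp.1.trans hp.2⟩
  have h1 : Tendsto (fun p : ℝ × ℝ => F p.1)
      (𝓝[{p : ℝ × ℝ | a < p.1 ∧ p.1 < p.2}] (a, a)) (𝓝 A) := (hF.comp tendsto_fst).mono_left hc
  have h2 : Tendsto (fun p : ℝ × ℝ => adjoint (G p.2))
      (𝓝[{p : ℝ × ℝ | a < p.1 ∧ p.1 < p.2}] (a, a)) (𝓝 (adjoint B)) :=
    ((adjoint.continuous.tendsto B).comp (hG.comp tendsto_snd)).mono_left hc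
  exact ((ContinuousLinearMap.apply ℂ H h).continuous.tendsto _).comp (h1.mul h2)

/-- For x < x' the kernel is the product φ(z, x)ψ(z̄, x')*, so derivatives and limits are taken
factor by factor. The adjoint turns m(z̄) into m(z) by `adjoint_weylM_conj`. -/
theorem exists_corner_green [TopologicalSpace.SeparableSpace H] (hab : (a : EReal) < b)
    (hV : IsPotential a b V) (hα : IsSelfAdjoint α) (hz : z.im ≠ 0) :
    HasCornerDerivatives a b (green a b V α z)
      (opCos α * (opCos α - weylM a b V α z * opSin α))
      (-opSin α * (opSin α + weylM a b V α z * opCos α))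
      (opCos α * (opSin α + weylM a b V α z * opCos α)) ∧
    green a b V α z a a = -opSin α * (opCos α - weylM a b V α z * opSin α) := by
  have hP := hV.locPotential
  have hS := isSelfAdjoint_opSin α
  have hC := isSelfAdjoint_opCos α
  set m := weylM a b V α z with hm
  set w := starRingEnd ℂ z with hw
  have hmw : adjoint (weylM a b V α w) = m := adjoint_weylM_conj hab hV hα hz
  obtain ⟨φ', hφ, hφc, hφ0, hφ1⟩ := exists_deriv_opSolution hab hP z (-opSin α) (opCos α)
  obtain ⟨χ', hχ, hχc, hχ0, hχ1⟩ := exists_deriv_opSolution hab hP w (-opSin α) (opCos α)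
  obtain ⟨θ', hθ, hθc, hθ0, hθ1⟩ := exists_deriv_opSolution hab hP w (opCos α) (opSin α)
  set ψ' : ℝ → H →L[ℂ] H := fun x => θ' x + χ' x * weylM a b V α w with hψ'
  have hψd : ∀ x ∈ ivl a b, HasDerivAt (psi a b V α w) (ψ' x) x := fun x hx => by
    have hn : ivlC a b ∈ 𝓝 x :=
      mem_of_superset ((isOpen_ivl a b).mem_nhds hx) ivl_subset_ivlC
    exact (hθ.hasDerivAt hθc hn).add ((hχ.hasDerivAt hχc hn).mul_const _)
  have hφd : ∀ x ∈ ivl a b, HasDerivAt (phi a b V α z) (φ' x) x := fun x hx =>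
    hφ.hasDerivAt hφc (mem_of_superset ((isOpen_ivl a b).mem_nhds hx) ivl_subset_ivlC)
  have lφ : Tendsto (phi a b V α z) (𝓝[>] a) (𝓝 (-opSin α)) := by
    have := tendsto_nhdsGT_of_continuousOn_ivlC hab (hφ.continuousOn hP.ordConnected)
    rwa [hφ0] at this
  have lφ' : Tendsto φ' (𝓝[>] a) (𝓝 (opCos α)) := by
    have := tendsto_nhdsGT_of_continuousOn_ivlC hab hφc
    rwa [hφ1] at this
  have lψ : Tendsto (psi a b V α w) (𝓝[>] a) (𝓝 (opCos α + -opSin α * weylM a b V α w)) := by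
    have h1 := tendsto_nhdsGT_of_continuousOn_ivlC hab (hθ.continuousOn hP.ordConnected)
    have h2 := tendsto_nhdsGT_of_continuousOn_ivlC hab (hχ.continuousOn hP.ordConnected)
    rw [hθ0] at h1
    rw [hχ0] at h2
    exact h1.add (h2.mul_const _)
  have lψ' : Tendsto ψ' (𝓝[>] a) (𝓝 (opSin α + opCos α * weylM a b V α w)) := by
    have h1 := tendsto_nhdsGT_of_continuousOn_ivlC hab hθc
    have h2 := tendsto_nhdsGT_of_continuousOn_ivlC hab hχc
    rw [hθ1] at h1
    rw [hχ1] at h2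
    exact h1.add (h2.mul_const _)
  have eψ : adjoint (opCos α + -opSin α * weylM a b V α w) = opCos α - m * opSin α := by
    rw [← hmw, ← ContinuousLinearMap.star_eq_adjoint, ← ContinuousLinearMap.star_eq_adjoint,
      star_add, star_mul, star_neg, hS.star_eq, hC.star_eq, mul_neg, sub_eq_add_neg]
  have eψ' : adjoint (opSin α + opCos α * weylM a b V α w) = opSin α + m * opCos α := by
    rw [← hmw, ← ContinuousLinearMap.star_eq_adjoint, ← ContinuousLinearMap.star_eq_adjoint,
      star_add, star_mul, hS.star_eq, hC.star_eq]
  refine ⟨⟨fun x x' => φ' x * adjoint (psi a b V α w x'),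
    fun x x' => phi a b V α z x * adjoint (ψ' x'), fun x x' => φ' x * adjoint (ψ' x'),
    fun x x' hax hxx' hb h => ?_, ?_, ?_, ?_⟩, ?_⟩
  · have hx : x ∈ ivl a b := ⟨hax, (EReal.coe_lt_coe_iff.2 hxx').trans hb⟩
    have hx' : x' ∈ ivl a b := ⟨hax.trans hxx', hb⟩
    have happ : ∀ {F : ℝ → H →L[ℂ] H} {F' : H →L[ℂ] H} {t : ℝ}, HasDerivAt F F' t →
        HasDerivAt (fun s => F s h) (F' h) t := fun hF =>
      ((ContinuousLinearMap.apply ℂ H h).restrictScalars ℝ).hasFDerivAt.comp_hasDerivAt _ hF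
    refine ⟨?_, ?_, ?_⟩
    · refine (happ ((hφd x hx).mul_const (adjoint (psi a b V α w x')))).congr_of_eventuallyEq ?_
      filter_upwards [Iio_mem_nhds hxx'] with s hs
      rw [green, if_pos (le_of_lt hs)]
    · refine (happ (((hψd x' hx').star).const_mul (phi a b V α z x))).congr_of_eventuallyEq ?_
      filter_upwards [Ioi_mem_nhds hxx'] with s hs
      rw [green, if_pos (le_of_lt hs)]
      rfl
    · exact happ ((hφd x hx).mul_const (adjoint (ψ' x')))
  · rw [← eψ]
    exact isStrongCornerLimit_mul lφ' lψ
  · rw [← eψ']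
    exact isStrongCornerLimit_mul lφ lψ'
  · rw [← eψ']
    exact isStrongCornerLimit_mul lφ' lψ'
  · rw [green, if_pos le_rfl, ← eψ, psi, phi, theta, phi, hφ0, hχ0, hθ0]

/-- The matrix is the column (-S, C) times the row (C - mS, S + mC). The expression becomes (C² +
S²)((C - mS)(-S) + (S + mC)C), which equals m by SC = CS and C² + S² = 1. -/
theorem corner_matrix_identity (hα : IsSelfAdjoint α) (m : H →L[ℂ] H) :
    ![-opSin α, opCos α] ⬝ᵥ Matrix.mulVec
      !![-opSin α * (opCos α - m * opSin α), -opSin α * (opSin α + m * opCos α);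
        opCos α * (opCos α - m * opSin α), opCos α * (opSin α + m * opCos α)]
      ![-opSin α, opCos α] = m := by
  have h1 := opSin_mul_opCos α
  have h2 := opCos_mul_self_add hα
  simp only [Matrix.mulVec, dotProduct, Fin.sum_univ_two, Matrix.of_apply, Matrix.cons_val_zero,
    Matrix.cons_val_one, Matrix.cons_val', Matrix.cons_val_fin_one]
  generalize opSin α = S at *
  generalize opCos α = C at *
  have e : (C - m * S) * -S + (S + m * C) * C = m := by
    have : (C - m * S) * -S + (S + m * C) * C = (S * C - C * S) + m * (C * C + S * S) := by
      noncomm_ring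
    rw [this, h1, h2, sub_self, zero_add, mul_one]
  have : -S * (-S * (C - m * S) * -S + -S * (S + m * C) * C)
      + C * (C * (C - m * S) * -S + C * (S + m * C) * C)
      = (C * C + S * S) * ((C - m * S) * -S + (S + m * C) * C) := by noncomm_ring
  rw [this, e, h2, one_mul]

end greenFunction

/-! ### Nonconstancy of the Weyl–Titchmarsh function. -/

section nonconstant

variable {H : Type*} [NormedAddCommGroup H] [InnerProductSpace ℂ H]
variable {a : ℝ} {b : EReal} {V : ℝ → H →L[ℂ] H} {α : H →L[ℂ] H} {z : ℂ}

theorem L2_norm_sq_eq_integral (x : L2 H a b) : ‖x‖ ^ 2 = ∫ t, ‖x t‖ ^ 2 ∂(ivlMeasure a b) := by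
  have h := L2.inner_def (𝕜 := ℂ) x x
  simp only [inner_self_eq_norm_sq_to_K] at h
  have h2 : ∫ t, ((‖x t‖ : ℂ) ^ 2) ∂(ivlMeasure a b)
      = ((∫ t, ‖x t‖ ^ 2 ∂(ivlMeasure a b) : ℝ) : ℂ) := by
    rw [← integral_complex_ofReal]
    simp
  have h3 : ((‖x‖ ^ 2 : ℝ) : ℂ) = ((∫ t, ‖x t‖ ^ 2 ∂(ivlMeasure a b) : ℝ) : ℂ) := by
    rw [← h2]
    push_cast
    exact h
  exact_mod_cast h3

theorem mul_sq_le_L2_norm_sq {c r : ℝ} (hc : c ∈ ivl a b) (hr : 0 ≤ r) {x : L2 H a b} {u : ℝ → H}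
    (hx : x =ᵐ[ivlMeasure a b] u) (hu : ∀ t ∈ Ioc a c, r ≤ ‖u t‖) :
    (c - a) * r ^ 2 ≤ ‖x‖ ^ 2 := by
  have hint : Integrable (fun t => ‖x t‖ ^ 2) (ivlMeasure a b) :=
    (Lp.memLp x).integrable_norm_pow (p := 2) two_ne_zero
  have hintc : IntegrableOn (fun t => ‖x t‖ ^ 2) (Ioc a c) :=
    hint.mono_measure (Measure.restrict_mono (Ioc_subset_ivl hc) le_rfl)
  have hxc := ae_restrict_of_ae (s := Ioc a c) hx
  rw [restrict_Ioc_ivlMeasure hc] at hxc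
  rw [L2_norm_sq_eq_integral]
  calc (c - a) * r ^ 2 = ∫ _ in Ioc a c, r ^ 2 := by
        rw [setIntegral_const, Real.volume_real_Ioc_of_le hc.1.le, smul_eq_mul]
    _ ≤ ∫ t in Ioc a c, ‖x t‖ ^ 2 := by
        refine integral_mono_ae (integrable_const _) hintc ?_
        filter_upwards [hxc, ae_restrict_mem measurableSet_Ioc] with t ht htm
        simp only [ht]
        have := hu t htm
        gcongr
    _ ≤ ∫ t, ‖x t‖ ^ 2 ∂(ivlMeasure a b) :=
        setIntegral_mono_set hint (Eventually.of_forall fun t => sq_nonneg _)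
          (Ioc_subset_ivl hc).eventuallyLE

variable [CompleteSpace H]

/-- On an interval of length `δ ≲ |z|^{-1/2}`, a solution stays close to its initial value. -/
theorem Sol.half_norm_le {J : Set ℝ} (hV : LocPotential J V) {u u' : ℝ → H}
    (h : Sol J V z 0 u u') {δ v : ℝ} (hδ : 0 ≤ δ) (ha : a ∈ J) (hc : a + δ ∈ J)
    (hv : ∫ t in a..a + δ, ‖V t‖ ≤ v) (hsmall : δ * (v + ‖z‖ * δ) ≤ 1 / 4)
    (hu' : δ * ‖u' a‖ ≤ ‖u a‖ / 8) {x : ℝ} (hx : x ∈ Icc a (a + δ)) : ‖u a‖ / 2 ≤ ‖u x‖ := by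
  have hle : a ≤ a + δ := by linarith
  have hI : uIcc a (a + δ) = Icc a (a + δ) := uIcc_of_le hle
  have hsub : Icc a (a + δ) ⊆ J := hI ▸ hV.ordConnected.uIcc_subset ha hc
  have haI : a ∈ Icc a (a + δ) := left_mem_Icc.2 hle
  obtain ⟨s, hs, hmax⟩ := isCompact_Icc.exists_isMaxOn ⟨a, haI⟩
    ((h.prim.continuousOn hV.ordConnected).mono hsub).norm
  set N := ‖u s‖ with hN
  have hN0 : 0 ≤ N := norm_nonneg _
  have hub : ∀ t ∈ Icc a (a + δ), ‖u t‖ ≤ N := fun t ht => hmax ht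
  have hw : IntervalIntegrable (fun t => N * (‖V t‖ + ‖z‖)) volume a (a + δ) :=
    ((hV.locInt a ha _ hc).add intervalIntegrable_const).const_mul N
  have hwt : ∫ t in a..a + δ, N * (‖V t‖ + ‖z‖) ≤ N * (v + ‖z‖ * δ) := by
    rw [intervalIntegral.integral_const_mul, intervalIntegral.integral_add
      (hV.locInt a ha _ hc) intervalIntegrable_const, intervalIntegral.integral_const,
      smul_eq_mul, add_sub_cancel_left, mul_comm δ]
    gcongr
  have h1 : ∀ t ∈ Icc a (a + δ), ‖u' t‖ ≤ ‖u' a‖ + N * (v + ‖z‖ * δ) := by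
    intro t ht
    have e := h.prim'.dist_le hV.ordConnected ha hc hw left_mem_uIcc (hI ▸ ht) fun r hr => by
      have hr' : r ∈ Icc a (a + δ) := hI ▸ uIoc_subset_uIcc hr
      have h2 : ‖V r (u r)‖ ≤ ‖V r‖ * N := (V r).le_of_opNorm_le_of_le le_rfl (hub r hr')
      have h4 : ‖z • u r‖ ≤ ‖z‖ * N := by rw [norm_smul]; gcongr; exact hub r hr'
      have h5 := norm_sub_le (V r (u r)) (z • u r)
      simp only [secondDeriv, Pi.zero_apply, sub_zero]
      linarith
    have e2 : |∫ r in a..t, N * (‖V r‖ + ‖z‖)| ≤ N * (v + ‖z‖ * δ) := by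
      refine le_trans ?_ hwt
      rw [abs_of_nonneg (intervalIntegral.integral_nonneg ht.1 fun r _ => by positivity)]
      exact intervalIntegral.integral_mono_interval le_rfl ht.1 ht.2
        (Eventually.of_forall fun r => by positivity) hw
    have e3 := norm_sub_norm_le (u' t) (u' a)
    linarith
  have h2 : ∀ t ∈ Icc a (a + δ), ‖u t - u a‖ ≤ ‖u a‖ / 8 + N / 4 := by
    intro t ht
    have e := h.prim.dist_le hV.ordConnected ha hc
      (w := fun _ => ‖u' a‖ + N * (v + ‖z‖ * δ)) intervalIntegrable_const left_mem_uIcc (hI ▸ ht)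
      fun r hr => h1 r (hI ▸ uIoc_subset_uIcc hr)
    have hC : 0 ≤ ‖u' a‖ + N * (v + ‖z‖ * δ) := (norm_nonneg _).trans (h1 t ht)
    rw [intervalIntegral.integral_const, smul_eq_mul, abs_mul, abs_of_nonneg hC,
      abs_of_nonneg (sub_nonneg.2 ht.1)] at e
    have e2 : (t - a) * (‖u' a‖ + N * (v + ‖z‖ * δ)) ≤ δ * (‖u' a‖ + N * (v + ‖z‖ * δ)) := by
      gcongr
      linarith [ht.2]
    nlinarith [mul_le_mul_of_nonneg_left hsmall hN0]
  -- At the maximum point the deviation bound gives N ≤ (3/2)‖u(a)‖; inserted again, it bounds the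
  -- deviation by (1/8 + 3/8)‖u(a)‖.
  have e1 := h2 s hs
  have e2 := h2 x hx
  have e3 := norm_sub_norm_le (u s) (u a)
  have e4 := norm_sub_norm_le (u a) (u x)
  rw [norm_sub_rev] at e4
  linarith

/-- If m were constant, the Cauchy data (u₀, u₁) of ψ(z)h and K = Im z ‖ψ(z)h‖² would not depend on
z. For z = i/(8δ²), ‖ψ(z)h‖ is at least ‖u₀‖/2 on (a, a + δ), so δ‖u₀‖²/4 ≤ 8Kδ², and δ → 0 forces
u₀ = 0. Then K = 0, hence ψ(i)h = 0, u₁ = 0 and h = 0. -/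
theorem exists_weylM_ne [TopologicalSpace.SeparableSpace H] [Nontrivial H] (hab : (a : EReal) < b)
    (hV : IsPotential a b V) (hα : IsSelfAdjoint α) :
    ∃ z w : ℂ, 0 < z.im ∧ 0 < w.im ∧ weylM a b V α z ≠ weylM a b V α w := by
  by_contra! hcon
  have hP := hV.locPotential
  have haJ := left_mem_ivlC hab
  set m := weylM a b V α Complex.I with hm
  have hconst : ∀ z : ℂ, 0 < z.im → weylM a b V α z = m := fun z hz =>
    hcon z Complex.I hz (by simp)
  obtain ⟨h, hh⟩ := exists_ne (0 : H)
  set u₀ := psiInit a b V α Complex.I h with hu₀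
  set u₁ := psiInit' a b V α Complex.I h with hu₁
  set K := (inner ℂ h (m h)).im with hK
  have hdata : ∀ z : ℂ, 0 < z.im → psiSol hab hP α z h a = u₀ ∧ psiSolDeriv hab hP α z h a = u₁ := by
    intro z hz
    rw [psiSol, psiSolDeriv, ivp_base, ivpDeriv_base, hu₀, hu₁, psiInit, psiInit', psiInit,
      psiInit', hconst z hz]
    exact ⟨rfl, rfl⟩
  have hnorm : ∀ z : ℂ, 0 < z.im → ∃ x : L2 H a b,
      x =ᵐ[ivlMeasure a b] psiSol hab hP α z h ∧ K = z.im * ‖x‖ ^ 2 := by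
    intro z hz
    obtain ⟨Ψ, hΨ⟩ := exists_psiOp hab hV hα hz.ne'
    refine ⟨Ψ h, hΨ h, ?_⟩
    rw [hK, ← hconst z hz]
    exact im_inner_weylM hab hV hα hΨ h
  obtain ⟨c, hc⟩ := exists_mem_ivl hab
  have hcJ := ivl_subset_ivlC hc
  set v := ∫ t in a..c, ‖V t‖ with hv
  have hv0 : 0 ≤ v := intervalIntegral.integral_nonneg hc.1.le fun _ _ => norm_nonneg _
  have key : ∀ᶠ δ in 𝓝[>] (0 : ℝ), ‖u₀‖ ^ 2 ≤ 32 * K * δ := by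
    have t0 : ∀ k : ℝ, Tendsto (fun δ : ℝ => δ * k) (𝓝[>] 0) (𝓝 0) := fun k => by
      have : Tendsto (fun δ : ℝ => δ * k) (𝓝 0) (𝓝 (0 * k)) := tendsto_id.mul_const k
      rw [zero_mul] at this
      exact this.mono_left nhdsWithin_le_nhds
    -- The case u₀ = 0 is kept apart: there the first alternative would force u₁ = 0, while the
    -- estimate sought is trivial.
    have hu : ∀ᶠ δ in 𝓝[>] (0 : ℝ), δ * ‖u₁‖ ≤ ‖u₀‖ / 8 ∨ u₀ = 0 := by
      by_cases h0 : u₀ = 0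
      · exact Eventually.of_forall fun _ => Or.inr h0
      · filter_upwards [(t0 ‖u₁‖).eventually_le_const
          (show 0 < ‖u₀‖ / 8 by have := norm_pos_iff.2 h0; positivity)] with δ hδ using Or.inl hδ
    filter_upwards [self_mem_nhdsWithin, hu, (t0 v).eventually_le_const
      (show (0 : ℝ) < 1 / 8 by norm_num),
      (t0 1).eventually_le_const (sub_pos.2 hc.1)] with δ hδ h1 h2 h3
    have hδ0 : 0 < δ := hδ
    -- This makes |z|δ² = 1/8; together with δv ≤ 1/8 it gives the smallness condition of
    -- `Sol.half_norm_le`.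
    set z : ℂ := ((1 / (8 * δ ^ 2) : ℝ) : ℂ) * Complex.I with hz
    have hzim : z.im = 1 / (8 * δ ^ 2) := by rw [hz, Complex.im_ofReal_mul, Complex.I_im, mul_one]
    have hzn : ‖z‖ = 1 / (8 * δ ^ 2) := by
      rw [hz, norm_mul, Complex.norm_I, mul_one, Complex.norm_real, Real.norm_of_nonneg]
      positivity
    have hz0 : 0 < z.im := by rw [hzim]; positivity
    obtain ⟨x, hx, hKx⟩ := hnorm z hz0
    rcases h1 with h1 | h1
    · have hδc : a + δ ≤ c := by linarith
      have hcδ : a + δ ∈ ivl a b :=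
        ⟨by linarith, (EReal.coe_le_coe_iff.2 hδc).trans_lt hc.2⟩
      have hvδ : ∫ t in a..a + δ, ‖V t‖ ≤ v :=
        intervalIntegral.integral_mono_interval le_rfl (by linarith) hδc
          (Eventually.of_forall fun _ => norm_nonneg _) (hP.locInt a haJ c hcJ)
      obtain ⟨e0, e1⟩ := hdata z hz0
      have hlow := mul_sq_le_L2_norm_sq hcδ (r := ‖u₀‖ / 2) (by positivity) hx fun t ht => by
        have := (sol_psiSol hab hP (α := α) z h).half_norm_le hP hδ0.le haJ
          (ivl_subset_ivlC hcδ) hvδ ?_ ?_ (Ioc_subset_Icc_self ht)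
        · rwa [e0] at this
        · rw [hzn, mul_add, show δ * (1 / (8 * δ ^ 2) * δ) = 1 / 8 by field_simp]
          linarith
        · rwa [e0, e1]
      have hxn : ‖x‖ ^ 2 = 8 * K * δ ^ 2 := by
        rw [hKx, hzim]
        field_simp
      rw [hxn, add_sub_cancel_left] at hlow
      have : δ * (‖u₀‖ ^ 2) ≤ δ * (32 * K * δ) := by linarith
      exact le_of_mul_le_mul_left this hδ0
    · have hK0 : 0 ≤ K := by rw [hKx]; positivity
      rw [h1, norm_zero, zero_pow two_ne_zero]
      positivity
  have hu0 : u₀ = 0 := by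
    have t1 : Tendsto (fun δ : ℝ => 32 * K * δ) (𝓝[>] 0) (𝓝 0) := by
      have : Tendsto (fun δ : ℝ => 32 * K * δ) (𝓝 0) (𝓝 (32 * K * 0)) := tendsto_id.const_mul _
      rw [mul_zero] at this
      exact this.mono_left nhdsWithin_le_nhds
    have := ge_of_tendsto t1 key
    exact norm_eq_zero.1 (pow_eq_zero_iff two_ne_zero |>.1 (le_antisymm this (sq_nonneg _)))
  have hI : (0 : ℝ) < Complex.I.im := by simp
  obtain ⟨x, hx, hKx⟩ := hnorm Complex.I hI
  have hs := sol_psiSol hab hP (α := α) Complex.I h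
  obtain ⟨e0, e1⟩ := hdata Complex.I hI
  have b1 := bc1_psiSol hab hP hα Complex.I h
  have b2 := bc2_psiSol hab hP hα Complex.I h
  rw [e0, e1] at b1 b2
  -- With u₀ = 0 the boundary form (u₀, u₁) - (u₁, u₀), which is 2iK in rotated coordinates,
  -- vanishes.
  have hK0 : K = 0 := by
    have e := symplectic_bc hα u₀ u₁ u₀ u₁
    rw [b1, b2, hu0, inner_zero_left, inner_zero_right, sub_zero, ← hm] at e
    have e' := congrArg Complex.im e
    rw [Complex.zero_im, Complex.sub_im, ← inner_conj_symm (m h) h, Complex.conj_im] at e'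
    linarith
  have hx0 : ‖x‖ = 0 := by
    rw [hK0, Complex.I_im, one_mul] at hKx
    exact pow_eq_zero_iff two_ne_zero |>.1 hKx.symm
  obtain ⟨C, -, hC⟩ := exists_data_bound_L2 hV hab Complex.I
  have hb := hC _ _ x hs hx
  rw [hx0, mul_zero, e0, e1] at hb
  have hu1 : u₁ = 0 := norm_le_zero_iff.1 ((le_max_right _ _).trans hb)
  rw [hu0, hu1, bc1, map_zero, map_zero, add_zero] at b1
  exact hh b1.symm

end nonconstant

end WeylTitchmarsh

end

/-! ### The main theorem. -/

theorem theorem3p17 {H : Type*} [NormedAddCommGroup H] [InnerProductSpace ℂ H] [CompleteSpace H]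
    [TopologicalSpace.SeparableSpace H] (a : ℝ) (b : EReal) (V : ℝ → H →L[ℂ] H)
    (hab : (a : EReal) < b) (hV : WeylTitchmarsh.IsPotential a b V)
    (α β : H →L[ℂ] H) (hα : IsSelfAdjoint α) (hβ : IsSelfAdjoint β) :
    -- `m_α` is a well-defined `B(H)`-valued function on the nonreal numbers
    (∀ z : ℂ, z.im ≠ 0 →
      WeylTitchmarsh.IsWeylM a b V α z (WeylTitchmarsh.weylM a b V α z)) ∧
    -- it is a (nonconstant) operator-valued Herglotz function
    WeylTitchmarsh.IsHerglotz (WeylTitchmarsh.weylM a b V α) ∧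
    (Nontrivial H → ∃ z w : ℂ, 0 < z.im ∧ 0 < w.im ∧
      WeylTitchmarsh.weylM a b V α z ≠ WeylTitchmarsh.weylM a b V α w) ∧
    -- representation through the Green's function
    (∀ z : ℂ, z.im ≠ 0 → ∃ Gx Gx' Gxx' : H →L[ℂ] H,
      WeylTitchmarsh.HasCornerDerivatives a b (WeylTitchmarsh.green a b V α z) Gx Gx' Gxx' ∧
      WeylTitchmarsh.weylM a b V α z =
        ![-WeylTitchmarsh.opSin α, WeylTitchmarsh.opCos α] ⬝ᵥ
          Matrix.mulVec !![WeylTitchmarsh.green a b V α z a a, Gx'; Gx, Gxx']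
            ![-WeylTitchmarsh.opSin α, WeylTitchmarsh.opCos α]) ∧
    -- analytic extension to the resolvent set of `H_α`
    (∃ M : ℂ → H →L[ℂ] H,
      {z : ℂ | z.im ≠ 0} ⊆ WeylTitchmarsh.resolventSet (WeylTitchmarsh.Halpha a b V α) ∧
      AnalyticOnNhd ℂ M (WeylTitchmarsh.resolventSet (WeylTitchmarsh.Halpha a b V α)) ∧
      ∀ z : ℂ, z.im ≠ 0 → M z = WeylTitchmarsh.weylM a b V α z) ∧
    -- linear fractional transformation
    (∀ z : ℂ, z.im ≠ 0 →
      IsUnit (WeylTitchmarsh.rotationMatrix β α 0 0 +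
        WeylTitchmarsh.rotationMatrix β α 0 1 * WeylTitchmarsh.weylM a b V α z) ∧
      WeylTitchmarsh.weylM a b V β z =
        (WeylTitchmarsh.rotationMatrix β α 1 0 +
          WeylTitchmarsh.rotationMatrix β α 1 1 * WeylTitchmarsh.weylM a b V α z) *
        Ring.inverse (WeylTitchmarsh.rotationMatrix β α 0 0 +
          WeylTitchmarsh.rotationMatrix β α 0 1 * WeylTitchmarsh.weylM a b V α z)) := by
  refine ⟨fun z hz => WeylTitchmarsh.isWeylM_weylM hab
      hV hα hz, WeylTitchmarsh.isHerglotz_weylM hab hV hα,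
    fun _ => WeylTitchmarsh.exists_weylM_ne hab hV hα, fun z hz => ?_, ?_,
    fun z hz => WeylTitchmarsh.weylM_transformation hab hV hα hβ hz⟩
  · obtain ⟨hG, h0⟩ := WeylTitchmarsh.exists_corner_green hab hV hα hz
    exact ⟨_, _, _, hG, by rw [h0, WeylTitchmarsh.corner_matrix_identity hα]⟩
  · obtain ⟨M, hM, hMz⟩ := WeylTitchmarsh.exists_analytic_extension hab hV hα
    exact ⟨M, WeylTitchmarsh.nonreal_subset_resolventSet hab hV hα, hM, hMz⟩
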